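/- Let $n\ge 0$, let $\mu=(\mu_1,\dots,\mu_n)$ be a composition (a vector of nonnegative integers), $N=\max_i\mu_i$, $|\mu|=\sum_i\mu_i$, and let $q,t$ be nonzero complex numbers. **Operators and polynomials.** On $\mathbb C[x_1,\dots,x_n]$ let $\mathfrak s_i$ exchange $x_i$ and $x_{i+1}$, let $(\tau_1h)(x_1,\dots,x_n)=h(qx_1,x_2,\dots,x_n)$, and put $$T_i=t-\tfrac{x_i-tx_{i+1}}{x_i-x_{i+1}}(1-\mathfrak s_i),\qquad T_i^{-1}=t^{-1}\Big(1-\tfrac{x_i-tx_{i+1}}{x_i-x_{i+1}}(1-\mathfrak s_i)\Big),$$ $$\omega=\tau_1\mathfrak s_1\cdots\mathfrak s_{n-1},\qquad Y_i=T_{i-1}\cdots T_1\,\omega\,T_{n-1}^{-1}\cdots T_i^{-1},$$ $$y_i(\mu)=q^{\mu_i}t^{\eta_i(\mu)+i-1},\qquad \eta_i(\mu)=-\#\{j<i:\mu_j>\mu_i\}-\#\{j>i:\mu_j\ge\mu_i\}.$$ Likewise let $\tilde T_i=t-\frac{tx_i-x_{i+1}}{x_i-x_{i+1}}(1-\mathfrak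 s_i)$, $\tilde T_i^{-1}=t^{-1}\big(1-\frac{tx_i-x_{i+1}}{x_i-x_{i+1}}(1-\mathfrak s_i)\big)$, $\tilde\omega=\mathfrak s_{n-1}\cdots\mathfrak s_1\tau_1$, $\tilde Y_i=\tilde T_i\cdots\tilde T_{n-1}\,\tilde\omega\,\tilde T_1^{-1}\cdots\tilde T_{i-1}^{-1}$, and $\tilde y_i(\mu)=q^{\mu_i}t^{\tilde\eta_i(\mu)+n-i}$ with $\tilde\eta_i(\mu)=-\#\{j<i:\mu_j\ge\mu_i\}-\#\{j>i:\mu_j>\mu_i\}$. The nonsymmetric Macdonald polynomial $E_\mu(x_1,\dots,x_n;q,t)$ is the unique polynomial of degree at most $|\mu|$ in which $x^\mu=\prod_ix_i^{\mu_i}$ has coefficient $1$ and which satisfies $\tilde Y_iE_\mu=\tilde y_i(\mu)E_\mu$ for all $i$. Put $f_\mu(x_1,\dots,x_n;q,t)=E_{(\mu_n,\dots,\mu_1)}(x_n,\dots,x_1;q,t)$. **Vertex model.** For $\boldsymbol I,\boldsymbol K\in\mathbb N^n$ and $j,\ell\in\{0,\dots,n\}$ (with $\boldsymbol e_0=0$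 and $\boldsymbol e_1,\dots,\boldsymbol e_n$ the unit vectors) the face with bottom, left, top, right labels $\boldsymbol I,j,\boldsymbol K,\ell$ has weight $L_x(\boldsymbol I,j;\boldsymbol K,\ell)=0$ unless $\boldsymbol I+\boldsymbol e_j=\boldsymbol K+\boldsymbol e_\ell$; in that case, with $I_{[a,n]}=\sum_{k=a}^nI_k$, it is $1$ if $\ell=0$, it is $xt^{I_{[\ell+1,n]}}$ if $j=\ell\ge1$, it is $x(1-t^{I_\ell})t^{I_{[\ell+1,n]}}$ if $0\le j<\ell$, and it is $0$ if $j>\ell\ge1$. Let $\mathbb V(N)$ be the complex vector space with basis $|\boldsymbol J(0),\dots,\boldsymbol J(N)\rangle$, $\boldsymbol J(k)\in\mathbb N^n$. The row operator $\mathcal C_i(x)$ sends $|\boldsymbol J(0),\dots,\boldsymbol J(N)\rangle$ to $$\sum_{\boldsymbol I(0),\dots,\boldsymbol I(N)}\ \sum_{\substack{\kappa_0,\dots,\kappa_{N+1}\in\{0,\dots,n\}\\ \kappa_0=i,\ \kappa_{N+1}=0}}\ \prod_{k=0}^NL_x(\boldsymbol I(k),\kappa_k;\boldsymbol J(k),\kappa_{k+1})\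 |\boldsymbol I(0),\dots,\boldsymbol I(N)\rangle .$$ For an operator $A$ on $\mathbb V(N)$ and numbers $v_{i,j}$ ($1\le i\le n$, $0\le j\le N$) put $$\langle A\rangle_\mu=\sum_{\{m_{i,j}\ge0\}}\ \prod_{i=1}^n\prod_{j=0}^Nv_{i,j}^{m_{i,j}}\ \langle\{m\}|A|\{m\}+\mu\rangle ,$$ where $\{m\}$ stands for the basis vector whose $j$-th component is $\sum_im_{i,j}\boldsymbol e_i$, and $\{m\}+\mu$ for the one whose $j$-th component is $\sum_i(m_{i,j}+\mathbf 1(\mu_i=j))\boldsymbol e_i$. Take $$v_{i,j}=q^{\mu_i-j}t^{\gamma_{i,j}(\mu)}\mathbf 1(\mu_i>j),\qquad \gamma_{i,j}(\mu)=-\#\{k<i:\mu_k>\mu_i\}+\#\{k>i:j\le\mu_k<\mu_i\},$$ $$\Omega_\mu(q,t)=\prod_{i=1}^n\prod_{j=0}^{\mu_i-1}\big(1-q^{\mu_i-j}t^{\alpha_{i,j}(\mu)}\big),$$ $$\alpha_{i,j}(\mu)=\#\{k<i:\mu_k=\mu_i\}+\#\{k\ne i:j<\mu_k<\mu_i\}+\#\{k>i:\mu_k=j\}.$$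 **Theorem.** Assume that the twists are small enough for the geometric series to converge: $|v_{i,j}|\max(1,|t|)^n<1$ for all $i,j$. Then: 1. For all $x\in\mathbb C^n$ the series defining $\langle\mathcal C_1(x_1)\cdots\mathcal C_n(x_n)\rangle_\mu$ converges absolutely. 2. $\Omega_\mu(q,t)\neq0$, and $\langle\mathcal C_1(x_1)\cdots\mathcal C_n(x_n)\rangle_\mu$ is a polynomial in $x_1,\dots,x_n$ which is a joint eigenfunction of all Cherednik–Dunkl operators, $Y_i\,\langle\mathcal C_1(x_1)\cdots\mathcal C_n(x_n)\rangle_\mu=y_i(\mu)\,\langle\mathcal C_1(x_1)\cdots\mathcal C_n(x_n)\rangle_\mu$ for $1\le i\le n$, and whose $x^\mu$ coefficient is $1/\Omega_\mu(q,t)$. 3. If moreover $(y_1(\nu),\dots,y_n(\nu))\ne(y_1(\mu),\dots,y_n(\mu))$ for every composition $\nu\neq\mu$ of length $n$ with $|\nu|\le|\mu|$ (which holds for instance if $q^at^b\ne1$ for all integers $(a,b)\ne(0,0)$), then the nonsymmetric Macdonald polynomial $E_{(\mu_n,\dots,\mu_1)}$ exists and is unique, and for all $x\in\mathbb C^n$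 $$\Omega_\mu(q,t)\,\langle\mathcal C_1(x_1)\cdots\mathcal C_n(x_n)\rangle_\mu=f_\mu(x_1,\dots,x_n;q,t)=E_{(\mu_n,\dots,\mu_1)}(x_n,\dots,x_1;q,t).$$ -/

import Mathlib

open MvPolynomial

noncomputable section

namespace NonsymMacdonald

/-! ### The polynomial representation of the affine Hecke algebra

Variables are indexed by `Fin n`, so the variable `x_i` is `X (i - 1)`, and the generators with
index `k : ℕ` below act on the neighbouring variables with zero-based indices `k`, `k + 1`.
Operators are linear endomorphisms of `ℂ[x_1, …, x_n]`; products are compositions. -/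

variable {n : ℕ}

/-- The operator exchanging the variables with indices `a` and `b`. -/
def swapVars (a b : Fin n) : Module.End ℂ (MvPolynomial (Fin n) ℂ) :=
  (rename (Equiv.swap a b)).toLinearMap

theorem dvd_sub_swapVars (a b : Fin n) (h : MvPolynomial (Fin n) ℂ) :
    (X a - X b) ∣ (h - swapVars a b h) := by
  induction h using MvPolynomial.induction_on with
  | C c => simp [swapVars]
  | add p r hp hr =>
    have : p + r - swapVars a b (p + r) = (p - swapVars a b p) + (r - swapVars a b r) := by
      rw [map_add]; ring
    rw [this]
    exact dvd_add hp hr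
  | mul_X p k hp =>
    have h1 : swapVars a b (p * X k) = swapVars a b p * X (Equiv.swap a b k) := by
      simp [swapVars]
    have h2 : p * X k - swapVars a b (p * X k)
        = (p - swapVars a b p) * X k
          + swapVars a b p * (X k - X (Equiv.swap a b k)) := by
      rw [h1]; ring
    rw [h2]
    refine dvd_add (Dvd.dvd.mul_right hp _) (Dvd.dvd.mul_left ?_ _)
    by_cases ha : k = a
    · subst ha; simp
    · by_cases hb : k = b
      · subst hb
        rw [Equiv.swap_apply_right]
        exact ⟨-1, by ring⟩
      · rw [Equiv.swap_apply_of_ne_of_ne ha hb]; simp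

/-- The quotient `(h - s h) / (x_a - x_b)`, where `s` exchanges `x_a` and `x_b`. -/
def divDiffFun (a b : Fin n) (h : MvPolynomial (Fin n) ℂ) : MvPolynomial (Fin n) ℂ :=
  Classical.choose (dvd_sub_swapVars a b h)

theorem mul_divDiffFun (a b : Fin n) (h : MvPolynomial (Fin n) ℂ) :
    (X a - X b) * divDiffFun a b h = h - swapVars a b h :=
  (Classical.choose_spec (dvd_sub_swapVars a b h)).symm

theorem X_sub_X_ne_zero {a b : Fin n} (hab : a ≠ b) :
    (X a - X b : MvPolynomial (Fin n) ℂ) ≠ 0 := by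
  rw [sub_ne_zero]
  exact fun h => hab (X_injective h)

/-- The divided difference `(1 - s) / (x_a - x_b)` as a linear operator. -/
def divDiff (a b : Fin n) (hab : a ≠ b) : Module.End ℂ (MvPolynomial (Fin n) ℂ) where
  toFun := divDiffFun a b
  map_add' p r := by
    apply mul_left_cancel₀ (X_sub_X_ne_zero hab)
    rw [mul_add, mul_divDiffFun, mul_divDiffFun, mul_divDiffFun, map_add]
    ring
  map_smul' c p := by
    apply mul_left_cancel₀ (X_sub_X_ne_zero hab)
    rw [RingHom.id_apply, mul_smul_comm, mul_divDiffFun, mul_divDiffFun, map_smul, smul_sub]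

/-- `s_{k+1}`: exchange of the variables with zero-based indices `k`, `k + 1`
(the identity, never used, if there are no such variables). -/
def transp (n k : ℕ) : Module.End ℂ (MvPolynomial (Fin n) ℂ) :=
  if h : k + 1 < n then swapVars ⟨k, by omega⟩ ⟨k + 1, h⟩ else 1

/-- The operator `((α x_a - β x_b) / (x_a - x_b)) (1 - s)` for the variables with zero-based
indices `a = k`, `b = k + 1` (zero, never used, if there are no such variables). -/
def ratioOp (n : ℕ) (α β : ℂ) (k : ℕ) : Module.End ℂ (MvPolynomial (Fin n) ℂ) :=
  if h : k + 1 < n then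
    LinearMap.mulLeft ℂ (C α * X ⟨k, by omega⟩ - C β * X ⟨k + 1, h⟩) *
      divDiff ⟨k, by omega⟩ ⟨k + 1, h⟩ (by simp)
  else 0

/-- The `q`-shift `h(x_1, …, x_n) ↦ h(q x_1, x_2, …, x_n)`. -/
def shiftOp (n : ℕ) (q : ℂ) : Module.End ℂ (MvPolynomial (Fin n) ℂ) :=
  (aeval fun k : Fin n => if (k : ℕ) = 0 then C q * X k else X k :
    MvPolynomial (Fin n) ℂ →ₐ[ℂ] MvPolynomial (Fin n) ℂ).toLinearMap

/-! #### The generators for `E_μ` (written with a tilde) -/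

/-- `T̃ = t - ((t x_i - x_{i+1}) / (x_i - x_{i+1})) (1 - s_i)`. -/
def heckeTilde (n : ℕ) (t : ℂ) (k : ℕ) : Module.End ℂ (MvPolynomial (Fin n) ℂ) :=
  t • 1 - ratioOp n t 1 k

/-- `T̃⁻¹ = t⁻¹ (1 - ((t x_i - x_{i+1}) / (x_i - x_{i+1})) (1 - s_i))`. -/
def heckeTildeInv (n : ℕ) (t : ℂ) (k : ℕ) : Module.End ℂ (MvPolynomial (Fin n) ℂ) :=
  t⁻¹ • (1 - ratioOp n t 1 k)

/-- `ω̃ = s_{n-1} ⋯ s_1 τ_1`. -/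
def omegaTilde (n : ℕ) (q : ℂ) : Module.End ℂ (MvPolynomial (Fin n) ℂ) :=
  ((List.range (n - 1)).reverse.map (transp n)).prod * shiftOp n q

/-- The Cherednik--Dunkl operator `Ỹ_i = T̃_i ⋯ T̃_{n-1} ω̃ T̃_1⁻¹ ⋯ T̃_{i-1}⁻¹`. -/
def cherednikTilde (q t : ℂ) (i : Fin n) : Module.End ℂ (MvPolynomial (Fin n) ℂ) :=
  ((List.range' (i : ℕ) (n - 1 - i)).map (heckeTilde n t)).prod * omegaTilde n q *
    ((List.range (i : ℕ)).map (heckeTildeInv n t)).prod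

/-- `η̃_i(μ) = -#{j < i : μ_j ≥ μ_i} - #{j > i : μ_j > μ_i}`. -/
def etaTilde (μ : Fin n → ℕ) (i : Fin n) : ℤ :=
  -((Finset.univ.filter fun j => j < i ∧ μ i ≤ μ j).card : ℤ)
    - ((Finset.univ.filter fun j => i < j ∧ μ i < μ j).card : ℤ)

/-- The eigenvalue `ỹ_i(μ; q, t) = q^{μ_i} t^{η̃_i(μ) + n - i}` (with `i` counted from one). -/
def eigTilde (q t : ℂ) (μ : Fin n → ℕ) (i : Fin n) : ℂ :=
  q ^ μ i * t ^ (etaTilde μ i + (n : ℤ) - ((i : ℕ) + 1 : ℤ))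

/-- The properties characterising `E_μ(x_1, …, x_n; q, t)`: a polynomial of degree at most `|μ|`
in which `x^μ` has coefficient one, and a joint eigenfunction of the operators `Ỹ_i` with
eigenvalues `ỹ_i(μ; q, t)`. -/
structure IsE (q t : ℂ) (μ : Fin n → ℕ) (E : MvPolynomial (Fin n) ℂ) : Prop where
  degree_le : E.totalDegree ≤ ∑ i, μ i
  monic : E.coeff (Finsupp.equivFunOnFinite.symm μ) = 1
  eigen : ∀ i, cherednikTilde q t i E = eigTilde q t μ i • E

/-- The nonsymmetric Macdonald polynomial `E_μ(x_1, …, x_n; q, t)`: the polynomial with the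
properties `IsE`. -/
def polyE (q t : ℂ) (μ : Fin n → ℕ) : MvPolynomial (Fin n) ℂ :=
  Classical.epsilon (IsE q t μ)

/-- `f_μ(x_1, …, x_n; q, t) = E_{(μ_n, …, μ_1)}(x_n, …, x_1; q, t)`. -/
def polyF (q t : ℂ) (μ : Fin n → ℕ) : MvPolynomial (Fin n) ℂ :=
  rename Fin.rev (polyE q t fun i => μ i.rev)

/-! #### The generators for `f_μ` (reversed alphabet) -/

/-- `T_i = t - ((x_i - t x_{i+1}) / (x_i - x_{i+1})) (1 - s_i)`. -/
def hecke (n : ℕ) (t : ℂ) (k : ℕ) : Module.End ℂ (MvPolynomial (Fin n) ℂ) :=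
  t • 1 - ratioOp n 1 t k

/-- `T_i⁻¹ = t⁻¹ (1 - ((x_i - t x_{i+1}) / (x_i - x_{i+1})) (1 - s_i))`. -/
def heckeInv (n : ℕ) (t : ℂ) (k : ℕ) : Module.End ℂ (MvPolynomial (Fin n) ℂ) :=
  t⁻¹ • (1 - ratioOp n 1 t k)

/-- `ω = τ_1 s_1 ⋯ s_{n-1}`. -/
def omega (n : ℕ) (q : ℂ) : Module.End ℂ (MvPolynomial (Fin n) ℂ) :=
  shiftOp n q * ((List.range (n - 1)).map (transp n)).prod

/-- The Cherednik--Dunkl operator `Y_i = T_{i-1} ⋯ T_1 ω T_{n-1}⁻¹ ⋯ T_i⁻¹`. -/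
def cherednik (q t : ℂ) (i : Fin n) : Module.End ℂ (MvPolynomial (Fin n) ℂ) :=
  ((List.range (i : ℕ)).reverse.map (hecke n t)).prod * omega n q *
    ((List.range' (i : ℕ) (n - 1 - i)).reverse.map (heckeInv n t)).prod

/-- `η_i(μ) = -#{j < i : μ_j > μ_i} - #{j > i : μ_j ≥ μ_i}`. -/
def eta (μ : Fin n → ℕ) (i : Fin n) : ℤ :=
  -((Finset.univ.filter fun j => j < i ∧ μ i < μ j).card : ℤ)
    - ((Finset.univ.filter fun j => i < j ∧ μ i ≤ μ j).card : ℤ)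

/-- The eigenvalue `y_i(μ; q, t) = q^{μ_i} t^{η_i(μ) + i - 1}` (with `i` counted from one). -/
def eig (q t : ℂ) (μ : Fin n → ℕ) (i : Fin n) : ℂ :=
  q ^ μ i * t ^ (eta μ i + ((i : ℕ) : ℤ))

/-! ### The vertex model

Vertical edges carry a label in `{0, 1, …, n}`, modelled by `Option (Fin n)`: `none` is `0` (no
path) and `some i` is a path of colour `i`. Horizontal edges carry a vector in `ℕ^n`. -/

/-- The vector `e_j`, with `e_0 = 0`. -/
def unitVec : Option (Fin n) → Fin n → ℕ
  | none => 0
  | some i => Pi.single i 1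

/-- `I_{[i+1, n]} = I_{i+1} + ⋯ + I_n`. -/
def tailSum (I : Fin n → ℕ) (i : Fin n) : ℕ := ∑ k ∈ Finset.Ioi i, I k

/-- The weight `L_x(I, j; K, ℓ)` of a face with bottom `I`, left `j`, top `K`, right `ℓ`. -/
def faceWeight (t x : ℂ) (I : Fin n → ℕ) (j : Option (Fin n)) (K : Fin n → ℕ)
    (l : Option (Fin n)) : ℂ :=
  if I + unitVec j = K + unitVec l then
    match j, l with
    | none, none => 1
    | none, some i => x * (1 - t ^ I i) * t ^ tailSum I i
    | some _, none => 1
    | some i, some k =>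
      if i = k then x * t ^ tailSum I i
      else if i < k then x * (1 - t ^ I k) * t ^ tailSum I k
      else 0
  else 0

/-- Labels of the basis vectors of `𝕍(N) = V_0 ⊗ ⋯ ⊗ V_N`: one vector of `ℕ^n` for each of the
`N + 1` columns. The space `𝕍(N)` itself is the free module `State n N →₀ ℂ`. -/
abbrev State (n N : ℕ) : Type := Fin (N + 1) → Fin n → ℕ

/-- The one-row partition function with left label `i`, right label `0`, bottom labels `I(0), …,
I(N)` and top labels `J(0), …, J(N)`: the sum over all labels `κ` of the vertical edges (at most one
choice of the internal ones is compatible with conservation). -/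
def rowWeight {N : ℕ} (t x : ℂ) (i : Fin n) (I J : State n N) : ℂ :=
  ∑ κ : Fin (N + 2) → Option (Fin n),
    if κ 0 = some i ∧ κ (Fin.last (N + 1)) = none then
      ∏ c : Fin (N + 1), faceWeight t x (I c) (κ c.castSucc) (J c) (κ c.succ)
    else 0

theorem le_of_faceWeight_ne_zero {t x : ℂ} {I : Fin n → ℕ} {j : Option (Fin n)}
    {K : Fin n → ℕ} {l : Option (Fin n)} (h : faceWeight t x I j K l ≠ 0) : I ≤ K + 1 := by
  have h1 : I + unitVec j = K + unitVec l := by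
    by_contra hne
    exact h (by simp [faceWeight, hne])
  have h2 : unitVec l ≤ (1 : Fin n → ℕ) := by
    cases l with
    | none => intro k; simp [unitVec]
    | some i => 
      intro k
      by_cases hk : k = i
      · subst hk; simp [unitVec]
      · simp [unitVec, Pi.single_eq_of_ne hk]
  intro k
  have h3 := congrFun h1 k
  have h4 := h2 k
  simp only [Pi.add_apply, Pi.one_apply] at *
  omega

theorem le_of_rowWeight_ne_zero {N : ℕ} {t x : ℂ} {i : Fin n} {I J : State n N}
    (h : rowWeight t x i I J ≠ 0) : I ≤ J + 1 := by
  obtain ⟨κ, -, hκ⟩ := Finset.exists_ne_zero_of_sum_ne_zero h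
  split_ifs at hκ with hb
  · intro c
    exact le_of_faceWeight_ne_zero (Finset.prod_ne_zero_iff.mp hκ c (Finset.mem_univ c))
  · exact absurd rfl hκ

/-- The row operator `C_i(x)` on `𝕍(N)`: it maps the basis vector `|J⟩` to
`∑_I rowWeight(I, J) |I⟩`, a finite sum. -/
def rowOp (N : ℕ) (t : ℂ) (i : Fin n) (x : ℂ) : Module.End ℂ (State n N →₀ ℂ) :=
  Finsupp.linearCombination ℂ fun J : State n N =>
    Finsupp.onFinset (Finset.Icc 0 (J + 1)) (fun I => rowWeight t x i I J)
      fun _ h => Finset.mem_Icc.mpr ⟨zero_le, le_of_rowWeight_ne_zero h⟩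

/-- The product `C_1(x_1) ⋯ C_n(x_n)`. -/
def rowOpProd (N : ℕ) (t : ℂ) (x : Fin n → ℂ) : Module.End ℂ (State n N →₀ ℂ) :=
  (List.ofFn fun i => rowOp N t i (x i)).prod

/-- `N = max_i μ_i`. -/
def maxPart (μ : Fin n → ℕ) : ℕ := Finset.univ.sup μ

/-- The label of the composition state `|μ⟩`: `μ(j) = ∑_i 1(μ_i = j) e_i`. -/
def compState (μ : Fin n → ℕ) : State n (maxPart μ) :=
  fun j i => if μ i = (j : ℕ) then 1 else 0

/-- The summand `∏_{i,j} v_{i,j}^{m_{i,j}} ⟨{m}| X |{m} + μ⟩` of the linear form `⟨X⟩_μ`. -/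
def formTerm (μ : Fin n → ℕ) (v : Fin n → Fin (maxPart μ + 1) → ℂ)
    (A : Module.End ℂ (State n (maxPart μ) →₀ ℂ)) (m : State n (maxPart μ)) : ℂ :=
  (∏ i, ∏ j, v i j ^ m j i) * A (Finsupp.single (m + compState μ) 1) m

/-- The linear form `⟨X⟩_μ`, a sum over all families `{m_{i,j}}` of nonnegative integers. -/
def linForm (μ : Fin n → ℕ) (v : Fin n → Fin (maxPart μ + 1) → ℂ)
    (A : Module.End ℂ (State n (maxPart μ) →₀ ℂ)) : ℂ :=
  ∑' m : State n (maxPart μ), formTerm μ v A m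

/-! ### The twists and the normalization -/

/-- `γ_{i,j}(μ) = -#{k < i : μ_k > μ_i} + #{k > i : j ≤ μ_k < μ_i}`. -/
def gammaExp (μ : Fin n → ℕ) (i : Fin n) (j : ℕ) : ℤ :=
  -((Finset.univ.filter fun k => k < i ∧ μ i < μ k).card : ℤ)
    + ((Finset.univ.filter fun k => i < k ∧ j ≤ μ k ∧ μ k < μ i).card : ℤ)

/-- `v_{i,j} = q^{μ_i - j} t^{γ_{i,j}(μ)} 1(μ_i > j)`. -/
def twist (q t : ℂ) (μ : Fin n → ℕ) (i : Fin n) (j : Fin (maxPart μ + 1)) : ℂ :=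
  if (j : ℕ) < μ i then q ^ (μ i - (j : ℕ)) * t ^ gammaExp μ i j else 0

/-- `α_{i,j}(μ) = #{k < i : μ_k = μ_i} + #{k ≠ i : j < μ_k < μ_i} + #{k > i : j = μ_k}`. -/
def alphaExp (μ : Fin n → ℕ) (i : Fin n) (j : ℕ) : ℕ :=
  (Finset.univ.filter fun k => k < i ∧ μ k = μ i).card
    + (Finset.univ.filter fun k => k ≠ i ∧ j < μ k ∧ μ k < μ i).card
    + (Finset.univ.filter fun k => i < k ∧ j = μ k).card

/-- `Ω_μ(q, t) = ∏_i ∏_{0 ≤ j < μ_i} (1 - q^{μ_i - j} t^{α_{i,j}(μ)})`. -/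
def Omega (q t : ℂ) (μ : Fin n → ℕ) : ℂ :=
  ∏ i, ∏ j ∈ Finset.range (μ i), (1 - q ^ (μ i - j) * t ^ alphaExp μ i j)

/-- The partition function `⟨C_1(x_1) ⋯ C_n(x_n)⟩_μ` with the twists `twist q t μ`. -/
def partitionFn (q t : ℂ) (μ : Fin n → ℕ) (x : Fin n → ℂ) : ℂ :=
  linForm μ (twist q t μ) (rowOpProd (maxPart μ) t x)

end NonsymMacdonald

end

open MvPolynomial

noncomputable section

namespace NonsymMacdonald

variable {n : ℕ}

/-! ### Integer states and the expansion over lattice paths -/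

/-! Expanding the row operators turns the linear form into a finite sum over families of lattice
paths. Each family contributes a monomial in the `x_r` times a scalar series over the bottom states,
so the form of `C_{σ(1)}(x_1) ⋯ C_{σ(n)}(x_n)` is a polynomial `Z_σ`, here `partitionPoly`, for
every order `σ` of the colours. The smallness of the twists gives convergence by comparison with a
multiple geometric series.

The eigenvalue equations hold because the factors of `Y_i` permute the `Z_σ` up to scalars. The
Yang–Baxter equation gives the exchange relation `rowOp_exchange`. Read as a relation between `Z_σ`,
its image under `s_k` and `Z_{σ s_k}`, it says that `T_k^{±1}` interchanges the colours in rows `k`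
and `k + 1` (`hecke_partitionPoly`). The twists are chosen so that moving the top row to the bottom
only multiplies a path family by powers of `q` and `t` (`pathSum_rotate`), which makes `ω` a cyclic
rotation of the rows (`omega_partitionPoly`). In `Y_i` the inverse generators bring colour `i` to
the last row, `ω` brings it to the first, and the remaining generators bring it back to row `i`. So
`Z_id` returns to itself, and the accumulated scalar is `y_i(μ)` (`cherednik_partitionPoly`).

The coefficient of `x^μ` comes from a single family, in which the path of colour `r` runs straight
to column `μ_r` (`eq_straightPath`). Its series is a product of geometric series with value `1/Ω_μ`.

For the identification with the Macdonald polynomial, each `Y_i` is triangular in the monomials with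
diagonal entries `y_i(ν)` (`isTriangular_cherednik`). If the joint eigenvalue of `μ` is simple, a
joint eigenvector of degree at most `|μ|` without an `x^μ` term must vanish
(`eq_zero_of_cherednik_eigen`). Existence comes from the partition function itself. Reversing the
alphabet turns `Y_i` into `Ỹ_{n+1-i}` (`permVars_rev_cherednik`) and transfers both statements to
`E`. -/

/-- States with integer occupation numbers, on which the weights make sense as well. -/
abbrev ZState (n N : ℕ) : Type := Fin (N + 1) → Fin n → ℤ

/-- The labels of the vertical edges of one row. -/
abbrev RowPath (n N : ℕ) : Type := Fin (N + 2) → Option (Fin n)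

/-- The integer vector `e_j`, with `e_0 = 0`. -/
def unitZ (j : Option (Fin n)) : Fin n → ℤ := fun k => if j = some k then 1 else 0

/-- The change of the state across a row with the given vertical labels. -/
def flux {N : ℕ} (κ : RowPath n N) : ZState n N :=
  fun c => unitZ (κ c.castSucc) - unitZ (κ c.succ)

/-- A natural-number state, regarded as an integer state. -/
def castS {N : ℕ} (m : State n N) : ZState n N := fun c i => (m c i : ℤ)

/-- The weight of a face at `x = 1` in terms of its bottom, left and right labels. -/
def colWt (t : ℂ) (I : Fin n → ℤ) (j : Option (Fin n)) : Option (Fin n) → ℂ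
  | none => 1
  | some k =>
    (if j = some k then 1 else if ∀ i ∈ j, i < k then 1 - t ^ I k else 0) *
      t ^ ∑ k' ∈ Finset.Ioi k, I k'

/-- The number of columns that a path leaves with a nonzero label. -/
def deg {N : ℕ} (κ : RowPath n N) : ℕ :=
  (Finset.univ.filter fun c : Fin (N + 1) => (κ c.succ).isSome).card

/-- The weight of a row at `x = 1` in terms of its bottom state. -/
def rowWt {N : ℕ} (t : ℂ) (κ : RowPath n N) (I : ZState n N) : ℂ :=
  ∏ c, colWt t (I c) (κ c.castSucc) (κ c.succ)

/-- The weight of a stack of rows at `x = 1`, listed from bottom to top. -/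
def listWt {N : ℕ} (t : ℂ) : List (RowPath n N) → ZState n N → ℂ
  | [], _ => 1
  | κ :: ks, I => rowWt t κ I * listWt t ks (I + flux κ)

/-- The boundary conditions on the vertical labels of the row operator `C_i`. -/
def Bdry {N : ℕ} (i : Fin n) (κ : RowPath n N) : Prop :=
  κ 0 = some i ∧ κ (Fin.last (N + 1)) = none

instance {N : ℕ} (i : Fin n) (κ : RowPath n N) : Decidable (Bdry i κ) := by
  unfold Bdry; infer_instance

theorem castS_injective {N : ℕ} : Function.Injective (castS : State n N → ZState n N) := by
  intro a b h
  funext c i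
  have := congrFun (congrFun h c) i
  simpa [castS] using this

theorem castS_nonneg {N : ℕ} (m : State n N) : 0 ≤ castS m := fun c i => by simp [castS]

theorem exists_castS {N : ℕ} {I : ZState n N} (h : 0 ≤ I) : ∃ m : State n N, castS m = I :=
  ⟨fun c i => (I c i).toNat, by funext c i; simpa [castS] using h c i⟩

theorem unitVec_cast (j : Option (Fin n)) (k : Fin n) : ((unitVec j k : ℕ) : ℤ) = unitZ j k := by
  cases j with
  | none => simp [unitVec, unitZ]
  | some i =>
    by_cases h : i = k
    · subst h; simp [unitVec, unitZ]
    · simp [unitVec, unitZ, h, Ne.symm h]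

theorem faceWeight_eq (t x : ℂ) (I : Fin n → ℕ) (j : Option (Fin n)) (K : Fin n → ℕ)
    (l : Option (Fin n)) :
    faceWeight t x I j K l =
      if (fun k => (K k : ℤ)) = (fun k => (I k : ℤ)) + (unitZ j - unitZ l) then
        x ^ (if l.isSome then 1 else 0) * colWt t (fun k => (I k : ℤ)) j l else 0 := by
  have hcond : (I + unitVec j = K + unitVec l) ↔
      ((fun k => (K k : ℤ)) = (fun k => (I k : ℤ)) + (unitZ j - unitZ l)) := by
    constructor
    · intro h
      funext k
      have := congrFun h k
      simp only [Pi.add_apply, Pi.sub_apply, ← unitVec_cast] at *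
      omega
    · intro h
      funext k
      have := congrFun h k
      simp only [Pi.add_apply, Pi.sub_apply, ← unitVec_cast] at *
      omega
  have htail : ∀ k : Fin n, t ^ (∑ k' ∈ Finset.Ioi k, (I k' : ℤ)) = t ^ tailSum I k := by
    intro k
    rw [tailSum, ← zpow_natCast]
    push_cast
    rfl
  unfold faceWeight
  rw [if_congr hcond rfl rfl]
  congr 1
  cases j with
  | none =>
    cases l with
    | none => simp [colWt]
    | some k => simp [colWt, htail]; ring
  | some i =>
    cases l with
    | none => simp [colWt]
    | some k =>
      by_cases h : i = k
      · simp [colWt, htail, h]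
      · by_cases h' : i < k
        · simp [colWt, htail, h, h']; ring
        · simp [colWt, h, h']

theorem rowWeight_eq {N : ℕ} (t x : ℂ) (i : Fin n) (I J : State n N) :
    rowWeight t x i I J = ∑ κ : RowPath n N,
      if Bdry i κ ∧ castS J = castS I + flux κ then x ^ deg κ * rowWt t κ (castS I) else 0 := by
  unfold rowWeight
  refine Finset.sum_congr rfl fun κ _ => ?_
  by_cases hb : Bdry i κ
  · have hb' := hb
    unfold Bdry at hb'
    rw [if_pos hb']
    simp only [faceWeight_eq]
    by_cases hf : castS J = castS I + flux κ
    · rw [if_pos ⟨hb, hf⟩]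
      have : ∀ c, (fun k => (J c k : ℤ)) =
          (fun k => (I c k : ℤ)) + (unitZ (κ c.castSucc) - unitZ (κ c.succ)) :=
        fun c => congrFun hf c
      simp only [this, if_true]
      rw [Finset.prod_mul_distrib, Finset.prod_pow_eq_pow_sum, deg, Finset.card_filter]
      rfl
    · rw [if_neg (fun h => hf h.2)]
      have : ∃ c, ¬ ((fun k => (J c k : ℤ)) =
          (fun k => (I c k : ℤ)) + (unitZ (κ c.castSucc) - unitZ (κ c.succ))) := by
        by_contra hcon
        push Not at hcon
        exact hf (funext hcon)
      obtain ⟨c, hc⟩ := this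
      exact Finset.prod_eq_zero (Finset.mem_univ c) (if_neg hc)
  · have hb' := hb
    unfold Bdry at hb'
    rw [if_neg hb', if_neg (fun h => hb h.1)]

/-- An occupation number can drop only when its colour leaves to the right without entering from the
left, and then the factor `1 - t ^ I k` vanishes at `I k = 0`. This lets later sums run over integer
states without spurious terms. -/
theorem colWt_nonneg {t : ℂ} {I : Fin n → ℤ} {j l : Option (Fin n)} {k : Fin n}
    (h : colWt t I j l ≠ 0) (hI : 0 ≤ I k) : 0 ≤ I k + (unitZ j k - unitZ l k) := by
  unfold unitZ
  cases l with
  | none => simp; split_ifs <;> omega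
  | some k' =>
    by_cases hk : k' = k
    · subst hk
      by_cases hj : j = some k'
      · simp [hj, hI]
      · simp only [hj, if_false, if_true]
        rcases hI.lt_or_eq with h' | h'
        · omega
        · exfalso
          apply h
          simp [colWt, hj, ← h']
    · simp [hk]; split_ifs <;> omega

theorem rowWt_nonneg {N : ℕ} {t : ℂ} {κ : RowPath n N} {I : ZState n N} {c : Fin (N + 1)}
    {k : Fin n} (h : rowWt t κ I ≠ 0) (hI : 0 ≤ I c k) : 0 ≤ (I + flux κ) c k :=
  colWt_nonneg (Finset.prod_ne_zero_iff.mp h c (Finset.mem_univ c)) hI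

theorem listWt_nonneg {N : ℕ} {t : ℂ} {ks : List (RowPath n N)} {I : ZState n N}
    {c : Fin (N + 1)} {k : Fin n} (h : listWt t ks I ≠ 0) (hI : 0 ≤ I c k) :
    0 ≤ (I + (ks.map flux).sum) c k := by
  induction ks generalizing I with
  | nil => simpa using hI
  | cons κ ks ih =>
    rw [listWt] at h
    have := ih (right_ne_zero_of_mul h) (rowWt_nonneg (left_ne_zero_of_mul h) hI)
    rwa [List.map_cons, List.sum_cons, ← add_assoc]

theorem listWt_append {N : ℕ} (t : ℂ) (ks ls : List (RowPath n N)) (I : ZState n N) :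
    listWt t (ks ++ ls) I = listWt t ks I * listWt t ls (I + (ks.map flux).sum) := by
  induction ks generalizing I with
  | nil => simp [listWt]
  | cons κ ks ih => simp [listWt, ih, mul_assoc, add_assoc]

theorem rowOp_apply {N : ℕ} (t x : ℂ) (i : Fin n) (φ : State n N →₀ ℂ) (I : State n N) :
    rowOp N t i x φ I = ∑ J ∈ φ.support, φ J * rowWeight t x i I J := by
  rw [rowOp, Finsupp.linearCombination_apply, Finsupp.sum, Finsupp.finsetSum_apply]
  rfl

open Classical in
/-- Matrix elements of a product of row operators, as sums over families of paths. -/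
theorem prod_rowOp_apply {N : ℕ} (t : ℂ) (k : ℕ) (σ : Fin k → Fin n) (x : Fin k → ℂ)
    (a b : State n N) :
    (List.ofFn fun r => rowOp N t (σ r) (x r)).prod (Finsupp.single b 1) a =
      ∑ ks : Fin k → RowPath n N,
        if (∀ r, Bdry (σ r) (ks r)) ∧ castS b = castS a + ∑ r, flux (ks r) then
          (∏ r, x r ^ deg (ks r)) * listWt t (List.ofFn ks) (castS a) else 0 := by
  induction k generalizing a with
  | zero =>
    simp only [List.ofFn_zero, List.prod_nil, Module.End.one_apply, Finset.univ_unique,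
      Finset.sum_singleton, IsEmpty.forall_iff, true_and, Finset.univ_eq_empty, Finset.sum_empty,
      add_zero, Finset.prod_empty, listWt, mul_one]
    by_cases h : b = a
    · simp [h]
    · rw [Finsupp.single_apply, if_neg h, if_neg (fun h' => h (castS_injective h'))]
  | succ k ih =>
    rw [List.ofFn_succ, List.prod_cons, Module.End.mul_apply, rowOp_apply]
    set φ := (List.ofFn fun r : Fin k => rowOp N t (σ r.succ) (x r.succ)).prod
      (Finsupp.single b 1) with hφ
    rw [← (Fin.consEquiv fun _ : Fin (k + 1) => RowPath n N).sum_comp, Fintype.sum_prod_type]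
    simp only [rowWeight_eq, Finset.mul_sum]
    rw [Finset.sum_comm]
    refine Finset.sum_congr rfl fun κ _ => ?_
    simp only [Fin.consEquiv, Equiv.coe_fn_mk, Fin.forall_fin_succ, Fin.cons_zero, Fin.cons_succ,
      Fin.sum_univ_succ, Fin.prod_univ_succ, List.ofFn_succ, listWt]
    by_cases hb : Bdry (σ 0) κ
    swap
    · simp [hb]
    simp only [hb, true_and]
    by_cases hw : rowWt t κ (castS a) = 0
    · simp [hw]
    -- A nonzero row weight leads to a genuine state, so conservation leaves exactly one term of the
    -- sum over intermediate states.
    have hnn : 0 ≤ castS a + flux κ := fun c i => rowWt_nonneg hw (castS_nonneg a c i)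
    obtain ⟨p, hp⟩ := exists_castS hnn
    have hL : ∑ J ∈ φ.support, (φ J * if castS J = castS a + flux κ then
        x 0 ^ deg κ * rowWt t κ (castS a) else 0) =
        φ p * (x 0 ^ deg κ * rowWt t κ (castS a)) := by
      rw [Finset.sum_eq_single p]
      · rw [if_pos hp]
      · intro J _ hJ
        rw [if_neg, mul_zero]
        rw [← hp]
        exact fun h => hJ (castS_injective h)
      · intro hp'
        rw [Finsupp.notMem_support_iff.mp hp', zero_mul]
    rw [hL, hφ, ih (fun r => σ r.succ) (fun r => x r.succ) p, Finset.sum_mul]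
    refine Finset.sum_congr rfl fun ks _ => ?_
    rw [hp, add_assoc]
    split_ifs
    · ring
    · simp

/-! ### Convergence -/

theorem hasSum_mul_of_summable_norm {ι κ : Type*} {f : ι → ℂ} {g : κ → ℂ} {x y : ℂ}
    (hf : Summable fun i => ‖f i‖) (hg : Summable fun i => ‖g i‖) (hx : HasSum f x)
    (hy : HasSum g y) :
    (Summable fun p : ι × κ => ‖f p.1 * g p.2‖) ∧
      HasSum (fun p : ι × κ => f p.1 * g p.2) (x * y) := by
  have h : Summable fun p : ι × κ => ‖f p.1 * g p.2‖ := by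
    simp only [norm_mul]
    exact hf.mul_of_nonneg hg (fun _ => norm_nonneg _) (fun _ => norm_nonneg _)
  exact ⟨h, hx.mul hy h.of_norm⟩

theorem hasSum_prod_pow_fin (k : ℕ) (a : Fin k → ℂ) (ha : ∀ i, ‖a i‖ < 1) :
    (Summable fun m : Fin k → ℕ => ‖∏ i, a i ^ m i‖) ∧
      HasSum (fun m : Fin k → ℕ => ∏ i, a i ^ m i) (∏ i, (1 - a i)⁻¹) := by
  induction k with
  | zero =>
    constructor
    · exact (hasSum_fintype _).summable
    · convert hasSum_fintype (fun m : Fin 0 → ℕ => ∏ i, a i ^ m i) using 1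
      simp
  | succ k ih =>
    obtain ⟨h1, h2⟩ := ih (fun i => a i.succ) (fun i => ha _)
    have hg1 : Summable fun m : ℕ => ‖a 0 ^ m‖ := by
      simpa [norm_pow] using summable_geometric_of_lt_one (norm_nonneg _) (ha 0)
    have hg2 := hasSum_geometric_of_norm_lt_one (ha 0)
    obtain ⟨h3, h4⟩ := hasSum_mul_of_summable_norm hg1 h1 hg2 h2
    let e : ℕ × (Fin k → ℕ) ≃ (Fin (k + 1) → ℕ) := Fin.consEquiv fun _ => ℕ
    have he : ∀ p : ℕ × (Fin k → ℕ), ∏ i, a i ^ e p i = a 0 ^ p.1 * ∏ i, a i.succ ^ p.2 i := by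
      intro p
      rw [Fin.prod_univ_succ]
      rfl
    rw [← Fin.prod_univ_succ fun i => (1 - a i)⁻¹] at h4
    have he' : (fun p : ℕ × (Fin k → ℕ) => a 0 ^ p.1 * ∏ i, a i.succ ^ p.2 i) =
        (fun m : Fin (k + 1) → ℕ => ∏ i, a i ^ m i) ∘ e := funext fun p => (he p).symm
    have he'' : (fun p : ℕ × (Fin k → ℕ) => ‖a 0 ^ p.1 * ∏ i, a i.succ ^ p.2 i‖) =
        (fun m : Fin (k + 1) → ℕ => ‖∏ i, a i ^ m i‖) ∘ e :=
      funext fun p => congrArg norm (he p).symm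
    exact ⟨e.summable_iff.mp (he'' ▸ h3), e.hasSum_iff.mp (he' ▸ h4)⟩

/-- A multiple geometric series. -/
theorem hasSum_prod_pow {ι : Type*} [Fintype ι] (a : ι → ℂ) (ha : ∀ i, ‖a i‖ < 1) :
    (Summable fun m : ι → ℕ => ‖∏ i, a i ^ m i‖) ∧
      HasSum (fun m : ι → ℕ => ∏ i, a i ^ m i) (∏ i, (1 - a i)⁻¹) := by
  classical
  let e := Fintype.equivFin ι
  obtain ⟨h1, h2⟩ := hasSum_prod_pow_fin _ (fun i => a (e.symm i)) (fun i => ha _)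
  have he : ∀ m : ι → ℕ, ∏ i, a (e.symm i) ^ (e.arrowCongr (Equiv.refl ℕ) m) i =
      ∏ i, a i ^ m i := by
    intro m
    rw [← e.symm.prod_comp]
    simp
  rw [← (e.arrowCongr (Equiv.refl ℕ)).summable_iff] at h1
  rw [← (e.arrowCongr (Equiv.refl ℕ)).hasSum_iff, e.symm.prod_comp fun i => (1 - a i)⁻¹] at h2
  simp only [Function.comp_def, he] at h1 h2
  exact ⟨h1, h2⟩

/-- A multiple geometric series, summed over the states. -/
theorem hasSum_prod_pow_state {N : ℕ} (a : Fin n → Fin (N + 1) → ℂ) (ha : ∀ i j, ‖a i j‖ < 1) :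
    (Summable fun m : State n N => ‖∏ i, ∏ j, a i j ^ m j i‖) ∧
      HasSum (fun m : State n N => ∏ i, ∏ j, a i j ^ m j i) (∏ i, ∏ j, (1 - a i j)⁻¹) := by
  obtain ⟨h1, h2⟩ := hasSum_prod_pow (fun p : Fin (N + 1) × Fin n => a p.2 p.1)
    (fun p => ha _ _)
  let e := (Equiv.curry (Fin (N + 1)) (Fin n) ℕ).symm
  have he : ∀ m : State n N, ∏ p : Fin (N + 1) × Fin n, a p.2 p.1 ^ e m p =
      ∏ i, ∏ j, a i j ^ m j i := by
    intro m
    rw [Fintype.prod_prod_type_right]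
    rfl
  rw [← e.summable_iff] at h1
  rw [← e.hasSum_iff, Fintype.prod_prod_type_right] at h2
  simp only [Function.comp_def, he] at h1 h2
  exact ⟨h1, h2⟩

/-- The factors `1 - t ^ I k` and `t ^ ∑ I k'` with `k' > k` involve disjoint sets of colours. Hence
a face costs at most one power of `max 1 ‖t‖` per particle, and a stack of rows costs one such power
per row. -/
theorem norm_colWt_le {t : ℂ} (ht : t ≠ 0) (d : Fin n → ℤ) (j l : Option (Fin n)) :
    ∃ C : ℝ, 0 ≤ C ∧ ∀ m : Fin n → ℕ,
      ‖colWt t ((fun i => (m i : ℤ)) + d) j l‖ ≤ C * max 1 ‖t‖ ^ ∑ i, m i := by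
  set B := max 1 ‖t‖ with hB
  have hB1 : 1 ≤ B := le_max_left _ _
  have hBt : ‖t‖ ≤ B := le_max_right _ _
  cases l with
  | none =>
    refine ⟨1, zero_le_one, fun m => ?_⟩
    simpa [colWt] using one_le_pow₀ hB1
  | some k =>
    refine ⟨(1 + ‖t ^ d k‖) * ‖t ^ ∑ k' ∈ Finset.Ioi k, d k'‖, by positivity, fun m => ?_⟩
    have h1 : ‖(if j = some k then (1 : ℂ) else if ∀ i ∈ j, i < k then
        1 - t ^ (((fun i => (m i : ℤ)) + d) k) else 0)‖ ≤ (1 + ‖t ^ d k‖) * B ^ m k := by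
      have hp : 1 ≤ B ^ m k := one_le_pow₀ hB1
      have hn := norm_nonneg (t ^ d k)
      split_ifs
      · rw [norm_one]; nlinarith
      · refine (norm_sub_le _ _).trans ?_
        rw [norm_one, Pi.add_apply, zpow_add₀ ht, norm_mul, zpow_natCast, norm_pow]
        have : ‖t‖ ^ m k ≤ B ^ m k := pow_le_pow_left₀ (norm_nonneg _) hBt _
        nlinarith
      · rw [norm_zero]; positivity
    have h2 : ‖t ^ ∑ k' ∈ Finset.Ioi k, ((fun i => (m i : ℤ)) + d) k'‖ ≤
        ‖t ^ ∑ k' ∈ Finset.Ioi k, d k'‖ * B ^ ∑ k' ∈ Finset.Ioi k, m k' := by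
      simp only [Pi.add_apply]
      rw [Finset.sum_add_distrib, zpow_add₀ ht, norm_mul, mul_comm, ← Nat.cast_sum, zpow_natCast,
        norm_pow]
      exact mul_le_mul_of_nonneg_left (pow_le_pow_left₀ (norm_nonneg _) hBt _) (norm_nonneg _)
    have h3 : m k + ∑ k' ∈ Finset.Ioi k, m k' ≤ ∑ i, m i := by
      rw [← Finset.sum_insert (s := Finset.Ioi k) (by simp)]
      exact Finset.sum_le_sum_of_subset (Finset.subset_univ _)
    rw [colWt, norm_mul]
    refine (mul_le_mul h1 h2 (norm_nonneg _) (by positivity)).trans ?_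
    calc _ = ((1 + ‖t ^ d k‖) * ‖t ^ ∑ k' ∈ Finset.Ioi k, d k'‖) *
          B ^ (m k + ∑ k' ∈ Finset.Ioi k, m k') := by rw [pow_add]; ring
      _ ≤ _ := mul_le_mul_of_nonneg_left (pow_le_pow_right₀ hB1 h3) (by positivity)

theorem norm_rowWt_le {N : ℕ} {t : ℂ} (ht : t ≠ 0) (κ : RowPath n N) (d : ZState n N) :
    ∃ C : ℝ, 0 ≤ C ∧ ∀ m : State n N,
      ‖rowWt t κ (castS m + d)‖ ≤ C * max 1 ‖t‖ ^ ∑ c, ∑ i, m c i := by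
  choose C hC0 hC using fun c => norm_colWt_le ht (d c) (κ c.castSucc) (κ c.succ)
  refine ⟨∏ c, C c, Finset.prod_nonneg fun c _ => hC0 c, fun m => ?_⟩
  rw [rowWt, norm_prod, ← Finset.prod_pow_eq_pow_sum, ← Finset.prod_mul_distrib]
  exact Finset.prod_le_prod (fun _ _ => norm_nonneg _) fun c _ => hC c (m c)

theorem norm_listWt_le {N : ℕ} {t : ℂ} (ht : t ≠ 0) (ks : List (RowPath n N)) (d : ZState n N) :
    ∃ C : ℝ, 0 ≤ C ∧ ∀ m : State n N,
      ‖listWt t ks (castS m + d)‖ ≤ C * (max 1 ‖t‖ ^ ks.length) ^ ∑ c, ∑ i, m c i := by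
  induction ks generalizing d with
  | nil => exact ⟨1, zero_le_one, fun m => by simp [listWt]⟩
  | cons κ ks ih =>
    obtain ⟨C₁, h₁, h₁'⟩ := norm_rowWt_le ht κ d
    obtain ⟨C₂, h₂, h₂'⟩ := ih (d + flux κ)
    refine ⟨C₁ * C₂, mul_nonneg h₁ h₂, fun m => ?_⟩
    rw [listWt, norm_mul, add_assoc]
    refine (mul_le_mul (h₁' m) (h₂' m) (norm_nonneg _) (by positivity)).trans (le_of_eq ?_)
    rw [List.length_cons, pow_succ, mul_pow]
    ring

theorem summable_listWt {N : ℕ} {t : ℂ} (ht : t ≠ 0) (v : Fin n → Fin (N + 1) → ℂ)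
    (ks : List (RowPath n N)) (hv : ∀ i j, ‖v i j‖ * max 1 ‖t‖ ^ ks.length < 1) :
    Summable fun m : State n N => (∏ i, ∏ j, v i j ^ m j i) * listWt t ks (castS m) := by
  obtain ⟨C, hC, hC'⟩ := norm_listWt_le ht ks 0
  set D := max 1 ‖t‖ ^ ks.length with hD
  have hD0 : 0 ≤ D := by positivity
  have hg := (hasSum_prod_pow_state (fun i j => v i j * (D : ℂ)) fun i j => by
    rw [norm_mul, Complex.norm_real, Real.norm_of_nonneg hD0]; exact hv i j).1
  refine Summable.of_norm_bounded (hg.mul_left C) fun m => ?_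
  have h1 := hC' m
  rw [add_zero] at h1
  rw [norm_mul]
  refine (mul_le_mul_of_nonneg_left h1 (norm_nonneg _)).trans (le_of_eq ?_)
  simp only [mul_pow, Finset.prod_mul_distrib, norm_mul]
  have : ‖∏ i, ∏ j, (D : ℂ) ^ m j i‖ = D ^ ∑ c, ∑ i, m c i := by
    simp only [Finset.prod_pow_eq_pow_sum]
    rw [norm_pow, Complex.norm_real, Real.norm_of_nonneg hD0, Finset.sum_comm]
  rw [this]
  ring

/-! ### The partition functions as polynomials -/

open Classical in
/-- The families of paths contributing to the linear form of `C_{σ(1)} ⋯ C_{σ(k)}`. -/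
def admissible {k : ℕ} (μ : Fin n → ℕ) (σ : Fin k → Fin n) :
    Finset (Fin k → RowPath n (maxPart μ)) :=
  Finset.univ.filter fun ks =>
    (∀ r, Bdry (σ r) (ks r)) ∧ ∑ r, flux (ks r) = castS (compState μ)

theorem mem_admissible {k : ℕ} {μ : Fin n → ℕ} {σ : Fin k → Fin n}
    {ks : Fin k → RowPath n (maxPart μ)} :
    ks ∈ admissible μ σ ↔
      (∀ r, Bdry (σ r) (ks r)) ∧ ∑ r, flux (ks r) = castS (compState μ) := by
  simp [admissible]

/-- The contribution of a stack of paths to the linear form at `x = 1`. -/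
def pathSum {N : ℕ} (t : ℂ) (v : Fin n → Fin (N + 1) → ℂ) (ks : List (RowPath n N)) : ℂ :=
  ∑' m : State n N, (∏ i, ∏ j, v i j ^ m j i) * listWt t ks (castS m)

/-- The linear form of `C_{σ(1)}(x_1) ⋯ C_{σ(k)}(x_k)`, as a polynomial in the variables. -/
def partitionPoly {k : ℕ} (t : ℂ) (μ : Fin n → ℕ) (v : Fin n → Fin (maxPart μ + 1) → ℂ)
    (σ : Fin k → Fin n) : MvPolynomial (Fin k) ℂ :=
  ∑ ks ∈ admissible μ σ, C (pathSum t v (List.ofFn ks)) * ∏ r, X r ^ deg (ks r)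

/-- Since the top state is the bottom state translated by that of `μ`, the conservation condition
does not involve `m`. The same finite set of path families therefore serves every term of the
series. -/
theorem formTerm_eq {k : ℕ} (t : ℂ) (μ : Fin n → ℕ) (v : Fin n → Fin (maxPart μ + 1) → ℂ)
    (σ : Fin k → Fin n) (x : Fin k → ℂ) (m : State n (maxPart μ)) :
    formTerm μ v (List.ofFn fun r => rowOp (maxPart μ) t (σ r) (x r)).prod m =
      ∑ ks ∈ admissible μ σ, (∏ r, x r ^ deg (ks r)) *
        ((∏ i, ∏ j, v i j ^ m j i) * listWt t (List.ofFn ks) (castS m)) := by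
  classical
  rw [formTerm, prod_rowOp_apply, admissible, Finset.sum_filter, Finset.mul_sum]
  refine Finset.sum_congr rfl fun ks _ => ?_
  have : castS (m + compState μ) = castS m + ∑ r, flux (ks r) ↔
      ∑ r, flux (ks r) = castS (compState μ) := by
    have h : castS (m + compState μ) = castS m + castS (compState μ) := by
      funext c i; simp [castS]
    rw [h, add_right_inj, eq_comm]
  by_cases hc : (∀ r, Bdry (σ r) (ks r)) ∧ ∑ r, flux (ks r) = castS (compState μ)
  · rw [if_pos hc, if_pos ⟨hc.1, this.mpr hc.2⟩]
    ring
  · rw [if_neg hc, if_neg fun h => hc ⟨h.1, this.mp h.2⟩, mul_zero]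

theorem summable_formTerm {k : ℕ} {t : ℂ} (ht : t ≠ 0) (μ : Fin n → ℕ)
    (v : Fin n → Fin (maxPart μ + 1) → ℂ) (hv : ∀ i j, ‖v i j‖ * max 1 ‖t‖ ^ k < 1)
    (σ : Fin k → Fin n) (x : Fin k → ℂ) :
    Summable (formTerm μ v (List.ofFn fun r => rowOp (maxPart μ) t (σ r) (x r)).prod) := by
  have : formTerm μ v (List.ofFn fun r => rowOp (maxPart μ) t (σ r) (x r)).prod = _ :=
    funext fun m => formTerm_eq t μ v σ x m
  rw [this]
  exact summable_sum fun ks _ =>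
    (summable_listWt ht v (List.ofFn ks) (by simpa using hv)).mul_left _

theorem eval_partitionPoly {k : ℕ} {t : ℂ} (ht : t ≠ 0) (μ : Fin n → ℕ)
    (v : Fin n → Fin (maxPart μ + 1) → ℂ) (hv : ∀ i j, ‖v i j‖ * max 1 ‖t‖ ^ k < 1)
    (σ : Fin k → Fin n) (x : Fin k → ℂ) :
    eval x (partitionPoly t μ v σ) =
      linForm μ v (List.ofFn fun r => rowOp (maxPart μ) t (σ r) (x r)).prod := by
  have hs : ∀ ks : Fin k → RowPath n (maxPart μ), Summable fun m : State n (maxPart μ) =>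
      (∏ i, ∏ j, v i j ^ m j i) * listWt t (List.ofFn ks) (castS m) :=
    fun ks => summable_listWt ht v (List.ofFn ks) (by simpa using hv)
  rw [linForm]
  simp only [formTerm_eq]
  rw [Summable.tsum_finsetSum fun ks _ => (hs ks).mul_left _, partitionPoly, map_sum]
  refine Finset.sum_congr rfl fun ks _ => ?_
  rw [tsum_mul_left, pathSum]
  simp [mul_comm]

/-! ### The Yang--Baxter equation and the exchange relations -/

/-- The weight of a face in terms of `u l = t ^ I_l` and `T l = t ^ I_{[l+1, n]}`. -/
def faceFn (x : ℂ) (u T : ℕ → ℂ) (j l : ℕ) : ℂ :=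
  if l = 0 then 1 else x * ((if j = l then 1 else if j < l then 1 - u l else 0) * T l)

/-- The diagonal entries of the `R`-matrix. -/
def rDiag (t x y : ℂ) (a b : ℕ) : ℂ :=
  if a = b then x - t * y else if a < b then (1 - t) * y else (1 - t) * x

/-- The entries of the `R`-matrix that exchange two labels. -/
def rSwap (t x y : ℂ) (a b : ℕ) : ℂ :=
  if a = b then 0 else if a < b then x - y else t * (x - y)

/-- The weight of two faces on top of each other, in terms of `u l = t ^ (I_l - 1)` and
`T l = t ^ (I_{[l+1, n]} - 1)` for the bottom state `I`. -/
def facePairFn (t x y : ℂ) (u T : ℕ → ℂ) (a b c d : ℕ) : ℂ :=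
  faceFn x (fun l => t * u l) (fun l => t * T l) a c *
    faceFn y (fun l => (if a = l then t else 1) * ((if c = l then 1 else t) * u l))
      (fun l => (if l < a then t else 1) * ((if l < c then 1 else t) * T l)) b d

-- The entries depend only on the relative order of the four labels and on which outgoing labels are
-- zero. For each order the claim is a polynomial identity, valid for arbitrary functions `u` and
-- `T`. Normalizing with `t ^ (I_l - 1)` is what avoids division by `t` when a colour leaves.
set_option maxHeartbeats 4000000 in
theorem yangBaxter_face (t x y : ℂ) (u T : ℕ → ℂ) (a b c d : ℕ) :
    rDiag t x y a b * facePairFn t x y u T a b c d +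
        rSwap t x y a b * facePairFn t x y u T b a c d =
      facePairFn t y x u T a b c d * rDiag t x y c d +
        facePairFn t y x u T a b d c * rSwap t x y d c := by
  unfold rDiag rSwap facePairFn faceFn
  rcases lt_trichotomy a b with hab | hab | hab <;>
  rcases lt_trichotomy c d with hcd | hcd | hcd <;>
  rcases Nat.eq_zero_or_pos c with hc | hc <;>
  rcases Nat.eq_zero_or_pos d with hd | hd <;> first | omega | skip
  all_goals
    rcases lt_trichotomy a c with hac | hac | hac <;> first | omega | skip
  all_goals
    rcases lt_trichotomy b c with hbc | hbc | hbc <;> first | omega | skip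
  all_goals
    rcases lt_trichotomy a d with had | had | had <;> first | omega | skip
  all_goals
    rcases lt_trichotomy b d with hbd | hbd | hbd <;> first | omega | skip
  all_goals
    simp (disch := omega) only [if_pos, if_neg]
    try subst hab
    try subst hcd
    try subst hac
    try subst hbc
    try subst had
    try subst hbd
    ring

/-- The position of a label in the order `0 < 1 < ⋯ < n`. -/
def labelNum : Option (Fin n) → ℕ
  | none => 0
  | some i => i + 1

theorem labelNum_injective : Function.Injective (labelNum : Option (Fin n) → ℕ) := by
  intro a b h
  cases a <;> cases b <;> simp_all [labelNum, Fin.ext_iff]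

/-- The function `l ↦ t ^ I_l`. -/
def occFn (t : ℂ) (I : Fin n → ℤ) (l : ℕ) : ℂ := t ^ ∑ k : Fin n, if (k : ℕ) + 1 = l then I k else 0

/-- The function `l ↦ t ^ I_{[l+1, n]}`. -/
def tailFn (t : ℂ) (I : Fin n → ℤ) (l : ℕ) : ℂ := t ^ ∑ k : Fin n, if l ≤ k then I k else 0

theorem colWt_eq_faceFn (t x : ℂ) (I : Fin n → ℤ) (j l : Option (Fin n)) :
    x ^ (if l.isSome then 1 else 0) * colWt t I j l =
      faceFn x (occFn t I) (tailFn t I) (labelNum j) (labelNum l) := by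
  cases l with
  | none => simp [colWt, faceFn, labelNum]
  | some k =>
    have h1 : occFn t I (labelNum (some k)) = t ^ I k := by
      simp [occFn, labelNum, ← Fin.ext_iff]
    have h2 : tailFn t I (labelNum (some k)) = t ^ ∑ k' ∈ Finset.Ioi k, I k' := by
      unfold tailFn
      rw [← Finset.sum_filter]
      congr 2
      ext k'
      simp only [labelNum, Finset.mem_filter, Finset.mem_univ, true_and, Finset.mem_Ioi,
        Fin.lt_def, Nat.succ_le_iff]
    have h3 : (labelNum j = labelNum (some k)) ↔ j = some k := labelNum_injective.eq_iff
    have h4 : (labelNum j < labelNum (some k)) ↔ ∀ i ∈ j, i < k := by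
      cases j <;> simp [labelNum]
    simp only [faceFn, h1, h2, h3, h4]
    simp [colWt, labelNum]

theorem occFn_shift {t : ℂ} (ht : t ≠ 0) (I : Fin n → ℤ) (a c : Option (Fin n)) {l : ℕ}
    (hl : l ≠ 0) : occFn t (I + (unitZ a - unitZ c)) l =
      (if labelNum a = l then t else 1) *
        ((if labelNum c = l then 1 else t) * (t⁻¹ * occFn t I l)) := by
  have h : ∀ b : Option (Fin n), (∑ k : Fin n, if (k : ℕ) + 1 = l then unitZ b k else 0) =
      if labelNum b = l then 1 else 0 := by
    intro b
    cases b with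
    | none => simp [unitZ, labelNum, hl.symm]
    | some i =>
      simp only [unitZ, Option.some.injEq]
      rw [Finset.sum_eq_single i]
      · by_cases hi : (i : ℕ) + 1 = l <;> simp [labelNum, hi]
      · intro k _ hk; simp [hk.symm]
      · simp
  unfold occFn
  have : (∑ k : Fin n, if (k : ℕ) + 1 = l then (I + (unitZ a - unitZ c)) k else 0) =
      (∑ k : Fin n, if (k : ℕ) + 1 = l then I k else 0) +
        ((if labelNum a = l then 1 else 0) - if labelNum c = l then 1 else 0) := by
    rw [← h a, ← h c, ← Finset.sum_sub_distrib, ← Finset.sum_add_distrib]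
    refine Finset.sum_congr rfl fun k _ => ?_
    split_ifs <;> simp
  rw [this, zpow_add₀ ht]
  split_ifs <;> simp [zpow_neg, ht, mul_comm]

theorem tailFn_shift {t : ℂ} (ht : t ≠ 0) (I : Fin n → ℤ) (a c : Option (Fin n)) (l : ℕ) :
    tailFn t (I + (unitZ a - unitZ c)) l =
      (if l < labelNum a then t else 1) *
        ((if l < labelNum c then 1 else t) * (t⁻¹ * tailFn t I l)) := by
  have h : ∀ b : Option (Fin n), (∑ k : Fin n, if l ≤ (k : ℕ) then unitZ b k else 0) =
      if l < labelNum b then 1 else 0 := by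
    intro b
    cases b with
    | none => simp [unitZ, labelNum]
    | some i =>
      simp only [unitZ, labelNum, Option.some.injEq]
      rw [Finset.sum_eq_single i]
      · simp
      · intro k _ hk; simp [hk.symm]
      · simp
  unfold tailFn
  have : (∑ k : Fin n, if l ≤ (k : ℕ) then (I + (unitZ a - unitZ c)) k else 0) =
      (∑ k : Fin n, if l ≤ (k : ℕ) then I k else 0) +
        ((if l < labelNum a then 1 else 0) - if l < labelNum c then 1 else 0) := by
    rw [← h a, ← h c, ← Finset.sum_sub_distrib, ← Finset.sum_add_distrib]
    refine Finset.sum_congr rfl fun k _ => ?_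
    split_ifs <;> simp
  rw [this, zpow_add₀ ht]
  split_ifs <;> simp [zpow_neg, ht, mul_comm]

/-- The weight of two faces on top of each other, in terms of the bottom state. -/
def facePair (t x y : ℂ) (I : Fin n → ℤ) (p r : Option (Fin n) × Option (Fin n)) : ℂ :=
  x ^ (if r.1.isSome then 1 else 0) * colWt t I p.1 r.1 *
    (y ^ (if r.2.isSome then 1 else 0) * colWt t (I + (unitZ p.1 - unitZ r.1)) p.2 r.2)

theorem facePair_eq {t : ℂ} (ht : t ≠ 0) (x y : ℂ) (I : Fin n → ℤ)
    (p r : Option (Fin n) × Option (Fin n)) :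
    facePair t x y I p r =
      facePairFn t x y (fun l => t⁻¹ * occFn t I l) (fun l => t⁻¹ * tailFn t I l)
        (labelNum p.1) (labelNum p.2) (labelNum r.1) (labelNum r.2) := by
  unfold facePair facePairFn
  rw [colWt_eq_faceFn, colWt_eq_faceFn]
  have h1 : (fun l => t * (t⁻¹ * occFn t I l)) = occFn t I :=
    funext fun l => mul_inv_cancel_left₀ ht _
  have h2 : (fun l => t * (t⁻¹ * tailFn t I l)) = tailFn t I :=
    funext fun l => mul_inv_cancel_left₀ ht _
  rw [h1, h2]
  congr 1
  unfold faceFn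
  -- The label zero must be set aside: the shift rule for `occFn` fails there, but the face weight
  -- is then 1.
  by_cases h0 : labelNum r.2 = 0
  · simp [h0]
  · rw [tailFn_shift ht, occFn_shift ht I p.1 r.1 h0]

/-- The matrix of one column of a two-row configuration with bottom `I` and top `J`. -/
def colMatrix (t x y : ℂ) (I J : Fin n → ℤ) :
    Matrix (Option (Fin n) × Option (Fin n)) (Option (Fin n) × Option (Fin n)) ℂ :=
  fun p r => if J = I + (unitZ p.1 - unitZ r.1) + (unitZ p.2 - unitZ r.2) then
    facePair t x y I p r else 0

/-- The `R`-matrix. -/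
def rMatrix (n : ℕ) (t x y : ℂ) :
    Matrix (Option (Fin n) × Option (Fin n)) (Option (Fin n) × Option (Fin n)) ℂ :=
  fun p r => (if r = p then rDiag t x y (labelNum p.1) (labelNum p.2) else 0) +
    if r = p.swap then rSwap t x y (labelNum p.1) (labelNum p.2) else 0

/-- The conservation condition is symmetric in the two rows, and the `R`-matrix at most swaps two
labels. The condition therefore factors out, leaving the identity for four labels. -/
theorem yangBaxter_column {t : ℂ} (ht : t ≠ 0) (x y : ℂ) (I J : Fin n → ℤ) :
    rMatrix n t x y * colMatrix t x y I J = colMatrix t y x I J * rMatrix n t x y := by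
  ext p r
  rw [Matrix.mul_apply, Matrix.mul_apply]
  simp only [rMatrix, add_mul, mul_add, ite_mul, mul_ite, zero_mul, mul_zero,
    Finset.sum_add_distrib, Finset.sum_ite_eq', Finset.sum_ite_eq, Finset.mem_univ, if_true]
  have hsw : ∀ s : Option (Fin n) × Option (Fin n), r = s.swap ↔ s = r.swap := by
    intro s
    constructor <;> rintro rfl <;> simp
  simp only [hsw, Finset.sum_ite_eq', Finset.mem_univ, if_true]
  have hc1 : J = I + (unitZ p.swap.1 - unitZ r.1) + (unitZ p.swap.2 - unitZ r.2) ↔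
      J = I + (unitZ p.1 - unitZ r.1) + (unitZ p.2 - unitZ r.2) := by
    rw [show I + (unitZ p.swap.1 - unitZ r.1) + (unitZ p.swap.2 - unitZ r.2) =
      I + (unitZ p.1 - unitZ r.1) + (unitZ p.2 - unitZ r.2) by
        simp only [Prod.fst_swap, Prod.snd_swap]; abel]
  have hc2 : J = I + (unitZ p.1 - unitZ r.swap.1) + (unitZ p.2 - unitZ r.swap.2) ↔
      J = I + (unitZ p.1 - unitZ r.1) + (unitZ p.2 - unitZ r.2) := by
    rw [show I + (unitZ p.1 - unitZ r.swap.1) + (unitZ p.2 - unitZ r.swap.2) =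
      I + (unitZ p.1 - unitZ r.1) + (unitZ p.2 - unitZ r.2) by
        simp only [Prod.fst_swap, Prod.snd_swap]; abel]
  unfold colMatrix
  rw [if_congr hc1 rfl rfl, if_congr hc2 rfl rfl]
  split_ifs
  · simp only [facePair_eq ht]
    exact yangBaxter_face t x y _ _ _ _ _ _
  · simp

/-! ### From one column to a whole row -/

/-- Entries of a product of matrices as sums over paths. -/
theorem prod_ofFn_apply {ι : Type*} [Fintype ι] [DecidableEq ι] (k : ℕ)
    (A : Fin k → Matrix ι ι ℂ) (a b : ι) :
    (List.ofFn A).prod a b = ∑ κ : Fin (k + 1) → ι,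
      if κ 0 = a ∧ κ (Fin.last k) = b then ∏ c, A c (κ c.castSucc) (κ c.succ) else 0 := by
  induction k generalizing a with
  | zero =>
    rw [← (Equiv.funUnique (Fin 1) ι).symm.sum_comp]
    simp only [List.ofFn_zero, List.prod_nil, Matrix.one_apply, Equiv.funUnique_symm_apply,
      uniqueElim_const, Finset.univ_eq_empty, Finset.prod_empty]
    by_cases h : a = b
    · subst h; simp
    · rw [if_neg h, Finset.sum_eq_zero]
      intro x _
      rw [if_neg]
      rintro ⟨rfl, h'⟩
      exact h h'
  | succ k ih =>
    rw [List.ofFn_succ, List.prod_cons, Matrix.mul_apply,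
      ← (Fin.consEquiv fun _ : Fin (k + 2) => ι).sum_comp, Fintype.sum_prod_type]
    have hR : ∀ c : ι, c ≠ a → ∑ κ : Fin (k + 1) → ι,
        (if (Fin.consEquiv fun _ => ι) (c, κ) 0 = a ∧
            (Fin.consEquiv fun _ => ι) (c, κ) (Fin.last (k + 1)) = b then
          ∏ d : Fin (k + 1), A d ((Fin.consEquiv fun _ => ι) (c, κ) d.castSucc)
            ((Fin.consEquiv fun _ => ι) (c, κ) d.succ) else 0) = 0 := by
      intro c hc
      refine Finset.sum_eq_zero fun κ _ => if_neg fun h => hc h.1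
    rw [Finset.sum_eq_single_of_mem (s := Finset.univ) (f := fun c : ι => ∑ κ : Fin (k + 1) → ι,
        (if (Fin.consEquiv fun _ => ι) (c, κ) 0 = a ∧
            (Fin.consEquiv fun _ => ι) (c, κ) (Fin.last (k + 1)) = b then
          ∏ d : Fin (k + 1), A d ((Fin.consEquiv fun _ => ι) (c, κ) d.castSucc)
            ((Fin.consEquiv fun _ => ι) (c, κ) d.succ) else 0)) a (Finset.mem_univ _)
        fun c _ => hR c]
    simp only [ih, Finset.mul_sum]
    rw [Finset.sum_comm]
    refine Finset.sum_congr rfl fun κ _ => ?_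
    rw [Finset.sum_eq_single_of_mem (κ 0) (Finset.mem_univ _) fun c _ hc => by
      rw [if_neg fun h => hc h.1.symm, mul_zero]]
    have h1 : ((Fin.consEquiv fun _ : Fin (k + 2) => ι) (a, κ) 0 = a ∧
        (Fin.consEquiv fun _ : Fin (k + 2) => ι) (a, κ) (Fin.last (k + 1)) = b) ↔
        (κ 0 = κ 0 ∧ κ (Fin.last k) = b) := by
      constructor
      · rintro ⟨-, h⟩; exact ⟨rfl, h⟩
      · rintro ⟨-, h⟩; exact ⟨rfl, h⟩
    by_cases hb : κ 0 = κ 0 ∧ κ (Fin.last k) = b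
    · rw [if_pos hb, if_pos (h1.mpr hb), Fin.prod_univ_succ]
      rfl
    · rw [if_neg hb, if_neg fun h => hb (h1.mp h), mul_zero]

theorem mul_prod_eq_prod_mul {M : Type*} [Monoid M] {k : ℕ} {r : M} {A B : Fin k → M}
    (h : ∀ c, r * A c = B c * r) : r * (List.ofFn A).prod = (List.ofFn B).prod * r := by
  induction k with
  | zero => simp
  | succ k ih =>
    rw [List.ofFn_succ, List.ofFn_succ, List.prod_cons, List.prod_cons, ← mul_assoc, h, mul_assoc,
      ih fun c => h c.succ, mul_assoc]

theorem rowOp_mul_rowOp_apply {N : ℕ} (t x y : ℂ) (i j : Fin n) (I J : State n N) :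
    (rowOp N t i x * rowOp N t j y) (Finsupp.single J 1) I =
      (List.ofFn fun c => colMatrix t x y (castS I c) (castS J c)).prod
        (some i, some j) (none, none) := by
  have h := prod_rowOp_apply t 2 ![i, j] ![x, y] I J
  simp only [List.ofFn_succ, List.ofFn_zero, List.prod_cons, List.prod_nil, mul_one,
    Matrix.cons_val_zero, Matrix.cons_val_succ, Fin.sum_univ_two, Fin.prod_univ_two,
    Fin.forall_fin_two, Matrix.cons_val_one, Fin.succ_zero_eq_one, listWt] at h
  rw [h, prod_ofFn_apply]
  let e : (Fin 2 → RowPath n N) ≃ (Fin (N + 2) → Option (Fin n) × Option (Fin n)) :=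
    (finTwoArrowEquiv _).trans (Equiv.arrowProdEquivProdArrow _ _ _).symm
  rw [← e.sum_comp]
  refine Finset.sum_congr rfl fun ks _ => ?_
  have he : ∀ c, e ks c = (ks 0 c, ks 1 c) := fun c => rfl
  simp only [he, Prod.mk.injEq, colMatrix]
  by_cases hb : Bdry i (ks 0) ∧ Bdry j (ks 1)
  swap
  · rw [if_neg (fun h => hb h.1), if_neg]
    unfold Bdry at hb
    tauto
  have hb' := hb
  unfold Bdry at hb'
  rw [if_pos (show (ks 0 0 = some i ∧ ks 1 0 = some j) ∧
    ks 0 (Fin.last (N + 1)) = none ∧ ks 1 (Fin.last (N + 1)) = none by tauto)]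
  by_cases hf : castS J = castS I + (flux (ks 0) + flux (ks 1))
  · rw [if_pos ⟨hb, hf⟩]
    have : ∀ c, castS J c = castS I c + (unitZ (ks 0 c.castSucc) - unitZ (ks 0 c.succ)) +
        (unitZ (ks 1 c.castSucc) - unitZ (ks 1 c.succ)) := by
      intro c
      rw [congrFun hf c, add_assoc]
      rfl
    rw [Finset.prod_congr rfl fun c _ => if_pos (this c)]
    simp only [facePair, Finset.prod_mul_distrib, Finset.prod_pow_eq_pow_sum, deg,
      Finset.card_filter, rowWt]
    simp only [Pi.add_apply, flux]
    ring
  · rw [if_neg (fun h => hf h.2)]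
    have : ∃ c, ¬ castS J c = castS I c + (unitZ (ks 0 c.castSucc) - unitZ (ks 0 c.succ)) +
        (unitZ (ks 1 c.castSucc) - unitZ (ks 1 c.succ)) := by
      by_contra hcon
      push Not at hcon
      apply hf
      funext c
      rw [hcon c, add_assoc]
      rfl
    obtain ⟨c, hc⟩ := this
    exact (Finset.prod_eq_zero (Finset.mem_univ c) (if_neg hc)).symm

/-- The exchange relation of two row operators. -/
theorem rowOp_exchange {N : ℕ} {t : ℂ} (ht : t ≠ 0) (x y : ℂ) (i j : Fin n) :
    (x - t * y) • (rowOp N t i y * rowOp N t j x) =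
      rDiag t x y i j • (rowOp N t i x * rowOp N t j y) +
        rSwap t x y i j • (rowOp N t j x * rowOp N t i y) := by
  refine Finsupp.lhom_ext' fun J => LinearMap.ext_ring ?_
  ext I
  have h0 := mul_prod_eq_prod_mul fun c : Fin (N + 1) =>
    yangBaxter_column ht x y (castS I c) (castS J c)
  -- The `R`-matrix has been carried through all columns. On the right boundary both labels are zero
  -- and it acts by `x - t * y`; on the left boundary it mixes `(i, j)` with `(j, i)`.
  have h := congrArg (fun M : Matrix _ _ ℂ => M (some i, some j) (none, none)) h0
  rw [Matrix.mul_apply, Matrix.mul_apply] at h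
  simp only [rMatrix, add_mul, mul_add, ite_mul, mul_ite, zero_mul, mul_zero,
    Finset.sum_add_distrib, Finset.sum_ite_eq', Finset.sum_ite_eq, Finset.mem_univ, if_true] at h
  have hsw : ∀ s : Option (Fin n) × Option (Fin n), (none, none) = s.swap ↔ s = (none, none) := by
    intro s
    constructor
    · intro h; rw [← s.swap_swap, ← h]; rfl
    · rintro rfl; rfl
  simp only [hsw, Finset.sum_ite_eq', Finset.mem_univ, if_true, Prod.swap_prod_mk] at h
  rw [← rowOp_mul_rowOp_apply t x y i j I J, ← rowOp_mul_rowOp_apply t x y j i I J,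
    ← rowOp_mul_rowOp_apply t y x i j I J] at h
  have h1 : rDiag t x y (labelNum (some i)) (labelNum (some j)) = rDiag t x y i j := by
    simp [rDiag, labelNum]
  have h2 : rSwap t x y (labelNum (some i)) (labelNum (some j)) = rSwap t x y i j := by
    simp [rSwap, labelNum]
  have h3 : rDiag t x y (labelNum (none : Option (Fin n))) (labelNum (none : Option (Fin n))) =
      x - t * y := by simp [rDiag]
  have h4 : rSwap t x y (labelNum (none : Option (Fin n))) (labelNum (none : Option (Fin n))) =
      0 := by simp [rSwap]
  rw [h1, h2, h3, h4, mul_zero, add_zero] at h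
  simp only [LinearMap.coe_comp, Function.comp_apply, Finsupp.lsingle_apply,
    LinearMap.smul_apply, LinearMap.add_apply, Finsupp.smul_apply, Finsupp.add_apply, smul_eq_mul]
  rw [mul_comm, ← h]

/-! ### The cyclic relation -/

theorem prod_zpow_eq_zpow_sum {ι : Type*} (s : Finset ι) {a : ℂ} (ha : a ≠ 0) (f : ι → ℤ) :
    ∏ i ∈ s, a ^ f i = a ^ ∑ i ∈ s, f i := by
  classical
  induction s using Finset.induction_on with
  | empty => simp
  | insert i s hi ih => rw [Finset.prod_insert hi, Finset.sum_insert hi, zpow_add₀ ha, ih]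

theorem unitZ_nonneg (j : Option (Fin n)) (k : Fin n) : 0 ≤ unitZ j k := by
  unfold unitZ; split_ifs <;> simp

/-- The sum of the entries of `E` at the colours larger than `l` (zero if `l = 0`). -/
def tailPair (l : Option (Fin n)) (E : Fin n → ℤ) : ℤ :=
  ∑ k', E k' * ∑ k ∈ Finset.Iio k', unitZ l k

/-- When the outgoing colour is absent from `E`, the factor `1 - t ^ I k` does not see `E`. Only the
tail sum changes, so extra particles cost a pure power of `t`. -/
theorem colWt_add {t : ℂ} (ht : t ≠ 0) (I E : Fin n → ℤ) (j l : Option (Fin n))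
    (h : ∀ k, l = some k → E k = 0) :
    colWt t (I + E) j l = colWt t I j l * t ^ tailPair l E := by
  cases l with
  | none => simp [colWt, tailPair, unitZ]
  | some k =>
    have h1 : tailPair (some k) E = ∑ k' ∈ Finset.Ioi k, E k' := by
      rw [tailPair, ← Finset.sum_filter_add_sum_filter_not Finset.univ (fun k' => k < k')]
      have h2 : ∑ k' ∈ Finset.univ.filter (fun k' => ¬ k < k'),
          E k' * ∑ k₁ ∈ Finset.Iio k', unitZ (some k) k₁ = 0 := by
        refine Finset.sum_eq_zero fun k' hk' => ?_
        rw [Finset.sum_eq_zero, mul_zero]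
        intro k₁ hk₁
        have : k ≠ k₁ := by
          rintro rfl
          exact (Finset.mem_filter.mp hk').2 (Finset.mem_Iio.mp hk₁)
        simp [unitZ, this]
      rw [h2, add_zero]
      refine Finset.sum_congr (by ext; simp) fun k' hk' => ?_
      have hk : k ∈ Finset.Iio k' := by simpa using hk'
      rw [Finset.sum_eq_single_of_mem k hk fun b _ hb => by simp [unitZ, hb.symm]]
      simp [unitZ]
    rw [h1]
    simp only [colWt, Pi.add_apply, h k rfl, add_zero, Finset.sum_add_distrib, zpow_add₀ ht]
    ring

theorem rowWt_add {N : ℕ} {t : ℂ} (ht : t ≠ 0) (κ : RowPath n N) (I E : ZState n N)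
    (h : ∀ c k, κ (Fin.succ c) = some k → E c k = 0) :
    rowWt t κ (I + E) = rowWt t κ I * t ^ ∑ c, tailPair (κ (Fin.succ c)) (E c) := by
  rw [← prod_zpow_eq_zpow_sum _ ht, rowWt, rowWt, ← Finset.prod_mul_distrib]
  exact Finset.prod_congr rfl fun c _ => colWt_add ht _ _ _ _ (h c)

theorem listWt_add {N : ℕ} {t : ℂ} (ht : t ≠ 0) (ks : List (RowPath n N)) (I E : ZState n N)
    (h : ∀ κ ∈ ks, ∀ c k, κ (Fin.succ c) = some k → E c k = 0) :
    listWt t ks (I + E) = listWt t ks I *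
      t ^ ∑ c, ∑ k', E c k' * ∑ k ∈ Finset.Iio k', (ks.map fun κ => unitZ (κ c.succ) k).sum := by
  induction ks generalizing I with
  | nil => simp [listWt]
  | cons κ ks ih =>
    rw [listWt, listWt, rowWt_add ht κ I E (h κ (by simp)), add_right_comm,
      ih (I + flux κ) fun κ' hκ' => h κ' (by simp [hκ'])]
    simp only [List.map_cons, List.sum_cons, Finset.sum_add_distrib, mul_add, zpow_add₀ ht,
      tailPair]
    ring

theorem sum_map_flux_apply {N : ℕ} (ks : List (RowPath n N)) (c : Fin (N + 1)) (k : Fin n) :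
    (ks.map flux).sum c k = (ks.map fun κ => unitZ (κ c.castSucc) k).sum -
      (ks.map fun κ => unitZ (κ c.succ) k).sum := by
  induction ks with
  | nil => simp
  | cons κ ks ih =>
    simp only [List.map_cons, List.sum_cons, Pi.add_apply, ih, flux, Pi.sub_apply]
    ring

theorem abel_sum (g U : ℕ → ℤ) (M : ℕ) :
    U 0 * g 0 + ∑ c ∈ Finset.range M, g c * (U (c + 1) - U c) =
      U M * g M + ∑ c ∈ Finset.range M, U (c + 1) * (g c - g (c + 1)) := by
  induction M with
  | zero => simp
  | succ M ih =>
    rw [Finset.sum_range_succ, Finset.sum_range_succ, ← add_assoc, ih]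
    ring

theorem sum_fin_ite_lt {N M : ℕ} (hM : M ≤ N + 1) (f : ℕ → ℤ) :
    (∑ c : Fin (N + 1), if (c : ℕ) < M then f c else 0) = ∑ c ∈ Finset.range M, f c := by
  rw [Fin.sum_univ_eq_sum_range (fun c => if c < M then f c else 0) (N + 1),
    ← Finset.sum_filter]
  congr 1
  ext c
  simp only [Finset.mem_filter, Finset.mem_range]
  omega

theorem le_maxPart (μ : Fin n → ℕ) (l : Fin n) : μ l ≤ maxPart μ :=
  Finset.le_sup (f := μ) (Finset.mem_univ l)

theorem gammaExp_sub (μ : Fin n → ℕ) (l : Fin n) {c : ℕ} (hc : c < μ l) :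
    gammaExp μ l c - gammaExp μ l (c + 1) =
      ∑ k ∈ Finset.Ioi l, if μ k = c then 1 else 0 := by
  have h : (Finset.univ.filter fun k => l < k ∧ c ≤ μ k ∧ μ k < μ l).card =
      (Finset.univ.filter fun k => l < k ∧ c + 1 ≤ μ k ∧ μ k < μ l).card +
        ((Finset.Ioi l).filter fun k => μ k = c).card := by
    rw [← Finset.card_union_of_disjoint]
    · congr 1
      ext k
      simp only [Finset.mem_filter, Finset.mem_univ, true_and, Finset.mem_union, Finset.mem_Ioi]
      omega
    · rw [Finset.disjoint_left]
      intro k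
      simp only [Finset.mem_filter, Finset.mem_univ, true_and, Finset.mem_Ioi]
      omega
  unfold gammaExp
  rw [h, Finset.sum_boole]
  push_cast
  ring

theorem gammaExp_self (μ : Fin n → ℕ) (l : Fin n) :
    gammaExp μ l (μ l) = -∑ k ∈ Finset.Iio l, if μ l < μ k then 1 else 0 := by
  have h : (Finset.univ.filter fun k => l < k ∧ μ l ≤ μ k ∧ μ k < μ l) = ∅ := by
    ext k
    simp only [Finset.mem_filter, Finset.mem_univ, true_and, Finset.notMem_empty, iff_false]
    omega
  unfold gammaExp
  rw [h, Finset.sum_boole]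
  simp only [Finset.card_empty, Nat.cast_zero, add_zero]
  congr 3
  ext k
  simp

/-- Summation by parts along the path of one colour. -/
theorem exponent_identities (μ : Fin n → ℕ) (l : Fin n) (U : ℕ → ℤ) (hU : ∀ j, μ l < j → U j = 0) :
    (∑ c : Fin (maxPart μ + 1), U (c + 1) = U 0 * μ l +
      ∑ c : Fin (maxPart μ + 1), if (c : ℕ) < μ l then
        ((μ l : ℤ) - c) * (U (c + 1) - U c) else 0) ∧
    (∑ c : Fin (maxPart μ + 1), (U (c + 1) * (∑ k ∈ Finset.Ioi l, if μ k = c then 1 else 0) -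
        if μ l = c then U c * (∑ k ∈ Finset.Iio l, if (c : ℕ) < μ k then 1 else 0) else 0) =
      U 0 * gammaExp μ l 0 +
      ∑ c : Fin (maxPart μ + 1), if (c : ℕ) < μ l then
        gammaExp μ l c * (U (c + 1) - U c) else 0) := by
  have hM : μ l ≤ maxPart μ + 1 := (le_maxPart μ l).trans (Nat.le_succ _)
  have hcut : ∀ f : ℕ → ℤ, ∑ c : Fin (maxPart μ + 1), U (c + 1) * f c =
      ∑ c ∈ Finset.range (μ l), U (c + 1) * f c := by
    intro f
    rw [← sum_fin_ite_lt hM fun c => U (c + 1) * f c]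
    refine Finset.sum_congr rfl fun c _ => ?_
    split_ifs with h
    · rfl
    · rw [hU _ (by omega), zero_mul]
  constructor
  -- `μ l - c` is the exponent of `q` in the twist. Its differences are all 1 and it vanishes at `c
  -- = μ l`, so summation by parts counts the edges of colour `l`.
  · have h1 := abel_sum (fun c => (μ l : ℤ) - c) U (μ l)
    have h2 := hcut fun _ => 1
    simp only [mul_one] at h2
    rw [sum_fin_ite_lt hM fun c => ((μ l : ℤ) - c) * (U (c + 1) - U c), h2]
    simp only [Nat.cast_zero, sub_zero, sub_self, mul_zero, zero_add] at h1
    rw [h1]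
    refine Finset.sum_congr rfl fun c _ => ?_
    push_cast
    ring
  -- For the exponent of `t`, the differences count the larger colours ending in column `c`. The end
  -- value at `μ l` is nonzero and accounts for the smaller colours with larger part.
  · have h1 := abel_sum (fun c => gammaExp μ l c) U (μ l)
    rw [sum_fin_ite_lt hM fun c => gammaExp μ l c * (U (c + 1) - U c), h1,
      Finset.sum_sub_distrib, hcut fun c => ∑ k ∈ Finset.Ioi l, if μ k = c then 1 else 0]
    have h3 : (∑ c : Fin (maxPart μ + 1), if μ l = c then
        U c * (∑ k ∈ Finset.Iio l, if (c : ℕ) < μ k then 1 else 0) else 0) =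
        U (μ l) * ∑ k ∈ Finset.Iio l, if μ l < μ k then 1 else 0 := by
      rw [Finset.sum_eq_single_of_mem
        (⟨μ l, Nat.lt_succ_of_le (le_maxPart μ l)⟩ : Fin (maxPart μ + 1)) (Finset.mem_univ _)]
      · simp
      · intro c _ hc
        rw [if_neg]
        intro h
        exact hc (Fin.ext h.symm)
    rw [h3, gammaExp_self, Finset.sum_congr rfl fun c hc => by
      rw [← gammaExp_sub μ l (Finset.mem_range.mp hc)]]
    ring

/-! ### Moving the top row to the bottom -/

/-- The product of the powers of the twists, extended by zero to integer states. -/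
def twistProd {N : ℕ} (μ : Fin n → ℕ) (v : Fin n → Fin (N + 1) → ℂ) (m : ZState n N) : ℂ :=
  ∏ l, ∏ c : Fin (N + 1), if (c : ℕ) < μ l then if 0 ≤ m c l then v l c ^ m c l else 0
    else if m c l = 0 then 1 else 0

theorem twistProd_eq_zero {N : ℕ} {μ : Fin n → ℕ} {v : Fin n → Fin (N + 1) → ℂ} {m : ZState n N}
    (c : Fin (N + 1)) (l : Fin n) (h : m c l < 0 ∨ (μ l ≤ c ∧ m c l ≠ 0)) :
    twistProd μ v m = 0 := by
  refine Finset.prod_eq_zero (Finset.mem_univ l) (Finset.prod_eq_zero (Finset.mem_univ c) ?_)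
  split_ifs <;> first | rfl | omega

theorem twistProd_castS {N : ℕ} {μ : Fin n → ℕ} {v : Fin n → Fin (N + 1) → ℂ}
    (hv : ∀ l (c : Fin (N + 1)), μ l ≤ (c : ℕ) → v l c = 0) (m : State n N) :
    twistProd μ v (castS m) = ∏ l, ∏ c, v l c ^ m c l := by
  refine Finset.prod_congr rfl fun l _ => Finset.prod_congr rfl fun c _ => ?_
  simp only [castS, Int.natCast_nonneg, if_true, zpow_natCast, Nat.cast_eq_zero]
  split_ifs with h1 h2
  · rfl
  · rw [h2, pow_zero]
  · rw [hv l c (not_lt.mp h1), zero_pow h2]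

/-- The rotation translates the summation variable by a vector that may have negative entries. Over
integer states this translation is a bijection. -/
theorem pathSum_eq_tsum {N : ℕ} (t : ℂ) {μ : Fin n → ℕ} {v : Fin n → Fin (N + 1) → ℂ}
    (hv : ∀ l (c : Fin (N + 1)), μ l ≤ (c : ℕ) → v l c = 0) (ks : List (RowPath n N)) :
    pathSum t v ks = ∑' m : ZState n N, twistProd μ v m * listWt t ks m := by
  rw [pathSum, ← castS_injective.tsum_eq]
  · simp only [twistProd_castS hv]
  · intro m hm
    by_contra hcon
    apply hm
    have : ¬ 0 ≤ m := fun h => hcon (exists_castS h)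
    simp only [Pi.le_def, not_forall, not_le] at this
    obtain ⟨c, l, hcl⟩ := this
    change twistProd μ v m * _ = 0
    rw [twistProd_eq_zero c l (Or.inl hcl), zero_mul]

theorem twistProd_add {N : ℕ} {μ : Fin n → ℕ} {v : Fin n → Fin (N + 1) → ℂ}
    (hv : ∀ l (c : Fin (N + 1)), (c : ℕ) < μ l → v l c ≠ 0) {m s : ZState n N} (hm : 0 ≤ m) (hms : 0 ≤ m + s)
    (hs : ∀ l (c : Fin (N + 1)), μ l ≤ (c : ℕ) → s c l = 0) :
    twistProd μ v (m + s) = twistProd μ v m *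
      ∏ l, ∏ c : Fin (N + 1), if (c : ℕ) < μ l then v l c ^ s c l else 1 := by
  simp only [twistProd, ← Finset.prod_mul_distrib]
  refine Finset.prod_congr rfl fun l _ => Finset.prod_congr rfl fun c _ => ?_
  by_cases h1 : (c : ℕ) < μ l
  · rw [if_pos h1, if_pos h1, if_pos h1,
      if_pos (show 0 ≤ (m + s) c l from hms c l), if_pos (show 0 ≤ m c l from hm c l), ← zpow_add₀ (hv l c h1)]
    rfl
  · rw [if_neg h1, if_neg h1, if_neg h1, Pi.add_apply, Pi.add_apply, hs l c (not_lt.mp h1),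
      add_zero, mul_one]

theorem deg_eq_sum {N : ℕ} (κ : RowPath n N) :
    (deg κ : ℤ) = ∑ l, ∑ c : Fin (N + 1), unitZ (κ c.succ) l := by
  rw [Finset.sum_comm, deg, Finset.card_filter]
  push_cast
  refine Finset.sum_congr rfl fun c _ => ?_
  cases h : κ c.succ with
  | none => simp [unitZ]
  | some k => simp [unitZ]

/-- The twists and the vertical shifts of a path produce the same powers of `q` and `t`. -/
theorem twist_ratio {q t : ℂ} (hq : q ≠ 0) (ht : t ≠ 0) (μ : Fin n → ℕ)
    (κ : RowPath n (maxPart μ)) (i : Fin n) (h0 : κ 0 = some i)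
    (hκ : ∀ j k, κ j = some k → (j : ℕ) ≤ μ k) :
    q ^ deg κ * t ^ ∑ c : Fin (maxPart μ + 1),
        ((∑ k', (if μ k' = c then 1 else 0) * ∑ k ∈ Finset.Iio k', unitZ (κ c.succ) k) -
        ∑ k', (if μ k' = c then unitZ (κ c.castSucc) k' else 0) *
          ∑ k ∈ Finset.Iio k', if (c : ℕ) < μ k then 1 else 0) =
      q ^ μ i * t ^ gammaExp μ i 0 * ∏ l, ∏ c : Fin (maxPart μ + 1),
        if (c : ℕ) < μ l then
          twist q t μ l c ^ (unitZ (κ c.succ) l - unitZ (κ c.castSucc) l) else 1 := by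
  -- `U l j` indicates whether the path carries colour `l` over the vertical line `j`; it is
  -- extended by zero beyond the last line.
  let U : Fin n → ℕ → ℤ := fun l j => if h : j < maxPart μ + 2 then unitZ (κ ⟨j, h⟩) l else 0
  have hU1 : ∀ l (c : Fin (maxPart μ + 1)), U l (c + 1) = unitZ (κ c.succ) l := by
    intro l c
    have : (c : ℕ) + 1 < maxPart μ + 2 := by omega
    simp only [U, this, dif_pos]
    rfl
  have hU0 : ∀ l (c : Fin (maxPart μ + 1)), U l c = unitZ (κ c.castSucc) l := by
    intro l c
    have : (c : ℕ) < maxPart μ + 2 := by omega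
    simp only [U, this, dif_pos]
    rfl
  have hUz : ∀ l, U l 0 = if l = i then 1 else 0 := by
    intro l
    have := hU0 l 0
    simp only [Fin.val_zero, Fin.castSucc_zero, h0] at this
    rw [this]
    simp [unitZ, eq_comm]
  have hUc : ∀ l j, μ l < j → U l j = 0 := by
    intro l j hj
    simp only [U]
    split_ifs with h
    · unfold unitZ
      rw [if_neg]
      intro hh
      exact absurd (hκ _ _ hh) (by simpa using hj)
    · rfl
  have hP : (∏ l, ∏ c : Fin (maxPart μ + 1), if (c : ℕ) < μ l then
      twist q t μ l c ^ (unitZ (κ c.succ) l - unitZ (κ c.castSucc) l) else 1) =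
      q ^ (∑ l, ∑ c : Fin (maxPart μ + 1), if (c : ℕ) < μ l then
        ((μ l : ℤ) - c) * (U l (c + 1) - U l c) else 0) *
      t ^ (∑ l, ∑ c : Fin (maxPart μ + 1), if (c : ℕ) < μ l then
        gammaExp μ l c * (U l (c + 1) - U l c) else 0) := by
    simp only [← prod_zpow_eq_zpow_sum _ hq, ← prod_zpow_eq_zpow_sum _ ht,
      ← Finset.prod_mul_distrib]
    refine Finset.prod_congr rfl fun l _ => Finset.prod_congr rfl fun c _ => ?_
    rw [hU1, hU0]
    split_ifs with h
    · rw [twist, if_pos h, mul_zpow, ← zpow_natCast, ← zpow_mul, ← zpow_mul, Nat.cast_sub h.le]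
    · simp
  have hdeg : (deg κ : ℤ) = μ i + ∑ l, ∑ c : Fin (maxPart μ + 1), if (c : ℕ) < μ l then
      ((μ l : ℤ) - c) * (U l (c + 1) - U l c) else 0 := by
    rw [deg_eq_sum]
    have : ∀ l, ∑ c : Fin (maxPart μ + 1), unitZ (κ c.succ) l = _ := fun l =>
      (Finset.sum_congr rfl fun c _ => (hU1 l c).symm).trans
        (exponent_identities μ l (U l) (hUc l)).1
    simp only [this, Finset.sum_add_distrib, hUz, ite_mul, one_mul, zero_mul,
      Finset.sum_ite_eq', Finset.mem_univ, if_true]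
  have hexp : (∑ c : Fin (maxPart μ + 1),
      ((∑ k', (if μ k' = c then 1 else 0) * ∑ k ∈ Finset.Iio k', unitZ (κ c.succ) k) -
        ∑ k', (if μ k' = c then unitZ (κ c.castSucc) k' else 0) *
          ∑ k ∈ Finset.Iio k', if (c : ℕ) < μ k then 1 else 0)) =
      gammaExp μ i 0 + ∑ l, ∑ c : Fin (maxPart μ + 1), if (c : ℕ) < μ l then
        gammaExp μ l c * (U l (c + 1) - U l c) else 0 := by
    have := Finset.sum_congr (rfl : (Finset.univ : Finset (Fin n)) = _) fun l _ =>
      (exponent_identities μ l (U l) (hUc l)).2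
    simp only [Finset.sum_add_distrib, hUz, ite_mul, one_mul, zero_mul,
      Finset.sum_ite_eq', Finset.mem_univ, if_true] at this
    rw [← this, Finset.sum_comm]
    refine Finset.sum_congr rfl fun c _ => ?_
    rw [Finset.sum_sub_distrib]
    congr 1
    · simp only [Finset.mul_sum, hU1]
      rw [Finset.sum_sigma', Finset.sum_sigma']
      refine Finset.sum_bij' (fun p _ => ⟨p.2, p.1⟩) (fun p _ => ⟨p.2, p.1⟩) ?_ ?_ ?_ ?_ ?_
      · rintro ⟨k', k⟩ h; simpa using h
      · rintro ⟨k, k'⟩ h; simpa using h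
      · rintro ⟨k', k⟩ h; rfl
      · rintro ⟨k, k'⟩ h; rfl
      · rintro ⟨k', k⟩ h; simp [mul_comm]
    · refine Finset.sum_congr rfl fun l _ => ?_
      rw [hU0]
      split_ifs <;> simp
  rw [hP, hexp, ← zpow_natCast, hdeg, zpow_add₀ hq, zpow_add₀ ht, zpow_natCast]
  ring

/-- Moving the top row to the bottom changes the path sum by a factor. -/
theorem pathSum_rotate {q t : ℂ} (hq : q ≠ 0) (ht : t ≠ 0) (μ : Fin n → ℕ)
    (A : List (RowPath n (maxPart μ))) (κ : RowPath n (maxPart μ)) (i : Fin n)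
    (h0 : κ 0 = some i)
    (hA : ∀ j k, (A.map fun κ' => unitZ (κ' j) k).sum + unitZ (κ j) k =
      if (j : ℕ) ≤ μ k then 1 else 0) :
    q ^ deg κ * pathSum t (twist q t μ) (A ++ [κ]) =
      q ^ μ i * t ^ gammaExp μ i 0 * pathSum t (twist q t μ) (κ :: A) := by
  have hv0 : ∀ l (c : Fin (maxPart μ + 1)), μ l ≤ (c : ℕ) → twist q t μ l c = 0 :=
    fun l c h => if_neg (not_lt.mpr h)
  have hv1 : ∀ l (c : Fin (maxPart μ + 1)), (c : ℕ) < μ l → twist q t μ l c ≠ 0 := by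
    intro l c h
    rw [twist, if_pos h]
    exact mul_ne_zero (pow_ne_zero _ hq) (zpow_ne_zero _ ht)
  have hAnn : ∀ j k, 0 ≤ (A.map fun κ' => unitZ (κ' j) k).sum := by
    intro j k
    refine List.sum_nonneg fun z hz => ?_
    obtain ⟨κ', -, rfl⟩ := List.mem_map.mp hz
    exact unitZ_nonneg _ _
  have hκz : ∀ (j : Fin (maxPart μ + 2)) k, μ k < (j : ℕ) → unitZ (κ j) k = 0 := by
    intro j k hjk
    have h1 := hA j k
    rw [if_neg (not_le.mpr hjk)] at h1
    have h2 := hAnn j k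
    have h3 := unitZ_nonneg (κ j) k
    omega
  have hκ : ∀ j k, κ j = some k → (j : ℕ) ≤ μ k := by
    intro j k hjk
    by_contra hcon
    have := hκz j k (not_le.mp hcon)
    simp [unitZ, hjk] at this
  have hA' : ∀ κ' ∈ A, ∀ j k, κ' j = some k → (j : ℕ) ≤ μ k := by
    intro κ' hκ' j k hjk
    by_contra hcon
    have h1 := hA j k
    rw [if_neg hcon] at h1
    have h2 : unitZ (κ' j) k ≤ (A.map fun κ' => unitZ (κ' j) k).sum :=
      List.single_le_sum (fun z hz => by
        obtain ⟨κ'', -, rfl⟩ := List.mem_map.mp hz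
        exact unitZ_nonneg _ _) _ (List.mem_map_of_mem hκ')
    have h3 := unitZ_nonneg (κ j) k
    have h4 : unitZ (κ' j) k = 1 := by simp [unitZ, hjk]
    omega
  have hfA : ∀ (c : Fin (maxPart μ + 1)) l,
      (A.map flux).sum c l = (if μ l = c then 1 else 0) - flux κ c l := by
    intro c l
    rw [sum_map_flux_apply]
    have h1 := hA c.castSucc l
    have h2 := hA c.succ l
    simp only [Fin.val_castSucc, Fin.val_succ] at h1 h2
    simp only [flux, Pi.sub_apply]
    split_ifs at h1 h2 ⊢ <;> omega
  -- In columns `c < μ l` the flux of colour `l` through the whole stack is zero, so the rows of `A`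
  -- change it by `-flux κ`. With `m` below `A` and `m + s` below `κ`, each row meets the same
  -- occupation of `l` in both orders.
  let s : ZState n (maxPart μ) := fun c l => if (c : ℕ) < μ l then -flux κ c l else 0
  have hs : ∀ l (c : Fin (maxPart μ + 1)), μ l ≤ (c : ℕ) → s c l = 0 :=
    fun l c h => if_neg (not_lt.mpr h)
  have hfl : ∀ (c : Fin (maxPart μ + 1)) l, μ l ≤ (c : ℕ) →
      flux κ c l = if μ l = c then unitZ (κ c.castSucc) l else 0 := by
    intro c l h
    simp only [flux, Pi.sub_apply]
    rw [hκz c.succ l (by simp only [Fin.val_succ]; omega)]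
    split_ifs with h'
    · simp
    · rw [hκz c.castSucc l (by simp only [Fin.val_castSucc]; omega)]
      simp
  rw [pathSum_eq_tsum t hv0, pathSum_eq_tsum t hv0, ← tsum_mul_left, ← tsum_mul_left,
    ← (Equiv.addRight s).tsum_eq fun m => q ^ μ i * t ^ gammaExp μ i 0 *
      (twistProd μ (twist q t μ) m * listWt t (κ :: A) m)]
  refine tsum_congr fun m => ?_
  simp only [Equiv.coe_addRight]
  rw [listWt_append, listWt]
  simp only [listWt, mul_one]
  -- states outside the support of the twists
  by_cases hout : ∃ c l, μ l ≤ (c : Fin (maxPart μ + 1)) ∧ m c l ≠ 0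
  · obtain ⟨c, l, h1, h2⟩ := hout
    rw [twistProd_eq_zero c l (Or.inr ⟨h1, h2⟩), twistProd_eq_zero (m := m + s) c l
      (Or.inr ⟨h1, by simpa [hs l c h1] using h2⟩)]
    simp
  push Not at hout
  -- states with negative entries
  by_cases hneg : 0 ≤ m
  swap
  · simp only [Pi.le_def, not_forall, not_le] at hneg
    obtain ⟨c, l, h1⟩ := hneg
    have h1 : m c l < 0 := h1
    have hc : (c : ℕ) < μ l := by
      by_contra hcon
      have := hout c l (not_lt.mp hcon)
      omega
    rw [twistProd_eq_zero c l (Or.inl h1)]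
    by_cases h2 : (m + s) c l < 0
    · rw [twistProd_eq_zero (m := m + s) c l (Or.inl h2)]
      simp
    -- In this entry the row `κ` takes `m + s` to `m`, so a nonzero weight would force `m c l` to be
    -- nonnegative.
    · by_cases h3 : rowWt t κ (m + s) = 0
      · simp [h3]
      · exfalso
        have h4 := rowWt_nonneg h3 (not_lt.mp h2)
        simp only [Pi.add_apply, s, if_pos hc] at h4
        omega
  by_cases hneg' : 0 ≤ m + s
  swap
  · simp only [Pi.le_def, not_forall, not_le] at hneg'
    obtain ⟨c, l, h1⟩ := hneg'
    have h1 : (m + s) c l < 0 := h1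
    have h0' : 0 ≤ m c l := hneg c l
    have hc : (c : ℕ) < μ l := by
      by_contra hcon
      have := hs l c (not_lt.mp hcon)
      simp only [Pi.add_apply] at h1
      omega
    rw [twistProd_eq_zero (m := m + s) c l (Or.inl h1)]
    -- Conversely, the rows of `A` take `m` to `m + s` in this entry.
    by_cases h3 : listWt t A m = 0
    · simp [h3]
    · exfalso
      have h4 := listWt_nonneg h3 h0'
      simp only [Pi.add_apply, hfA, s, if_pos hc] at h4 h1
      rw [if_neg (by omega)] at h4
      omega
  -- In column `μ l` the twist forces occupation zero of colour `l` at the bottom, and one particle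
  -- is there at the top. `D` records that `κ` delivered it, `E` that `A` did. Colour `l` never
  -- leaves this column to the right, so `D` and `E` enter only through tail sums.
  let D : ZState n (maxPart μ) := fun c l => if μ l = c then unitZ (κ c.castSucc) l else 0
  let E : ZState n (maxPart μ) := fun c l => if μ l = c then 1 - unitZ (κ c.castSucc) l else 0
  have hE : m + (A.map flux).sum = (m + s) + E := by
    funext c l
    simp only [Pi.add_apply, hfA, s, E]
    by_cases hc : (c : ℕ) < μ l
    · rw [if_pos hc, if_neg (by omega), if_neg (by omega)]; ring
    · rw [if_neg hc, hfl c l (not_lt.mp hc)]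
      split_ifs <;> ring
  have hD : m + s + flux κ = m + D := by
    funext c l
    simp only [Pi.add_apply, s, D]
    by_cases hc : (c : ℕ) < μ l
    · rw [if_pos hc, if_neg (by omega)]; ring
    · rw [if_neg hc, hfl c l (not_lt.mp hc)]
      ring
  rw [hE, hD, twistProd_add hv1 hneg hneg' hs, rowWt_add ht κ (m + s) E, listWt_add ht A m D]
  rotate_left
  · intro κ' hκ' c k hk
    have := hA' κ' hκ' _ _ hk
    simp only [Fin.val_succ] at this
    exact if_neg (by omega)
  · intro c k hk
    have := hκ _ _ hk
    simp only [Fin.val_succ] at this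
    exact if_neg (by omega)
  have hr := twist_ratio hq ht μ κ i h0 hκ
  have hsr : (∏ l, ∏ c : Fin (maxPart μ + 1), if (c : ℕ) < μ l then
      twist q t μ l c ^ s c l else 1) = ∏ l, ∏ c : Fin (maxPart μ + 1), if (c : ℕ) < μ l then
          twist q t μ l c ^ (unitZ (κ c.succ) l - unitZ (κ c.castSucc) l) else 1 := by
    refine Finset.prod_congr rfl fun l _ => Finset.prod_congr rfl fun c _ => ?_
    split_ifs with h
    · simp only [s, if_pos h, flux, Pi.sub_apply, neg_sub]
    · rfl
  rw [hsr]
  have hexp : ∑ c, tailPair (κ (Fin.succ c)) (E c) =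
      (∑ c : Fin (maxPart μ + 1),
        ((∑ k', (if μ k' = c then 1 else 0) * ∑ k ∈ Finset.Iio k', unitZ (κ c.succ) k) -
        ∑ k', (if μ k' = c then unitZ (κ c.castSucc) k' else 0) *
          ∑ k ∈ Finset.Iio k', if (c : ℕ) < μ k then 1 else 0)) +
      ∑ c, ∑ k', D c k' *
        ∑ k ∈ Finset.Iio k', (A.map fun κ => unitZ (κ (Fin.succ c)) k).sum := by
    rw [← Finset.sum_add_distrib]
    refine Finset.sum_congr rfl fun c _ => ?_
    rw [tailPair, ← Finset.sum_sub_distrib, ← Finset.sum_add_distrib]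
    refine Finset.sum_congr rfl fun k' _ => ?_
    have h1 : ∑ k ∈ Finset.Iio k', (A.map fun κ => unitZ (κ (Fin.succ c)) k).sum =
        (∑ k ∈ Finset.Iio k', if (c : ℕ) < μ k then 1 else 0) -
          ∑ k ∈ Finset.Iio k', unitZ (κ c.succ) k := by
      rw [← Finset.sum_sub_distrib]
      refine Finset.sum_congr rfl fun k _ => ?_
      have := hA c.succ k
      simp only [Fin.val_succ, Nat.succ_le_iff] at this
      rw [← this]
      ring
    rw [h1]
    simp only [D, E]
    split_ifs <;> ring
  rw [hexp, zpow_add₀ ht]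
  linear_combination (twistProd μ (twist q t μ) m * listWt t A m * rowWt t κ (m + s) *
    t ^ ∑ c, ∑ k', D c k' *
        ∑ k ∈ Finset.Iio k', (A.map fun κ => unitZ (κ (Fin.succ c)) k).sum) * hr

/-! ### Hecke operators acting on the partition functions -/

/-- The total number of edges of a given colour over a vertical line. -/
theorem sum_unitZ_admissible {k : ℕ} {μ : Fin n → ℕ} {σ : Fin k → Fin n}
    (hσ : Function.Bijective σ) {ks : Fin k → RowPath n (maxPart μ)} (h : ks ∈ admissible μ σ)
    (j : Fin (maxPart μ + 2)) (l : Fin n) :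
    ∑ r, unitZ (ks r j) l = if (j : ℕ) ≤ μ l then 1 else 0 := by
  rw [mem_admissible] at h
  -- Each colour enters once at the left boundary because `σ` is bijective, and column `c` absorbs
  -- precisely the colours with part `c`.
  induction j using Fin.induction with
  | zero =>
    have h0 : ∀ r, ks r 0 = some (σ r) := fun r => (h.1 r).1
    simp only [h0, unitZ, Option.some.injEq, Fin.val_zero, Nat.zero_le, if_true]
    obtain ⟨r, rfl⟩ := hσ.2 l
    rw [Finset.sum_eq_single_of_mem r (Finset.mem_univ _)]
    · simp
    · intro b _ hb
      exact if_neg fun h => hb (hσ.1 h)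
  | succ c ih =>
    have h1 := congrFun (congrFun h.2 c) l
    simp only [Finset.sum_apply, flux, Pi.sub_apply, Finset.sum_sub_distrib, castS, compState] at h1
    rw [ih] at h1
    simp only [Fin.val_castSucc, Fin.val_succ] at h1 ⊢
    push_cast at h1
    split_ifs at h1 ⊢ <;> omega

/-! ### The operator `ω` as a rotation of the rows -/

theorem finRotate_symm_zero (n : ℕ) : (finRotate (n + 1)).symm 0 = Fin.last n := by
  rw [Equiv.symm_apply_eq, finRotate_last]

theorem finRotate_castSucc {n : ℕ} (r : Fin n) : finRotate (n + 1) r.castSucc = r.succ := by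
  rw [finRotate_apply, Fin.coeSucc_eq_succ]

theorem finRotate_symm_succ {n : ℕ} (r : Fin n) : (finRotate (n + 1)).symm r.succ = r.castSucc := by
  rw [Equiv.symm_apply_eq, finRotate_castSucc]

theorem pathSum_finRotate {q t : ℂ} (hq : q ≠ 0) (ht : t ≠ 0) {μ : Fin (n + 1) → ℕ}
    {σ : Fin (n + 1) → Fin (n + 1)} (hσ : Function.Bijective σ)
    {ks : Fin (n + 1) → RowPath (n + 1) (maxPart μ)} (h : ks ∈ admissible μ σ) :
    q ^ deg (ks (Fin.last n)) * pathSum t (twist q t μ) (List.ofFn ks) =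
      q ^ μ (σ (Fin.last n)) * t ^ gammaExp μ (σ (Fin.last n)) 0 *
        pathSum t (twist q t μ) (List.ofFn fun r => ks ((finRotate (n + 1)).symm r)) := by
  rw [List.ofFn_succ' (f := ks), List.concat_eq_append,
    List.ofFn_succ (f := fun r => ks ((finRotate (n + 1)).symm r)), finRotate_symm_zero]
  simp only [finRotate_symm_succ]
  refine pathSum_rotate hq ht μ _ _ _ ((mem_admissible.mp h).1 _).1 fun j k => ?_
  rw [← sum_unitZ_admissible hσ h j k, Fin.sum_univ_castSucc, List.map_ofFn, List.sum_ofFn]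
  rfl

/-- The point `(x_2, …, x_n, q x_1)`. -/
def rotatePoint (q : ℂ) (x : Fin (n + 1) → ℂ) (r : Fin (n + 1)) : ℂ :=
  (if r = Fin.last n then q else 1) * x (finRotate (n + 1) r)

/-- Scaling the variable of the top row by `q` produces `q ^ deg` of that row's path. This is the
path-dependent factor in the rotation of a family; what remains depends only on the top colour and
comes out of the sum. -/
theorem eval_rotatePoint_partitionPoly {q t : ℂ} (hq : q ≠ 0) (ht : t ≠ 0) (μ : Fin (n + 1) → ℕ)
    {σ : Fin (n + 1) → Fin (n + 1)} (hσ : Function.Bijective σ) (x : Fin (n + 1) → ℂ) :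
    eval (rotatePoint q x) (partitionPoly t μ (twist q t μ) σ) =
      q ^ μ (σ (Fin.last n)) * t ^ gammaExp μ (σ (Fin.last n)) 0 *
        eval x (partitionPoly t μ (twist q t μ) fun r => σ ((finRotate (n + 1)).symm r)) := by
  simp only [partitionPoly, map_sum, map_mul, map_prod, map_pow, eval_C, eval_X, Finset.mul_sum]
  refine Finset.sum_equiv ((finRotate (n + 1)).arrowCongr (Equiv.refl _)) ?_ ?_
  · intro ks
    rw [mem_admissible, mem_admissible]
    refine and_congr ?_ ?_
    · exact ⟨fun h r => h _, fun h r => by simpa using h (finRotate (n + 1) r)⟩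
    · rw [← (finRotate (n + 1)).symm.sum_comp fun r => flux (ks r)]
      rfl
  · intro ks hks
    have h1 := pathSum_finRotate hq ht hσ hks
    have h2 : ∏ r, rotatePoint q x r ^ deg (ks r) = q ^ deg (ks (Fin.last n)) *
        ∏ r, x r ^ deg (ks ((finRotate (n + 1)).symm r)) := by
      rw [← Equiv.prod_comp (finRotate (n + 1)) fun r => x r ^ deg (ks ((finRotate (n + 1)).symm r))]
      simp only [rotatePoint, mul_pow, Finset.prod_mul_distrib, Equiv.symm_apply_apply]
      congr 1
      rw [Finset.prod_eq_single_of_mem (Fin.last n) (Finset.mem_univ _)]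
      · simp
      · intro r _ hr
        simp [hr]
    rw [h2]
    change _ = _ * (pathSum t (twist q t μ) (List.ofFn fun r => ks ((finRotate (n + 1)).symm r)) *
      ∏ r, x r ^ deg (ks ((finRotate (n + 1)).symm r)))
    linear_combination (∏ r, x r ^ deg (ks ((finRotate (n + 1)).symm r))) * h1

theorem prod_transp_apply (n m : ℕ) (hm : m ≤ n) (P : MvPolynomial (Fin (n + 1)) ℂ) :
    ((List.range m).map (transp (n + 1))).prod P = rename (fun r : Fin (n + 1) =>
      if h : (r : ℕ) < m then ⟨r + 1, by omega⟩ else if (r : ℕ) = m then 0 else r) P := by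
  induction m generalizing P with
  | zero =>
    have : (fun r : Fin (n + 1) => if h : (r : ℕ) < 0 then (⟨r + 1, by omega⟩ : Fin (n + 1)) else
        if (r : ℕ) = 0 then 0 else r) = id := by
      funext r
      simp only [not_lt_zero, dif_neg, not_false_eq_true, id]
      split_ifs with h
      · exact (Fin.ext h).symm
      · rfl
    rw [this]
    simp
  | succ m ih =>
    rw [List.range_succ, List.map_append, List.prod_append, List.map_singleton,
      List.prod_singleton, Module.End.mul_apply, ih (by omega), transp, dif_pos (by omega),
      swapVars, AlgHom.toLinearMap_apply, rename_rename]
    congr 2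
    funext r
    rw [Function.comp_apply]
    by_cases h1 : r = ⟨m, by omega⟩
    · subst h1
      rw [Equiv.swap_apply_left]
      simp
    by_cases h2 : r = ⟨m + 1, by omega⟩
    · subst h2
      rw [Equiv.swap_apply_right]
      simp
    rw [Equiv.swap_apply_of_ne_of_ne h1 h2]
    simp only [Fin.ext_iff] at h1 h2
    by_cases h3 : (r : ℕ) < m
    · rw [dif_pos h3, dif_pos (by omega)]
    · rw [dif_neg h3, dif_neg (by omega), if_neg h1, if_neg h2]

theorem eval_omega (q : ℂ) (x : Fin (n + 1) → ℂ) (P : MvPolynomial (Fin (n + 1)) ℂ) :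
    eval x (omega (n + 1) q P) = eval (rotatePoint q x) P := by
  have h : ∀ r : Fin (n + 1), (if h : (r : ℕ) < n then (⟨r + 1, by omega⟩ : Fin (n + 1)) else
      if (r : ℕ) = n then 0 else r) = finRotate (n + 1) r := by
    intro r
    induction r using Fin.lastCases with
    | last => simp
    | cast r => rw [finRotate_castSucc]; simp [Fin.ext_iff]
  rw [omega, Module.End.mul_apply, Nat.add_sub_cancel, prod_transp_apply n n le_rfl, shiftOp]
  simp only [h, AlgHom.toLinearMap_apply]
  rw [aeval_rename]
  induction P using MvPolynomial.induction_on with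
  | C a => simp
  | add p r hp hr => simp only [map_add, hp, hr]
  | mul_X p r hp =>
    simp only [map_mul, hp, aeval_X, eval_X, Function.comp_apply]
    congr 1
    induction r using Fin.lastCases with
    | last => simp [rotatePoint]
    | cast r =>
      rw [finRotate_castSucc, rotatePoint, if_neg (Fin.castSucc_lt_last r).ne, finRotate_castSucc]
      simp

theorem omega_partitionPoly {q t : ℂ} (hq : q ≠ 0) (ht : t ≠ 0) (μ : Fin (n + 1) → ℕ)
    {σ : Fin (n + 1) → Fin (n + 1)} (hσ : Function.Bijective σ) :
    omega (n + 1) q (partitionPoly t μ (twist q t μ) σ) =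
      (q ^ μ (σ (Fin.last n)) * t ^ gammaExp μ (σ (Fin.last n)) 0) •
        partitionPoly t μ (twist q t μ) fun r => σ ((finRotate (n + 1)).symm r) := by
  refine MvPolynomial.funext fun x => ?_
  rw [eval_omega, eval_rotatePoint_partitionPoly hq ht μ hσ, smul_eval]

/-! ### Hecke generators as exchanges of adjacent colours -/

/-- The outer factors `U` and `V` are chosen before `g`, so that the three operator products in the
exchange relation share them. -/
theorem prod_ofFn_adjacent {M : Type*} [Monoid M] (f : Fin n → M) (k : ℕ) (hk : k + 1 < n) :
    ∃ U V : M, ∀ g : Fin n → M, (∀ r : Fin n, (r : ℕ) ≠ k → (r : ℕ) ≠ k + 1 → g r = f r) →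
      (List.ofFn g).prod = U * (g ⟨k, by omega⟩ * g ⟨k + 1, hk⟩) * V := by
  refine ⟨((List.ofFn f).take k).prod, ((List.ofFn f).drop (k + 2)).prod, fun g hg => ?_⟩
  have h1 : (List.ofFn g).take k = (List.ofFn f).take k := by
    refine List.ext_getElem (by simp) fun r h1 h2 => ?_
    simp only [List.length_take, List.length_ofFn] at h1
    simp only [List.getElem_take, List.getElem_ofFn]
    exact hg _ (by simp; omega) (by simp; omega)
  have h2 : (List.ofFn g).drop (k + 2) = (List.ofFn f).drop (k + 2) := by
    refine List.ext_getElem (by simp) fun r h1 h2 => ?_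
    simp only [List.getElem_drop, List.getElem_ofFn]
    exact hg _ (by simp; omega) (by simp; omega)
  rw [← h1, ← h2, mul_assoc, ← List.take_append_drop k (List.ofFn g)]
  rw [List.prod_append, List.take_append_drop]
  congr 1
  rw [List.drop_eq_getElem_cons (by simp; omega), List.drop_eq_getElem_cons (by simp; omega)]
  simp [mul_assoc]

theorem formTerm_add (μ : Fin n → ℕ) (v : Fin n → Fin (maxPart μ + 1) → ℂ)
    (A B : Module.End ℂ (State n (maxPart μ) →₀ ℂ)) :
    formTerm μ v (A + B) = formTerm μ v A + formTerm μ v B := by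
  funext m
  simp [formTerm, mul_add]

theorem formTerm_smul (μ : Fin n → ℕ) (v : Fin n → Fin (maxPart μ + 1) → ℂ) (a : ℂ)
    (A : Module.End ℂ (State n (maxPart μ) →₀ ℂ)) :
    formTerm μ v (a • A) = a • formTerm μ v A := by
  funext m
  simp [formTerm]
  ring

theorem mul_ratioOp_apply (α β : ℂ) (k : ℕ) (hk : k + 1 < n) (P : MvPolynomial (Fin n) ℂ) :
    (X ⟨k, by omega⟩ - X ⟨k + 1, hk⟩) * ratioOp n α β k P =
      (C α * X ⟨k, by omega⟩ - C β * X ⟨k + 1, hk⟩) *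
        (P - swapVars ⟨k, by omega⟩ ⟨k + 1, hk⟩ P) := by
  rw [ratioOp, dif_pos hk, Module.End.mul_apply, LinearMap.mulLeft_apply, mul_left_comm]
  congr 1
  exact mul_divDiffFun _ _ P

/-- The exchange relation for the partition functions. -/
theorem partitionPoly_exchange {t : ℂ} (ht : t ≠ 0) (μ : Fin n → ℕ)
    (v : Fin n → Fin (maxPart μ + 1) → ℂ) (hv : ∀ i j, ‖v i j‖ * max 1 ‖t‖ ^ n < 1)
    (σ : Fin n → Fin n) (k : ℕ) (hk : k + 1 < n) (x : Fin n → ℂ) :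
    (x ⟨k, by omega⟩ - t * x ⟨k + 1, hk⟩) *
        eval x (swapVars ⟨k, by omega⟩ ⟨k + 1, hk⟩ (partitionPoly t μ v σ)) =
      rDiag t (x ⟨k, by omega⟩) (x ⟨k + 1, hk⟩) (σ ⟨k, by omega⟩) (σ ⟨k + 1, hk⟩) *
          eval x (partitionPoly t μ v σ) +
        rSwap t (x ⟨k, by omega⟩) (x ⟨k + 1, hk⟩) (σ ⟨k, by omega⟩) (σ ⟨k + 1, hk⟩) *
          eval x (partitionPoly t μ v fun r =>
            σ (Equiv.swap ⟨k, by omega⟩ ⟨k + 1, hk⟩ r)) := by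
  set a : Fin n := ⟨k, by omega⟩ with ha
  set b : Fin n := ⟨k + 1, hk⟩ with hb
  have hab : a ≠ b := by simp [ha, hb]
  have hoff : ∀ r : Fin n, (r : ℕ) ≠ k → (r : ℕ) ≠ k + 1 → Equiv.swap a b r = r := by
    intro r h1 h2
    exact Equiv.swap_apply_of_ne_of_ne (fun h => h1 (by simp [h, ha])) fun h => h2 (by simp [h, hb])
  rw [swapVars, AlgHom.toLinearMap_apply, eval_rename, eval_partitionPoly ht μ v hv,
    eval_partitionPoly ht μ v hv, eval_partitionPoly ht μ v hv]
  have s1 := summable_formTerm ht μ v hv σ x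
  have s2 := summable_formTerm ht μ v hv (fun r => σ (Equiv.swap a b r)) x
  obtain ⟨U, V, hUV⟩ := prod_ofFn_adjacent (fun r => rowOp (maxPart μ) t (σ r) (x r)) k hk
  have e1 := hUV (fun r => rowOp (maxPart μ) t (σ r) ((x ∘ Equiv.swap a b) r)) fun r h1 h2 => by
    simp only [Function.comp_apply, hoff r h1 h2]
  have e2 := hUV (fun r => rowOp (maxPart μ) t (σ r) (x r)) fun r h1 h2 => rfl
  have e3 := hUV (fun r => rowOp (maxPart μ) t (σ (Equiv.swap a b r)) (x r)) fun r h1 h2 => by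
    simp only [hoff r h1 h2]
  simp only [← ha, ← hb, Function.comp_apply, Equiv.swap_apply_left, Equiv.swap_apply_right]
    at e1 e2 e3
  have hex := rowOp_exchange (N := maxPart μ) ht (x a) (x b) (σ a) (σ b)
  have hop : (x a - t * x b) •
      (List.ofFn fun r => rowOp (maxPart μ) t (σ r) (x (Equiv.swap a b r))).prod =
      rDiag t (x a) (x b) (σ a) (σ b) •
        (List.ofFn fun r => rowOp (maxPart μ) t (σ r) (x r)).prod +
      rSwap t (x a) (x b) (σ a) (σ b) •
        (List.ofFn fun r => rowOp (maxPart μ) t (σ (Equiv.swap a b r)) (x r)).prod := by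
    rw [e1, e2, e3, ← smul_mul_assoc, ← mul_smul_comm, hex]
    simp only [mul_add, add_mul, mul_smul_comm, smul_mul_assoc]
  have := congrArg (linForm μ v) hop
  simp only [linForm, formTerm_add, formTerm_smul] at this
  simp only [Pi.add_apply, Pi.smul_apply, smul_eq_mul] at this
  rw [Summable.tsum_add (s1.mul_left _) (s2.mul_left _), tsum_mul_left, tsum_mul_left,
    tsum_mul_left] at this
  exact this

/-- The Hecke operators exchange adjacent colours. -/
theorem hecke_partitionPoly {t : ℂ} (ht : t ≠ 0) (μ : Fin n → ℕ)
    (v : Fin n → Fin (maxPart μ + 1) → ℂ) (hv : ∀ i j, ‖v i j‖ * max 1 ‖t‖ ^ n < 1)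
    (σ : Fin n → Fin n) (k : ℕ) (hk : k + 1 < n) (hσ : σ ⟨k, by omega⟩ < σ ⟨k + 1, hk⟩) :
    heckeInv n t k (partitionPoly t μ v σ) = t⁻¹ • partitionPoly t μ v (fun r =>
        σ (Equiv.swap ⟨k, by omega⟩ ⟨k + 1, hk⟩ r)) ∧
      hecke n t k (partitionPoly t μ v fun r =>
        σ (Equiv.swap ⟨k, by omega⟩ ⟨k + 1, hk⟩ r)) = t • partitionPoly t μ v σ := by
  have hab : (⟨k, by omega⟩ : Fin n) ≠ ⟨k + 1, hk⟩ := by simp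
  have hσ' : ((σ ⟨k, by omega⟩ : Fin n) : ℕ) < σ ⟨k + 1, hk⟩ := hσ
  constructor
  · rw [heckeInv, LinearMap.smul_apply, LinearMap.sub_apply, Module.End.one_apply]
    congr 1
    apply mul_left_cancel₀ (X_sub_X_ne_zero hab)
    rw [mul_sub, mul_ratioOp_apply]
    refine MvPolynomial.funext fun x => ?_
    -- For increasing adjacent colours the `R`-matrix entries are `(1 - t) x_{k+1}` and `x_k -
    -- x_{k+1}`, in one-based notation for the two variables involved. Clearing denominators in
    -- `T⁻¹` gives the same relation.
    have h := partitionPoly_exchange ht μ v hv σ k hk x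
    rw [rDiag, rSwap, if_neg hσ'.ne, if_pos hσ', if_neg hσ'.ne, if_pos hσ'] at h
    simp only [map_mul, map_sub, eval_X, eval_C]
    linear_combination h
  · rw [hecke, LinearMap.sub_apply, LinearMap.smul_apply, Module.End.one_apply]
    apply mul_left_cancel₀ (X_sub_X_ne_zero hab)
    rw [mul_sub, mul_ratioOp_apply]
    refine MvPolynomial.funext fun x => ?_
    have h := partitionPoly_exchange ht μ v hv
      (fun r => σ (Equiv.swap ⟨k, by omega⟩ ⟨k + 1, hk⟩ r)) k hk x
    simp only [Equiv.swap_apply_left, Equiv.swap_apply_right, Equiv.swap_apply_self] at h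
    rw [rDiag, rSwap, if_neg hσ'.ne', if_neg hσ'.not_gt, if_neg hσ'.ne',
      if_neg hσ'.not_gt] at h
    simp only [map_mul, map_sub, eval_X, eval_C, smul_eval]
    linear_combination h

/-! ### The eigenvalue equations -/

/-- The colour `i` in position `p`, and the other colours in increasing order. -/
def insertColour (i p r : Fin n) : Fin n :=
  ⟨if (r : ℕ) = p then i else if (r : ℕ) < p then (if (r : ℕ) < i then r else r + 1) else
    if (r : ℕ) ≤ i then r - 1 else r, by split_ifs <;> omega⟩

theorem insertColour_bijective (i p : Fin n) : Function.Bijective (insertColour i p) := by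
  refine Finite.injective_iff_bijective.mp fun r s h => ?_
  simp only [insertColour, Fin.mk.injEq] at h
  ext
  split_ifs at h <;> omega

theorem insertColour_self (i : Fin n) : insertColour i i = id := by
  funext r
  ext
  simp only [insertColour, id]
  split_ifs <;> omega

theorem insertColour_swap (i : Fin n) (p : ℕ) (hp : p + 1 < n) (r : Fin n) :
    insertColour i ⟨p, by omega⟩ (Equiv.swap ⟨p, by omega⟩ ⟨p + 1, hp⟩ r) =
      insertColour i ⟨p + 1, hp⟩ r := by
  by_cases h1 : r = ⟨p, by omega⟩
  · subst h1
    rw [Equiv.swap_apply_left]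
    ext
    simp only [insertColour]
    split_ifs <;> omega
  by_cases h2 : r = ⟨p + 1, hp⟩
  · subst h2
    rw [Equiv.swap_apply_right]
    ext
    simp only [insertColour]
    split_ifs <;> omega
  rw [Equiv.swap_apply_of_ne_of_ne h1 h2]
  simp only [Fin.ext_iff] at h1 h2
  ext
  simp only [insertColour]
  split_ifs <;> omega

theorem insertColour_swap' (i : Fin n) (p : ℕ) (hp : p + 1 < n) (r : Fin n) :
    insertColour i ⟨p + 1, hp⟩ (Equiv.swap ⟨p, by omega⟩ ⟨p + 1, hp⟩ r) =
      insertColour i ⟨p, by omega⟩ r := by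
  rw [← insertColour_swap i p hp, Equiv.swap_apply_self]

theorem insertColour_last_finRotate (i r : Fin (n + 1)) :
    insertColour i (Fin.last n) ((finRotate (n + 1)).symm r) = insertColour i 0 r := by
  induction r using Fin.cases with
  | zero => rw [finRotate_symm_zero]; simp [insertColour]
  | succ r =>
    rw [finRotate_symm_succ]
    ext
    simp only [insertColour, Fin.val_castSucc, Fin.val_succ, Fin.val_last, Fin.val_zero]
    have hr := r.isLt
    rw [if_neg hr.ne, if_pos hr, if_neg (Nat.succ_ne_zero _), if_neg (Nat.not_lt_zero _)]
    split_ifs <;> omega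

/-- Moving to the right from its own row, colour `i` passes only larger colours. Every step is the
increasing case and costs `t⁻¹`. -/
theorem prod_heckeInv_partitionPoly {t : ℂ} (ht : t ≠ 0) (μ : Fin n → ℕ)
    (v : Fin n → Fin (maxPart μ + 1) → ℂ) (hv : ∀ i j, ‖v i j‖ * max 1 ‖t‖ ^ n < 1)
    (i : Fin n) (m : ℕ) (hm : i + m < n) :
    ((List.range' (i : ℕ) m).reverse.map (heckeInv n t)).prod (partitionPoly t μ v id) =
      (t⁻¹) ^ m • partitionPoly t μ v (insertColour i ⟨i + m, hm⟩) := by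
  induction m with
  | zero =>
    have : (⟨(i : ℕ) + 0, hm⟩ : Fin n) = i := rfl
    rw [this, insertColour_self]
    simp
  | succ m ih =>
    have h := (hecke_partitionPoly ht μ v hv (insertColour i ⟨i + m, by omega⟩) (i + m) hm (by
      rw [Fin.lt_def]
      simp only [insertColour]
      split_ifs <;> omega)).1
    simp only [insertColour_swap] at h
    rw [List.range'_concat, List.reverse_append, List.map_append, List.prod_append,
      Module.End.mul_apply, ih (by omega), map_smul]
    simp only [one_mul, List.reverse_singleton, List.map_singleton, List.prod_singleton]
    rw [h, smul_smul, pow_succ]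
    rfl

/-- From the first row up to row `i`, colour `i` passes only smaller colours, so each step costs
`t`. -/
theorem prod_hecke_partitionPoly {t : ℂ} (ht : t ≠ 0) (μ : Fin (n + 1) → ℕ)
    (v : Fin (n + 1) → Fin (maxPart μ + 1) → ℂ)
    (hv : ∀ i j, ‖v i j‖ * max 1 ‖t‖ ^ (n + 1) < 1)
    (i : Fin (n + 1)) (m : ℕ) (hm : m ≤ i) :
    ((List.range m).reverse.map (hecke (n + 1) t)).prod
        (partitionPoly t μ v (insertColour i 0)) =
      t ^ m • partitionPoly t μ v (insertColour i ⟨m, by omega⟩) := by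
  induction m with
  | zero => simp
  | succ m ih =>
    have h := (hecke_partitionPoly ht μ v hv (insertColour i ⟨m + 1, by omega⟩) m (by omega) (by
      rw [Fin.lt_def]
      simp only [insertColour]
      split_ifs <;> omega)).2
    simp only [insertColour_swap'] at h
    rw [List.range_succ, List.reverse_append, List.map_append, List.prod_append,
      Module.End.mul_apply, ih (by omega), map_smul]
    simp only [List.reverse_singleton, List.map_singleton, List.prod_singleton]
    rw [h, smul_smul, pow_succ]

theorem eta_eq (μ : Fin (n + 1) → ℕ) (i : Fin (n + 1)) :
    eta μ i = gammaExp μ i 0 - ((n : ℤ) - (i : ℕ)) := by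
  have h : ((Finset.univ.filter fun j => i < j ∧ μ i ≤ μ j).card : ℤ) +
      (Finset.univ.filter fun k => i < k ∧ 0 ≤ μ k ∧ μ k < μ i).card = (n : ℤ) - (i : ℕ) := by
    have h1 : (Finset.univ.filter fun j => i < j ∧ μ i ≤ μ j).card +
        (Finset.univ.filter fun k => i < k ∧ 0 ≤ μ k ∧ μ k < μ i).card =
        (Finset.Ioi i).card := by
      rw [← Finset.card_union_of_disjoint]
      · congr 1
        ext k
        simp only [Finset.mem_filter, Finset.mem_univ, true_and, Finset.mem_union, Finset.mem_Ioi]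
        omega
      · rw [Finset.disjoint_left]
        intro k
        simp only [Finset.mem_filter, Finset.mem_univ, true_and]
        omega
    rw [Fin.card_Ioi] at h1
    have := i.isLt
    omega
  unfold eta gammaExp
  omega

/-- Colour `i` makes one full turn around the rows. With `n + 1` rows and zero-based `i`, the
scalars are `t ^ -(n - i)` from the inverse generators, `q ^ μ i * t ^ γ_{i,0}` from `ω`, and `t ^
i` from the way back; `eta_eq` identifies their product with the eigenvalue. -/
theorem cherednik_partitionPoly {q t : ℂ} (hq : q ≠ 0) (ht : t ≠ 0) (μ : Fin n → ℕ)
    (hv : ∀ i j, ‖twist q t μ i j‖ * max 1 ‖t‖ ^ n < 1) (i : Fin n) :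
    cherednik q t i (partitionPoly t μ (twist q t μ) id) =
      eig q t μ i • partitionPoly t μ (twist q t μ) id := by
  cases n with
  | zero => exact i.elim0
  | succ n =>
    have hi : (i : ℕ) + (n + 1 - 1 - i) < n + 1 := by omega
    have hlast : (⟨(i : ℕ) + (n + 1 - 1 - i), hi⟩ : Fin (n + 1)) = Fin.last n := by
      ext
      simp only [Fin.val_last]
      omega
    have hil : insertColour i (Fin.last n) (Fin.last n) = i := by
      ext
      simp [insertColour]
    rw [cherednik, Module.End.mul_apply, Module.End.mul_apply,
      prod_heckeInv_partitionPoly ht μ _ hv i _ hi, hlast, map_smul,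
      omega_partitionPoly hq ht μ (insertColour_bijective _ _), hil]
    simp only [insertColour_last_finRotate]
    rw [map_smul, map_smul]
    have h := prod_hecke_partitionPoly ht μ _ hv i i le_rfl
    rw [show (⟨(i : ℕ), i.isLt⟩ : Fin (n + 1)) = i from rfl, insertColour_self] at h
    have h' : ((List.range (i : ℕ)).reverse.map (hecke (n + 1) t)).prod
        (partitionPoly t μ (twist q t μ) fun r => insertColour i 0 r) = _ := h
    rw [h', smul_smul, smul_smul]
    congr 1
    rw [eig, eta_eq, zpow_add₀ ht, zpow_sub₀ ht, zpow_natCast]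
    have h2 : (n : ℤ) - (i : ℕ) = ((n + 1 - 1 - i : ℕ) : ℤ) := by omega
    rw [h2, zpow_natCast, inv_pow]
    field_simp

/-! ### The leading coefficient -/

/-- The path of colour `r` that turns upwards in column `μ r`. -/
def straightPath {N : ℕ} (μ : Fin n → ℕ) (r : Fin n) : RowPath n N :=
  fun j => if (j : ℕ) ≤ μ r then some r else none

theorem colWt_eq_zero {t : ℂ} {I : Fin n → ℤ} {i k : Fin n} (h : k < i) :
    colWt t I (some i) (some k) = 0 := by
  have h1 : i ≠ k := h.ne'
  have h2 : ¬ i < k := h.not_gt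
  simp [colWt, h1, h2]

theorem listWt_eq_zero {N : ℕ} {t : ℂ} {ks : List (RowPath n N)} {κ : RowPath n N} (hκ : κ ∈ ks)
    {c : Fin (N + 1)} {i k : Fin n} (h1 : κ c.castSucc = some i) (h2 : κ c.succ = some k)
    (h : k < i) (I : ZState n N) : listWt t ks I = 0 := by
  induction ks generalizing I with
  | nil => simp at hκ
  | cons κ' ks ih =>
    rw [listWt]
    rcases List.mem_cons.mp hκ with rfl | hκ
    · rw [rowWt, Finset.prod_eq_zero (Finset.mem_univ c), zero_mul]
      rw [h1, h2, colWt_eq_zero h]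
    · rw [ih hκ, mul_zero]

theorem card_filter_val_lt {N M : ℕ} (h : M ≤ N) :
    (Finset.univ.filter fun c : Fin N => (c : ℕ) < M).card = M := by
  rw [Finset.card_filter, Fin.sum_univ_eq_sum_range (fun c => if c < M then 1 else 0) N,
    ← Finset.card_filter]
  have : (Finset.range N).filter (fun c => c < M) = Finset.range M := by
    ext c; simp only [Finset.mem_filter, Finset.mem_range]; omega
  rw [this, Finset.card_range]

theorem deg_straightPath (μ : Fin n → ℕ) (r : Fin n) :
    deg (straightPath μ r : RowPath n (maxPart μ)) = μ r := by
  rw [deg, ← card_filter_val_lt ((le_maxPart μ r).trans (Nat.le_succ _))]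
  congr 1
  ext c
  simp only [Finset.mem_filter, Finset.mem_univ, true_and, straightPath, Fin.val_succ,
    Nat.succ_le_iff]
  split_ifs with h <;> simp [h]

theorem flux_straightPath (μ : Fin n → ℕ) (r k : Fin n) {N : ℕ} (c : Fin (N + 1)) :
    flux (straightPath μ r : RowPath n N) c k = if r = k ∧ μ r = c then 1 else 0 := by
  simp only [flux, straightPath, Pi.sub_apply, unitZ, Fin.val_castSucc, Fin.val_succ]
  by_cases hr : r = k
  · subst hr
    by_cases h1 : (c : ℕ) ≤ μ r <;> by_cases h2 : (c : ℕ) + 1 ≤ μ r <;> simp [h1, h2] <;> omega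
  · by_cases h1 : (c : ℕ) ≤ μ r <;> by_cases h2 : (c : ℕ) + 1 ≤ μ r <;> simp [h1, h2, hr]

theorem straightPath_mem_admissible (μ : Fin n → ℕ) :
    (fun r => straightPath μ r) ∈ admissible μ (id : Fin n → Fin n) := by
  rw [mem_admissible]
  constructor
  · intro r
    refine ⟨by simp [straightPath], ?_⟩
    have := le_maxPart μ r
    simp only [straightPath, Fin.val_last]
    rw [if_neg (by omega)]
  · funext c k
    simp only [Finset.sum_apply, flux_straightPath, castS, compState]
    rw [Finset.sum_eq_single_of_mem k (Finset.mem_univ _)]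
    · simp
    · intro b _ hb
      simp [hb]

/-- The only family of paths contributing to the coefficient of `x ^ μ`. -/
theorem eq_straightPath {μ : Fin n → ℕ} {ks : Fin n → RowPath n (maxPart μ)}
    (hks : ks ∈ admissible μ (id : Fin n → Fin n)) (hdeg : ∀ r, deg (ks r) = μ r)
    (hmono : ∀ (r : Fin n) (c : Fin (maxPart μ + 1)) (i k : Fin n), ks r c.castSucc = some i →
      ks r c.succ = some k → i ≤ k) :
    ks = fun r => straightPath μ r := by
  have key : ∀ j : ℕ, ∀ (j' : Fin (maxPart μ + 2)), (j' : ℕ) ≤ j → ∀ r,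
      ks r j' = if (j' : ℕ) ≤ μ r then some r else none := by
    intro j
    induction j with
    | zero =>
      intro j' hj' r
      have : j' = 0 := Fin.ext (by simpa using hj')
      subst this
      simpa using ((mem_admissible.mp hks).1 r).1
    | succ j ih =>
      intro j' hj'
      rcases Nat.lt_or_ge (j' : ℕ) (j + 1) with hlt | hge
      · exact ih j' (by omega)
      obtain ⟨c, rfl⟩ : ∃ c : Fin (maxPart μ + 1), j' = c.succ :=
        ⟨j'.pred (fun h => by rw [h] at hge; simp at hge), by simp⟩
      have hc : (c : ℕ) = j := by
        simp only [Fin.val_succ] at hj' hge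
        omega
      have hnone : ∀ r, μ r < (c : ℕ) + 1 → ks r c.succ = none := by
        intro r hr
        by_contra hcon
        -- Row `r` has already used its whole degree in the columns before `μ r`; one further
        -- labelled edge would exceed it.
        have hss : Finset.univ.filter (fun c' : Fin (maxPart μ + 1) => (c' : ℕ) < μ r) ⊂
            Finset.univ.filter fun c' : Fin (maxPart μ + 1) => (ks r c'.succ).isSome := by
          rw [Finset.ssubset_iff]
          refine ⟨c, by simp; omega, ?_⟩
          rw [Finset.insert_subset_iff]
          constructor
          · simpa [Option.isSome_iff_ne_none] using hcon
          · intro c' hc'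
            have hc' : (c' : ℕ) < μ r := by simpa using hc'
            have := ih c'.succ (by simp only [Fin.val_succ]; omega) r
            simp only [Fin.val_succ] at this
            rw [if_pos (by omega)] at this
            simp [this]
        have := Finset.card_lt_card hss
        rw [card_filter_val_lt ((le_maxPart μ r).trans (Nat.le_succ _))] at this
        have h' := hdeg r
        unfold deg at h'
        omega
      -- Exactly one row carries colour `k` across this line. Its left label is its own index, which
      -- is at most `k` by monotonicity; a smaller row is already occupied by its own colour, by
      -- induction on `k`.
      have hsome : ∀ k, (c : ℕ) + 1 ≤ μ k → ks k c.succ = some k := by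
        intro k
        induction k using WellFoundedLT.induction with
        | ind k ihk =>
          intro hk
          have hsum := sum_unitZ_admissible Function.bijective_id hks c.succ k
          rw [if_pos (by simpa using hk)] at hsum
          obtain ⟨r, -, hr⟩ := Finset.exists_ne_zero_of_sum_ne_zero
            (show ∑ r, unitZ (ks r c.succ) k ≠ 0 by omega)
          have hr : ks r c.succ = some k := by
            by_contra hcon
            exact hr (if_neg hcon)
          have hμ : (c : ℕ) + 1 ≤ μ r := by
            by_contra hcon
            rw [hnone r (by omega)] at hr
            simp at hr
          have hleft := ih c.castSucc (by simp only [Fin.val_castSucc]; omega) r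
          rw [if_pos (by simp only [Fin.val_castSucc]; omega)] at hleft
          rcases (hmono r c r k hleft hr).lt_or_eq with hlt | heq
          · have := ihk r hlt hμ
            rw [hr] at this
            exact absurd (Option.some.inj this) hlt.ne'
          · rwa [heq] at hr
      intro r
      split_ifs with h
      · exact hsome r (by simpa using h)
      · exact hnone r (by simpa using h)
  funext r j
  exact key j j le_rfl r

theorem rowWt_straightPath {N : ℕ} (t : ℂ) (μ : Fin n → ℕ) (r : Fin n) (I : ZState n N) :
    rowWt t (straightPath μ r) I =
      ∏ c : Fin (N + 1), if (c : ℕ) < μ r then t ^ ∑ k ∈ Finset.Ioi r, I c k else 1 := by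
  refine Finset.prod_congr rfl fun c _ => ?_
  simp only [straightPath, Fin.val_castSucc, Fin.val_succ]
  by_cases h : (c : ℕ) < μ r
  · rw [if_pos h.le, if_pos (Nat.succ_le_of_lt h), if_pos h]
    simp [colWt]
  · rw [if_neg (fun h' => h (Nat.lt_of_succ_le h')), if_neg h]
    rfl

/-- From bottom to top the colours increase. A row of colour `r` alters only the occupation of `r`,
which the tail sums of the rows above it do not contain. Hence all weights can be evaluated at the
bottom state. -/
theorem listWt_straightPath {N : ℕ} (t : ℂ) (μ : Fin n → ℕ) (rs : List (Fin n))
    (hrs : rs.Pairwise (· < ·)) (I : ZState n N) :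
    listWt t (rs.map (straightPath μ)) I = (rs.map fun r =>
      ∏ c : Fin (N + 1), if (c : ℕ) < μ r then t ^ ∑ k ∈ Finset.Ioi r, I c k else 1).prod := by
  induction rs generalizing I with
  | nil => simp [listWt]
  | cons r rs ih =>
    rw [List.pairwise_cons] at hrs
    rw [List.map_cons, listWt, ih hrs.2, rowWt_straightPath, List.map_cons, List.prod_cons]
    congr 2
    refine List.map_congr_left fun r' hr' => Finset.prod_congr rfl fun c _ => ?_
    have : ∑ k ∈ Finset.Ioi r', (I + flux (straightPath μ r) : ZState n N) c k =
        ∑ k ∈ Finset.Ioi r', I c k := by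
      refine Finset.sum_congr rfl fun k hk => ?_
      rw [Pi.add_apply, Pi.add_apply, flux_straightPath, if_neg, add_zero]
      rintro ⟨rfl, -⟩
      exact absurd (hrs.1 r' hr') (Finset.mem_Ioi.mp hk).not_gt
    rw [this]

theorem listWt_ofFn_straightPath {N : ℕ} (t : ℂ) (μ : Fin n → ℕ) (m : State n N) :
    listWt t (List.ofFn fun r => straightPath μ r) (castS m) =
      ∏ i, ∏ j : Fin (N + 1),
        (t ^ (Finset.univ.filter fun r => r < i ∧ (j : ℕ) < μ r).card) ^ m j i := by
  rw [List.ofFn_eq_map]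
  rw [listWt_straightPath t μ _ (List.pairwise_lt_finRange n), ← List.ofFn_eq_map, List.prod_ofFn]
  have h1 : ∀ r (c : Fin (N + 1)), (if (c : ℕ) < μ r then
      t ^ ∑ k ∈ Finset.Ioi r, castS m c k else 1) =
      ∏ k, if r < k ∧ (c : ℕ) < μ r then t ^ m c k else 1 := by
    intro r c
    split_ifs with h
    · simp only [h, and_true]
      rw [← Finset.prod_filter, Finset.prod_pow_eq_pow_sum, ← zpow_natCast]
      push_cast
      congr 2
      ext; simp
    · simp [h]
  simp only [h1]
  rw [Finset.prod_congr rfl fun r _ => Finset.prod_comm, Finset.prod_comm]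
  refine Finset.prod_congr rfl fun i _ => ?_
  rw [Finset.prod_comm]
  refine Finset.prod_congr rfl fun j _ => ?_
  rw [← Finset.prod_filter, Finset.prod_const, pow_right_comm]

/-- Once the subtracted count in `gammaExp` is moved to the other side, both sides are sums over
colours `k` that agree term by term. -/
theorem alphaExp_eq (μ : Fin n → ℕ) (i : Fin n) {j : ℕ} (hj : j < μ i) :
    (alphaExp μ i j : ℤ) =
      gammaExp μ i j + (Finset.univ.filter fun r => r < i ∧ j < μ r).card := by
  have h : (Finset.univ.filter fun k => k < i ∧ μ k = μ i).card
      + (Finset.univ.filter fun k => k ≠ i ∧ j < μ k ∧ μ k < μ i).card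
      + (Finset.univ.filter fun k => i < k ∧ j = μ k).card
      + (Finset.univ.filter fun k => k < i ∧ μ i < μ k).card =
      (Finset.univ.filter fun k => i < k ∧ j ≤ μ k ∧ μ k < μ i).card +
        (Finset.univ.filter fun r => r < i ∧ j < μ r).card := by
    simp only [Finset.card_filter, ← Finset.sum_add_distrib]
    refine Finset.sum_congr rfl fun k _ => ?_
    rcases lt_trichotomy k i with hk | hk | hk
    · simp only [hk, hk.not_gt, hk.ne, true_and, false_and, if_false, ne_eq, not_false_eq_true]
      split_ifs <;> omega
    · simp [hk]
    · simp only [hk, hk.not_gt, hk.ne', true_and, false_and, if_false, ne_eq, not_false_eq_true]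
      split_ifs <;> omega
  unfold alphaExp gammaExp
  omega

/-! ### The geometric series for `Ω_μ` -/

theorem norm_twist_mul_lt_one {q t : ℂ} (μ : Fin n → ℕ)
    (hv : ∀ i j, ‖twist q t μ i j‖ * max 1 ‖t‖ ^ n < 1) (i : Fin n) (j : Fin (maxPart μ + 1))
    {k : ℕ} (hk : k ≤ n) : ‖twist q t μ i j * t ^ k‖ < 1 := by
  refine lt_of_le_of_lt ?_ (hv i j)
  rw [norm_mul, norm_pow]
  refine mul_le_mul_of_nonneg_left ?_ (norm_nonneg _)
  exact (pow_le_pow_left₀ (norm_nonneg _) (le_max_right _ _) _).trans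
    (pow_le_pow_right₀ (le_max_left _ _) hk)

theorem twist_mul_pow {q t : ℂ} (ht : t ≠ 0) (μ : Fin n → ℕ) (i : Fin n)
    (j : Fin (maxPart μ + 1)) :
    1 - twist q t μ i j * t ^ (Finset.univ.filter fun r => r < i ∧ (j : ℕ) < μ r).card =
      if (j : ℕ) < μ i then 1 - q ^ (μ i - j) * t ^ alphaExp μ i j else 1 := by
  unfold twist
  split_ifs with h
  · rw [mul_assoc, ← zpow_natCast t, ← zpow_natCast t, ← zpow_add₀ ht, alphaExp_eq μ i h]
  · simp

theorem prod_twist_eq_Omega {q t : ℂ} (ht : t ≠ 0) (μ : Fin n → ℕ) :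
    ∏ i, ∏ j : Fin (maxPart μ + 1),
      (1 - twist q t μ i j * t ^ (Finset.univ.filter fun r => r < i ∧ (j : ℕ) < μ r).card) =
      Omega q t μ := by
  refine Finset.prod_congr rfl fun i _ => ?_
  simp only [twist_mul_pow ht]
  rw [Fin.prod_univ_eq_prod_range
    (fun j => if j < μ i then 1 - q ^ (μ i - j) * t ^ alphaExp μ i j else 1), ← Finset.prod_filter]
  congr 1
  ext j
  have := le_maxPart μ i
  simp only [Finset.mem_filter, Finset.mem_range]
  omega

theorem Omega_ne_zero {q t : ℂ} (ht : t ≠ 0) (μ : Fin n → ℕ)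
    (hv : ∀ i j, ‖twist q t μ i j‖ * max 1 ‖t‖ ^ n < 1) : Omega q t μ ≠ 0 := by
  rw [← prod_twist_eq_Omega ht]
  refine Finset.prod_ne_zero_iff.mpr fun i _ => Finset.prod_ne_zero_iff.mpr fun j _ => ?_
  intro h
  have h1 := norm_twist_mul_lt_one μ hv i j
    (show (Finset.univ.filter fun r => r < i ∧ (j : ℕ) < μ r).card ≤ n from
      (Finset.card_le_univ _).trans (by simp))
  rw [← sub_eq_zero.mp h, norm_one] at h1
  exact lt_irrefl _ h1

theorem pathSum_straightPath {q t : ℂ} (ht : t ≠ 0) (μ : Fin n → ℕ)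
    (hv : ∀ i j, ‖twist q t μ i j‖ * max 1 ‖t‖ ^ n < 1) :
    pathSum t (twist q t μ) (List.ofFn fun r => straightPath μ r) = (Omega q t μ)⁻¹ := by
  have h := (hasSum_prod_pow_state (fun i (j : Fin (maxPart μ + 1)) => twist q t μ i j *
    t ^ (Finset.univ.filter fun r => r < i ∧ (j : ℕ) < μ r).card) fun i j =>
      norm_twist_mul_lt_one μ hv i j ((Finset.card_le_univ _).trans (by simp))).2.tsum_eq
  simp only [mul_pow, Finset.prod_mul_distrib, Finset.prod_inv_distrib] at h
  rw [prod_twist_eq_Omega ht] at h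
  rw [← h, pathSum]
  simp only [listWt_ofFn_straightPath]

theorem prod_X_pow_eq (d : Fin n → ℕ) :
    (∏ r, X r ^ d r : MvPolynomial (Fin n) ℂ) =
      monomial (Finsupp.equivFunOnFinite.symm d) 1 := by
  rw [monomial_eq, C_1, one_mul, Finsupp.prod_fintype _ _ (by simp)]
  rfl

/-- A family with the right degrees other than the straight one must contain a face whose label
drops from left to right, and such faces have weight zero. -/
theorem coeff_partitionPoly {q t : ℂ} (ht : t ≠ 0) (μ : Fin n → ℕ)
    (hv : ∀ i j, ‖twist q t μ i j‖ * max 1 ‖t‖ ^ n < 1) :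
    (partitionPoly t μ (twist q t μ) id).coeff (Finsupp.equivFunOnFinite.symm μ) =
      (Omega q t μ)⁻¹ := by
  rw [partitionPoly, coeff_sum, Finset.sum_eq_single_of_mem _ (straightPath_mem_admissible μ)]
  · rw [prod_X_pow_eq, coeff_C_mul, coeff_monomial, if_pos, mul_one, pathSum_straightPath ht μ hv]
    simp only [deg_straightPath]
  · intro ks hks hne
    rw [prod_X_pow_eq, coeff_C_mul, coeff_monomial]
    split_ifs with hd
    swap
    · rw [mul_zero]
    have hdeg : ∀ r, deg (ks r) = μ r := congrFun (Finsupp.equivFunOnFinite.symm.injective hd)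
    rw [mul_one, pathSum]
    by_contra hcon
    apply hne
    refine eq_straightPath hks hdeg fun r c i k h1 h2 => ?_
    by_contra hlt
    apply hcon
    have hz := fun I => listWt_eq_zero (t := t) (List.mem_ofFn.mpr ⟨r, rfl⟩ : ks r ∈ List.ofFn ks)
      h1 h2 (not_le.mp hlt) I
    simp [hz]

/-- Summed over rows, the degree counts the coloured edges to the right of some column. Colour `l`
has exactly `μ l` of them, in every admissible family. -/
theorem totalDegree_partitionPoly_le (t : ℂ) (μ : Fin n → ℕ)
    (v : Fin n → Fin (maxPart μ + 1) → ℂ) :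
    (partitionPoly t μ v id).totalDegree ≤ ∑ i, μ i := by
  refine (totalDegree_finsetSum _ _).trans (Finset.sup_le fun ks hks => ?_)
  rw [prod_X_pow_eq, C_mul_monomial]
  refine (totalDegree_monomial_le _ _).trans (le_of_eq ?_)
  rw [Finsupp.sum_fintype _ _ (by simp)]
  simp only [Finsupp.equivFunOnFinite_symm_apply_apply]
  have h : (∑ r, deg (ks r) : ℤ) = ∑ i, (μ i : ℤ) := by
    simp only [deg_eq_sum]
    rw [Finset.sum_comm]
    refine Finset.sum_congr rfl fun l _ => ?_
    rw [Finset.sum_comm]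
    simp only [sum_unitZ_admissible Function.bijective_id hks, Fin.val_succ, Nat.succ_le_iff]
    rw [Finset.sum_boole, card_filter_val_lt ((le_maxPart μ l).trans (Nat.le_succ _))]
  exact_mod_cast h

/-! ### Triangularity of the Cherednik--Dunkl operators -/

/-- The statistic by which monomials are ordered. -/
def monKey (ν : Fin n →₀ ℕ) : ℕ ×ₗ ℕ := toLex (∑ k : Fin n, ν k ^ 2, ∑ k : Fin n, (k : ℕ) * ν k)

/-- The span of the monomials below a given value of the statistic. -/
def lowerSpan (n : ℕ) (c : ℕ ×ₗ ℕ) : Submodule ℂ (MvPolynomial (Fin n) ℂ) :=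
  Submodule.span ℂ ((fun ν => monomial ν 1) '' {ν | monKey ν < c})

/-- Operators that are triangular in the basis of monomials, with given diagonal entries. -/
def IsTriangular (A : Module.End ℂ (MvPolynomial (Fin n) ℂ)) (d : (Fin n →₀ ℕ) → ℂ) : Prop :=
  ∀ ν, A (monomial ν 1) - d ν • monomial ν 1 ∈ lowerSpan n (monKey ν)

theorem monomial_mem_lowerSpan {ν : Fin n →₀ ℕ} {c : ℕ ×ₗ ℕ} (h : monKey ν < c) :
    (monomial ν 1 : MvPolynomial (Fin n) ℂ) ∈ lowerSpan n c :=
  Submodule.subset_span ⟨ν, h, rfl⟩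

theorem lowerSpan_mono {c d : ℕ ×ₗ ℕ} (h : c ≤ d) : lowerSpan n c ≤ lowerSpan n d :=
  Submodule.span_mono (Set.image_mono fun _ hν => lt_of_lt_of_le hν h)

theorem coeff_eq_zero_of_mem_lowerSpan {p : MvPolynomial (Fin n) ℂ} {c : ℕ ×ₗ ℕ}
    (hp : p ∈ lowerSpan n c) {ν : Fin n →₀ ℕ} (hν : c ≤ monKey ν) : p.coeff ν = 0 := by
  induction hp using Submodule.span_induction with
  | mem x hx =>
    obtain ⟨ν', hν', rfl⟩ := hx
    rw [coeff_monomial, if_neg]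
    rintro rfl
    exact absurd hν' (not_lt.mpr hν)
  | zero => simp
  | add x y _ _ hx hy => simp [hx, hy]
  | smul a x _ hx => simp [hx]

namespace IsTriangular

variable {A B : Module.End ℂ (MvPolynomial (Fin n) ℂ)} {d e : (Fin n →₀ ℕ) → ℂ}

theorem map_mem (hA : IsTriangular A d) {c : ℕ ×ₗ ℕ} {p : MvPolynomial (Fin n) ℂ}
    (hp : p ∈ lowerSpan n c) : A p ∈ lowerSpan n c := by
  induction hp using Submodule.span_induction with
  | mem x hx =>
    obtain ⟨ν, hν, rfl⟩ := hx
    have h := add_mem (lowerSpan_mono (le_of_lt hν) (hA ν))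
      ((lowerSpan n c).smul_mem (d ν) (monomial_mem_lowerSpan hν))
    rwa [sub_add_cancel] at h
  | zero => simp
  | add x y _ _ hx hy => rw [map_add]; exact add_mem hx hy
  | smul a x _ hx => rw [map_smul]; exact Submodule.smul_mem _ _ hx

theorem mul (hA : IsTriangular A d) (hB : IsTriangular B e) :
    IsTriangular (A * B) fun ν => d ν * e ν := by
  intro ν
  have h := add_mem (hA.map_mem (hB ν)) ((lowerSpan n _).smul_mem (e ν) (hA ν))
  convert h using 1
  rw [Module.End.mul_apply, map_sub, map_smul, smul_sub, smul_smul, mul_comm (e ν)]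
  abel

theorem smul (hA : IsTriangular A d) (a : ℂ) : IsTriangular (a • A) fun ν => a * d ν := by
  intro ν
  have h := (lowerSpan n _).smul_mem a (hA ν)
  convert h using 1
  rw [LinearMap.smul_apply, smul_sub, smul_smul]

theorem one : IsTriangular (1 : Module.End ℂ (MvPolynomial (Fin n) ℂ)) fun _ => 1 := by
  intro ν
  simp

theorem congr (hA : IsTriangular A d) (h : ∀ ν, d ν = e ν) : IsTriangular A e := by
  rwa [← funext h]

/-- The diagonal entry at a maximal monomial of an eigenvector is the eigenvalue. -/
theorem eigenvalue_eq (hA : IsTriangular A d) {p : MvPolynomial (Fin n) ℂ} {a : ℂ}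
    (hp : A p = a • p) {ν : Fin n →₀ ℕ} (hν : ν ∈ p.support)
    (hmax : ∀ ν' ∈ p.support, monKey ν' ≤ monKey ν) : d ν = a := by
  have h1 : (A p).coeff ν = p.coeff ν * d ν := by
    conv_lhs => rw [p.as_sum]
    rw [map_sum, coeff_sum, Finset.sum_eq_single_of_mem ν hν]
    · have h2 := coeff_eq_zero_of_mem_lowerSpan (hA ν) le_rfl
      rw [coeff_sub, coeff_smul, coeff_monomial, if_pos rfl, sub_eq_zero, smul_eq_mul,
        mul_one] at h2
      rw [← mul_one (p.coeff ν), ← smul_eq_mul (p.coeff ν) 1, ← smul_monomial, map_smul,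
        coeff_smul, h2, smul_eq_mul, smul_eq_mul, mul_one]
    · intro ν' hν' hne
      -- Distinct monomials may share a key, but off-diagonal terms have strictly smaller key, so
      -- those in the support do not reach `ν`.
      have h2 := coeff_eq_zero_of_mem_lowerSpan (hA ν') (hmax ν' hν')
      rw [coeff_sub, coeff_smul, coeff_monomial, if_neg hne, smul_zero, sub_zero] at h2
      rw [← mul_one (p.coeff ν'), ← smul_eq_mul (p.coeff ν') 1, ← smul_monomial, map_smul,
        coeff_smul, h2, smul_zero]
  rw [hp, coeff_smul, smul_eq_mul, mul_comm] at h1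
  exact (mul_left_cancel₀ (mem_support_iff.mp hν) h1).symm

end IsTriangular

/-! ### Factorization of `Y_i` into two-variable operators -/

/-- The action of a permutation of the variables. -/
def permVars (π : Equiv.Perm (Fin n)) : Module.End ℂ (MvPolynomial (Fin n) ℂ) :=
  (rename π).toLinearMap

theorem permVars_apply (π : Equiv.Perm (Fin n)) (p : MvPolynomial (Fin n) ℂ) :
    permVars π p = rename π p := rfl

theorem permVars_mul (π ρ : Equiv.Perm (Fin n)) :
    permVars π * permVars ρ = permVars (π * ρ) := by
  refine LinearMap.ext fun p => ?_
  simp [permVars, Module.End.mul_apply, rename_rename]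

theorem transp_eq_permVars {k : ℕ} (hk : k + 1 < n) :
    transp n k = permVars (Equiv.swap ⟨k, by omega⟩ ⟨k + 1, hk⟩) := by
  rw [transp, dif_pos hk]
  rfl

theorem permVars_swapVars (π : Equiv.Perm (Fin n)) (a b : Fin n) (p : MvPolynomial (Fin n) ℂ) :
    permVars π (swapVars a b p) = swapVars (π a) (π b) (permVars π p) := by
  simp only [permVars_apply, swapVars, AlgHom.toLinearMap_apply, rename_rename]
  congr 2
  funext r
  simp only [Function.comp_apply, Equiv.swap_apply_def, π.injective.eq_iff]
  split_ifs <;> rfl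

theorem permVars_divDiff (π : Equiv.Perm (Fin n)) {a b : Fin n} (hab : a ≠ b)
    (p : MvPolynomial (Fin n) ℂ) :
    permVars π (divDiff a b hab p) = divDiff (π a) (π b) (π.injective.ne hab) (permVars π p) := by
  apply mul_left_cancel₀ (X_sub_X_ne_zero (π.injective.ne hab))
  refine Eq.trans ?_ (mul_divDiffFun (π a) (π b) (permVars π p)).symm
  rw [← permVars_swapVars, ← map_sub, ← mul_divDiffFun a b p]
  simp only [permVars_apply, map_mul, map_sub, rename_X]
  rfl

/-- The operator `β s + (α x_a - β x_b) ∂` where `∂` is the divided difference. -/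
def pairOp (α β : ℂ) (a b : Fin n) (hab : a ≠ b) : Module.End ℂ (MvPolynomial (Fin n) ℂ) :=
  β • swapVars a b + LinearMap.mulLeft ℂ (C α * X a - C β * X b) * divDiff a b hab

theorem mul_pairOp (α β : ℂ) {a b : Fin n} (hab : a ≠ b) (p : MvPolynomial (Fin n) ℂ) :
    (X a - X b) * pairOp α β a b hab p =
      (C α * X a - C β * X b) * p - (C α - C β) * X a * swapVars a b p := by
  rw [pairOp, LinearMap.add_apply, LinearMap.smul_apply, Module.End.mul_apply,
    LinearMap.mulLeft_apply, smul_eq_C_mul]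
  have h : (X a - X b) * divDiff a b hab p = p - swapVars a b p := mul_divDiffFun a b p
  linear_combination (C α * X a - C β * X b) * h

theorem permVars_pairOp (α β : ℂ) (π : Equiv.Perm (Fin n)) {a b : Fin n} (hab : a ≠ b) :
    permVars π * pairOp α β a b hab =
      pairOp α β (π a) (π b) (π.injective.ne hab) * permVars π := by
  refine LinearMap.ext fun p => ?_
  simp only [pairOp, Module.End.mul_apply, LinearMap.add_apply, LinearMap.smul_apply,
    LinearMap.mulLeft_apply, map_add, map_smul, permVars_swapVars]
  rw [← permVars_divDiff π hab]
  simp [permVars_apply]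

theorem swapVars_swapVars (a b : Fin n) (p : MvPolynomial (Fin n) ℂ) :
    swapVars a b (swapVars a b p) = p := by
  simp [swapVars, rename_rename, ← Equiv.coe_trans]

/-- Joined with a transposition taken from `ω`, a generator becomes a two-variable operator.
Permutations conjugate such operators by relabelling the variables, so the chains in `Y_i` can be
untangled. -/
theorem hecke_mul_transp (t : ℂ) {k : ℕ} (hk : k + 1 < n) :
    hecke n t k * transp n k = pairOp 1 t ⟨k, by omega⟩ ⟨k + 1, hk⟩ (by simp) := by
  refine LinearMap.ext fun p => ?_
  apply mul_left_cancel₀ (X_sub_X_ne_zero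
    (show (⟨k, by omega⟩ : Fin n) ≠ ⟨k + 1, hk⟩ by simp))
  rw [mul_pairOp, Module.End.mul_apply, transp, dif_pos hk, hecke, LinearMap.sub_apply,
    LinearMap.smul_apply, Module.End.one_apply, mul_sub, mul_ratioOp_apply, swapVars_swapVars,
    smul_eq_C_mul]
  simp only [C_1]
  ring

theorem transp_mul_heckeInv (t : ℂ) {k : ℕ} (hk : k + 1 < n) :
    transp n k * heckeInv n t k = t⁻¹ • pairOp t 1 ⟨k, by omega⟩ ⟨k + 1, hk⟩ (by simp) := by
  refine LinearMap.ext fun p => ?_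
  have hne : (⟨k, by omega⟩ : Fin n) ≠ ⟨k + 1, hk⟩ := by simp
  apply mul_left_cancel₀ (X_sub_X_ne_zero hne)
  rw [LinearMap.smul_apply, mul_smul_comm, mul_pairOp, Module.End.mul_apply, transp, dif_pos hk,
    heckeInv, LinearMap.smul_apply, map_smul, mul_smul_comm]
  congr 1
  have h := congrArg (swapVars ⟨k, by omega⟩ ⟨k + 1, hk⟩) (mul_ratioOp_apply (n := n) 1 t k hk p)
  rw [LinearMap.sub_apply, Module.End.one_apply]
  have hmul : ∀ f g : MvPolynomial (Fin n) ℂ, swapVars ⟨k, by omega⟩ ⟨k + 1, hk⟩ (f * g) =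
      swapVars ⟨k, by omega⟩ ⟨k + 1, hk⟩ f * swapVars ⟨k, by omega⟩ ⟨k + 1, hk⟩ g := by
    intro f g; simp [swapVars]
  have hX1 : swapVars ⟨k, by omega⟩ ⟨k + 1, hk⟩ (X ⟨k, by omega⟩) =
      (X ⟨k + 1, hk⟩ : MvPolynomial (Fin n) ℂ) := by simp [swapVars]
  have hX2 : swapVars ⟨k, by omega⟩ ⟨k + 1, hk⟩ (X ⟨k + 1, hk⟩) =
      (X ⟨k, by omega⟩ : MvPolynomial (Fin n) ℂ) := by simp [swapVars]
  have hC : ∀ a : ℂ, swapVars ⟨k, by omega⟩ ⟨k + 1, hk⟩ (C a) =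
      (C a : MvPolynomial (Fin n) ℂ) := by intro a; simp [swapVars]
  simp only [hmul, map_sub, hX1, hX2, hC, swapVars_swapVars] at h ⊢
  simp only [C_1] at h ⊢
  linear_combination h

/-- Only the images of the indices that occur when a `pairOp` is conjugated are recorded; the full
cycle is not needed. -/
theorem exists_perm_prod_transp (j m : ℕ) (hm : j + m < n) :
    ∃ π : Equiv.Perm (Fin n), ((List.range' j m).map (transp n)).prod = permVars π ∧
      π ⟨j + m, hm⟩ = ⟨j, by omega⟩ ∧ (∀ r : Fin n, (r : ℕ) < j → π r = r) ∧
      ∀ r : Fin n, j + m < r → π r = r := by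
  induction m with
  | zero =>
    refine ⟨1, ?_, rfl, fun _ _ => rfl, fun _ _ => rfl⟩
    refine LinearMap.ext fun p => ?_
    simp [permVars]
  | succ m ih =>
    obtain ⟨π, h1, h2, h3, h4⟩ := ih (by omega)
    refine ⟨π * Equiv.swap ⟨j + m, by omega⟩ ⟨j + m + 1, hm⟩, ?_, ?_, ?_, ?_⟩
    · rw [List.range'_concat, List.map_append, List.prod_append, h1, List.map_singleton,
        List.prod_singleton, one_mul, transp_eq_permVars (show j + m + 1 < n from hm),
        permVars_mul]
    · change π (Equiv.swap _ _ ⟨j + m + 1, hm⟩) = _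
      rw [Equiv.swap_apply_right, h2]
    · intro r hr
      rw [Equiv.Perm.mul_apply, Equiv.swap_apply_of_ne_of_ne, h3 r hr] <;>
        (intro h; simp only [Fin.ext_iff] at h; omega)
    · intro r hr
      rw [Equiv.Perm.mul_apply, Equiv.swap_apply_of_ne_of_ne, h4 r (by omega)] <;>
        (intro h; simp only [Fin.ext_iff] at h; omega)

/-- Multiplication of the variable `x_a` by `q`. -/
def scaleVar (q : ℂ) (a : Fin n) : Module.End ℂ (MvPolynomial (Fin n) ℂ) :=
  (aeval fun k : Fin n => if k = a then C q * X k else X k :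
    MvPolynomial (Fin n) ℂ →ₐ[ℂ] MvPolynomial (Fin n) ℂ).toLinearMap

theorem shiftOp_eq_scaleVar (q : ℂ) (h : 0 < n) : shiftOp n q = scaleVar q ⟨0, h⟩ := by
  simp only [shiftOp, scaleVar, Fin.ext_iff]

theorem scaleVar_mul_permVars (q : ℂ) (π : Equiv.Perm (Fin n)) (a : Fin n) :
    scaleVar q (π a) * permVars π = permVars π * scaleVar q a := by
  refine LinearMap.ext fun p => ?_
  simp only [Module.End.mul_apply, scaleVar, permVars, AlgHom.toLinearMap_apply]
  rw [aeval_rename, ← AlgHom.comp_apply]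
  refine AlgHom.congr_fun (MvPolynomial.algHom_ext fun k => ?_) p
  simp only [aeval_X, Function.comp_apply, AlgHom.comp_apply, π.injective.eq_iff]
  split_ifs <;> simp

theorem isTriangular_scaleVar (q : ℂ) (a : Fin n) :
    IsTriangular (scaleVar q a) fun ν => q ^ ν a := by
  intro ν
  have : scaleVar q a (monomial ν 1) = q ^ ν a • monomial ν 1 := by
    rw [scaleVar, AlgHom.toLinearMap_apply, aeval_monomial, map_one, one_mul,
      Finsupp.prod_fintype _ _ (by simp), monomial_eq, C_1, one_mul,
      Finsupp.prod_fintype _ _ (by simp), smul_eq_C_mul, C_pow]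
    have h : ∀ k, (if k = a then C q * X k else X k : MvPolynomial (Fin n) ℂ) ^ ν k =
        (if k = a then C q ^ ν k else 1) * X k ^ ν k := by
      intro k
      split_ifs
      · rw [mul_pow]
      · rw [one_mul]
    simp only [h, Finset.prod_mul_distrib, Finset.prod_ite_eq', Finset.mem_univ, if_true]
  rw [this, sub_self]
  exact zero_mem _

theorem sum_pairExponent (f : Fin n → ℕ → ℕ) (hf : ∀ k, f k 0 = 0) {a b : Fin n} (hab : a ≠ b)
    {ν : Fin n →₀ ℕ} (ha : ν a = 0) (hb : ν b = 0) (u w : ℕ) :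
    ∑ k, f k ((ν + Finsupp.single a u + Finsupp.single b w) k) =
      ∑ k, f k (ν k) + f a u + f b w := by
  have h : ∀ k, f k ((ν + Finsupp.single a u + Finsupp.single b w) k) =
      f k (ν k) + (if k = a then f a u else 0) + if k = b then f b w else 0 := by
    intro k
    by_cases h1 : k = a
    · subst h1
      simp [ha, hf, hab]
    · by_cases h2 : k = b
      · subst h2
        simp [hb, hf, h1]
      · simp [h1, h2]
  simp only [h, Finset.sum_add_distrib, Finset.sum_ite_eq', Finset.mem_univ, if_true]

theorem monKey_pairExponent {a b : Fin n} (hab : a ≠ b) {ν : Fin n →₀ ℕ} (ha : ν a = 0)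
    (hb : ν b = 0) (u w : ℕ) : monKey (ν + Finsupp.single a u + Finsupp.single b w) =
      toLex (∑ k : Fin n, ν k ^ 2 + u ^ 2 + w ^ 2,
        ∑ k : Fin n, (k : ℕ) * ν k + a * u + b * w) := by
  rw [monKey, sum_pairExponent (fun _ m => m ^ 2) (by simp) hab ha hb,
    sum_pairExponent (fun k m => (k : ℕ) * m) (by simp) hab ha hb]

theorem monomial_pairExponent (a b : Fin n) (ν : Fin n →₀ ℕ) (u w : ℕ) :
    (monomial (ν + Finsupp.single a u + Finsupp.single b w) 1 : MvPolynomial (Fin n) ℂ) =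
      monomial ν 1 * X a ^ u * X b ^ w := by
  rw [X_pow_eq_monomial, X_pow_eq_monomial, monomial_mul, monomial_mul, one_mul, one_mul]

theorem swapVars_pairExponent {a b : Fin n} {ν : Fin n →₀ ℕ} (ha : ν a = 0)
    (hb : ν b = 0) (u w : ℕ) :
    swapVars a b (monomial ν 1 * X a ^ u * X b ^ w) = monomial ν 1 * X a ^ w * X b ^ u := by
  have h : rename (Equiv.swap a b) (monomial ν 1 : MvPolynomial (Fin n) ℂ) = monomial ν 1 := by
    have h' : Finsupp.mapDomain (Equiv.swap a b) ν = ν := by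
      ext k
      rw [Finsupp.mapDomain_equiv_apply, Equiv.symm_swap, Equiv.swap_apply_def]
      split_ifs with h1 h2
      · rw [h1, ha, hb]
      · rw [h2, ha, hb]
      · rfl
    rw [rename_monomial, h']
  rw [swapVars, AlgHom.toLinearMap_apply, map_mul, map_mul, map_pow, map_pow, h, rename_X, rename_X,
    Equiv.swap_apply_left, Equiv.swap_apply_right]
  ring

/-- On `x_a^p x_b^r` the division is a finite geometric sum of monomials with the same total
exponent. Those strictly between the two orderings have a smaller sum of squares. The swapped
monomial has the same sum of squares and appears only for `p < r`, where the second component of the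
key decides. -/
theorem isTriangular_pairOp (α β : ℂ) {a b : Fin n} (hab : a < b) :
    IsTriangular (pairOp α β a b hab.ne) fun ν => if ν b < ν a then α else β := by
  intro ν
  obtain ⟨ν₀, ha, hb, p, r, rfl⟩ : ∃ ν₀ : Fin n →₀ ℕ, ν₀ a = 0 ∧ ν₀ b = 0 ∧ ∃ p r,
      ν = ν₀ + Finsupp.single a p + Finsupp.single b r := by
    refine ⟨(ν.erase a).erase b, by simp [Finsupp.erase, hab.ne], by simp, ν a, ν b, ?_⟩
    ext k
    by_cases h1 : k = a
    · subst h1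
      simp [Finsupp.erase, hab.ne]
    · by_cases h2 : k = b
      · subst h2
        simp [h1]
      · simp [h1, h2]
  have hpa : (ν₀ + Finsupp.single a p + Finsupp.single b r) a = p := by simp [ha, hab.ne]
  have hpb : (ν₀ + Finsupp.single a p + Finsupp.single b r) b = r := by simp [hb, hab.ne']
  simp only [hpa, hpb]
  have hab' : (a : ℕ) < b := hab
  by_cases hrp : r < p
  · rw [if_pos hrp]
    obtain ⟨d, rfl⟩ : ∃ d, p = r + 1 + d := ⟨p - r - 1, by omega⟩
    have hG : pairOp α β a b hab.ne
        (monomial (ν₀ + Finsupp.single a (r + 1 + d) + Finsupp.single b r) 1) -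
          α • monomial (ν₀ + Finsupp.single a (r + 1 + d) + Finsupp.single b r) 1 =
        (α - β) • ∑ k ∈ Finset.range d, monomial (ν₀ + Finsupp.single a (r + 1 + (d - 1 - k)) +
          Finsupp.single b (r + 1 + k)) 1 := by
      apply mul_left_cancel₀ (X_sub_X_ne_zero hab.ne)
      rw [mul_sub, mul_pairOp]
      simp only [monomial_pairExponent, smul_eq_C_mul]
      rw [swapVars_pairExponent ha hb]
      have hg := (Commute.all (X b : MvPolynomial (Fin n) ℂ) (X a)).geom_sum₂_mul d
      have hs : ∑ k ∈ Finset.range d, (monomial ν₀ 1 * X a ^ (r + 1 + (d - 1 - k)) *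
          X b ^ (r + 1 + k) : MvPolynomial (Fin n) ℂ) =
          monomial ν₀ 1 * X a ^ (r + 1) * X b ^ (r + 1) *
            ∑ k ∈ Finset.range d, X b ^ k * X a ^ (d - 1 - k) := by
        rw [Finset.mul_sum]
        refine Finset.sum_congr rfl fun k _ => ?_
        rw [pow_add, pow_add _ (r + 1) k]
        ring
      rw [hs, C_sub]
      simp only [pow_add, pow_one]
      linear_combination ((C α - C β) * monomial ν₀ 1 * X a ^ r * X a * (X b ^ r * X b)) * hg
    rw [hG]
    refine Submodule.smul_mem _ _ (Submodule.sum_mem _ fun k hk => monomial_mem_lowerSpan ?_)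
    rw [monKey_pairExponent hab.ne ha hb, monKey_pairExponent hab.ne ha hb, Prod.Lex.toLex_lt_toLex]
    left
    obtain ⟨e, rfl⟩ : ∃ e, d = k + 1 + e := ⟨d - k - 1, by have := Finset.mem_range.mp hk; omega⟩
    have he : k + 1 + e - 1 - k = e := by omega
    simp only [he]
    nlinarith
  · rw [if_neg hrp]
    obtain ⟨d, rfl⟩ : ∃ d, r = p + d := ⟨r - p, by omega⟩
    have hG : pairOp α β a b hab.ne
        (monomial (ν₀ + Finsupp.single a p + Finsupp.single b (p + d)) 1) -
          β • monomial (ν₀ + Finsupp.single a p + Finsupp.single b (p + d)) 1 =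
        (β - α) • ∑ k ∈ Finset.range d, monomial (ν₀ + Finsupp.single a (p + 1 + (d - 1 - k)) +
          Finsupp.single b (p + k)) 1 := by
      apply mul_left_cancel₀ (X_sub_X_ne_zero hab.ne)
      rw [mul_sub, mul_pairOp]
      simp only [monomial_pairExponent, smul_eq_C_mul]
      rw [swapVars_pairExponent ha hb]
      have hg := (Commute.all (X b : MvPolynomial (Fin n) ℂ) (X a)).geom_sum₂_mul d
      have hs : ∑ k ∈ Finset.range d, (monomial ν₀ 1 * X a ^ (p + 1 + (d - 1 - k)) *
          X b ^ (p + k) : MvPolynomial (Fin n) ℂ) =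
          monomial ν₀ 1 * X a ^ (p + 1) * X b ^ p *
            ∑ k ∈ Finset.range d, X b ^ k * X a ^ (d - 1 - k) := by
        rw [Finset.mul_sum]
        refine Finset.sum_congr rfl fun k _ => ?_
        rw [pow_add, pow_add _ p k]
        ring
      rw [hs, C_sub]
      simp only [pow_add, pow_one]
      linear_combination ((C β - C α) * monomial ν₀ 1 * X a ^ p * X a * X b ^ p) * hg
    rw [hG]
    refine Submodule.smul_mem _ _ (Submodule.sum_mem _ fun k hk => monomial_mem_lowerSpan ?_)
    rw [monKey_pairExponent hab.ne ha hb, monKey_pairExponent hab.ne ha hb, Prod.Lex.toLex_lt_toLex]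
    obtain ⟨e, rfl⟩ : ∃ e, d = k + 1 + e := ⟨d - k - 1, by have := Finset.mem_range.mp hk; omega⟩
    have he : k + 1 + e - 1 - k = e := by omega
    simp only [he]
    -- The term `k = 0` is the swapped monomial; the larger exponent now sits at the smaller index
    -- `a`, which lowers `∑ k * ν k`.
    rcases Nat.eq_zero_or_pos k with rfl | hk'
    · right
      refine ⟨by ring, ?_⟩
      nlinarith
    · left
      nlinarith

/-- The factors of `Y_i` to the right of the shift. -/
theorem isTriangular_prod_transp_heckeInv {t : ℂ} (ht : t ≠ 0) (i : Fin n) (m : ℕ)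
    (hm : i + m < n) :
    IsTriangular (((List.range' (i : ℕ) m).map (transp n)).prod *
      ((List.range' (i : ℕ) m).reverse.map (heckeInv n t)).prod) fun ν =>
        ∏ k ∈ Finset.univ.filter (fun k : Fin n => i < k ∧ (k : ℕ) ≤ i + m),
          if ν k < ν i then 1 else t⁻¹ := by
  induction m with
  | zero =>
    have : Finset.univ.filter (fun k : Fin n => i < k ∧ (k : ℕ) ≤ i + 0) = ∅ := by
      ext k
      simp only [Finset.mem_filter, Finset.mem_univ, true_and, Finset.notMem_empty, iff_false]
      omega
    simp only [this, Finset.prod_empty]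
    simpa using IsTriangular.one
  | succ m ih =>
    obtain ⟨π, h1, h2, -, h4⟩ := exists_perm_prod_transp (n := n) i m (by omega)
    have hb : π ⟨i + m + 1, hm⟩ = ⟨i + m + 1, hm⟩ := h4 _ (by simp)
    have hlt : i < (⟨i + m + 1, hm⟩ : Fin n) := by rw [Fin.lt_def]; simp only; omega
    -- The innermost pair gives a `pairOp` in the variables `i + m` and `i + m + 1`. Pulling it left
    -- through the remaining transpositions renames `i + m` to `i`.
    have hop : ((List.range' (i : ℕ) (m + 1)).map (transp n)).prod *
        ((List.range' (i : ℕ) (m + 1)).reverse.map (heckeInv n t)).prod =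
        (t⁻¹ • pairOp t 1 i ⟨i + m + 1, hm⟩ hlt.ne) *
          (((List.range' (i : ℕ) m).map (transp n)).prod *
            ((List.range' (i : ℕ) m).reverse.map (heckeInv n t)).prod) := by
      rw [List.range'_concat, List.map_append, List.prod_append, List.reverse_append,
        List.map_append, List.prod_append]
      simp only [one_mul, List.reverse_singleton, List.map_singleton, List.prod_singleton]
      rw [mul_assoc, ← mul_assoc (transp n _), transp_mul_heckeInv t (show (i : ℕ) + m + 1 < n from hm),
        ← mul_assoc, h1, mul_smul_comm, permVars_pairOp]
      simp only [h2, hb, smul_mul_assoc, mul_assoc]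
    rw [hop]
    refine (((isTriangular_pairOp t 1 hlt).smul t⁻¹).mul (ih (by omega))).congr fun ν => ?_
    have hset : Finset.univ.filter (fun k : Fin n => i < k ∧ (k : ℕ) ≤ i + (m + 1)) =
        insert ⟨i + m + 1, hm⟩
          (Finset.univ.filter fun k : Fin n => i < k ∧ (k : ℕ) ≤ i + m) := by
      ext k
      simp only [Finset.mem_filter, Finset.mem_univ, true_and, Finset.mem_insert, Fin.ext_iff,
        Fin.lt_def]
      omega
    rw [hset, Finset.prod_insert (by simp)]
    congr 1
    split_ifs
    · exact inv_mul_cancel₀ ht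
    · exact mul_one _

/-- The factors of `Y_i` to the left of the shift. -/
theorem isTriangular_prod_hecke_transp (t : ℂ) (i : Fin n) (m j : ℕ) (hm : j + m = i) :
    IsTriangular (((List.range' j m).reverse.map (hecke n t)).prod *
      ((List.range' j m).map (transp n)).prod) fun ν =>
        ∏ k ∈ Finset.univ.filter (fun k : Fin n => j ≤ (k : ℕ) ∧ k < i),
          if ν i < ν k then 1 else t := by
  induction m generalizing j with
  | zero =>
    have : Finset.univ.filter (fun k : Fin n => j ≤ (k : ℕ) ∧ k < i) = ∅ := by
      ext k
      simp only [Finset.mem_filter, Finset.mem_univ, true_and, Finset.notMem_empty, iff_false,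
        Fin.lt_def]
      omega
    simp only [this, Finset.prod_empty]
    simpa using IsTriangular.one
  | succ m ih =>
    have hi := i.isLt
    obtain ⟨π, h1, h2, h3, -⟩ := exists_perm_prod_transp (n := n) (j + 1) m (by omega)
    have h2' : π i = ⟨j + 1, by omega⟩ := by
      rw [← h2]
      congr 1
      ext
      simp only
      omega
    have hj : π ⟨j, by omega⟩ = ⟨j, by omega⟩ := h3 _ (by simp)
    have hlt : (⟨j, by omega⟩ : Fin n) < i := by rw [Fin.lt_def]; simp only; omega
    -- Here the permutation is moved from right to left, which turns the neighbouring pair `j`, `j +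
    -- 1` into the pair `j`, `i`.
    have hconj : pairOp 1 t ⟨j, by omega⟩ ⟨j + 1, by omega⟩ (by simp) * permVars π =
        permVars π * pairOp 1 t ⟨j, by omega⟩ i hlt.ne := by
      rw [permVars_pairOp]
      simp only [hj, h2']
    have hop : ((List.range' j (m + 1)).reverse.map (hecke n t)).prod *
        ((List.range' j (m + 1)).map (transp n)).prod =
        (((List.range' (j + 1) m).reverse.map (hecke n t)).prod *
          ((List.range' (j + 1) m).map (transp n)).prod) *
            pairOp 1 t ⟨j, by omega⟩ i hlt.ne := by
      rw [List.range'_succ, List.reverse_cons, List.map_append, List.prod_append, List.map_singleton,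
        List.prod_singleton, List.map_cons, List.prod_cons, mul_assoc,
        ← mul_assoc (hecke n t j), hecke_mul_transp t (show j + 1 < n by omega), h1, hconj,
        mul_assoc]
    rw [hop]
    refine ((ih (j + 1) (by omega)).mul (isTriangular_pairOp 1 t hlt)).congr fun ν => ?_
    have hset : Finset.univ.filter (fun k : Fin n => j ≤ (k : ℕ) ∧ k < i) =
        insert ⟨j, by omega⟩
          (Finset.univ.filter fun k : Fin n => j + 1 ≤ (k : ℕ) ∧ k < i) := by
      ext k
      simp only [Finset.mem_filter, Finset.mem_univ, true_and, Finset.mem_insert, Fin.ext_iff,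
        Fin.lt_def]
      omega
    rw [hset, Finset.prod_insert (by simp), mul_comm]

/-- Splitting `s_1 ⋯ s_{n-1}` at `i` and pushing the shift through the left half makes it act on
`x_i`. What remains on either side is a product of two-variable operators pairing `x_i` with each
other variable. Their diagonal entries multiply to `y_i(ν)`. -/
theorem isTriangular_cherednik {q t : ℂ} (ht : t ≠ 0) (i : Fin n) :
    IsTriangular (cherednik q t i) fun ν => eig q t ν i := by
  have hi := i.isLt
  obtain ⟨π, h1, h2, -, -⟩ := exists_perm_prod_transp (n := n) 0 i (by omega)
  have h2' : π i = ⟨0, by omega⟩ := by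
    rw [← h2]
    congr 1
    ext
    simp
  have hop : cherednik q t i =
      (((List.range' 0 (i : ℕ)).reverse.map (hecke n t)).prod *
        ((List.range' 0 (i : ℕ)).map (transp n)).prod) * scaleVar q i *
      (((List.range' (i : ℕ) (n - 1 - i)).map (transp n)).prod *
        ((List.range' (i : ℕ) (n - 1 - i)).reverse.map (heckeInv n t)).prod) := by
    have hr : List.range (n - 1) = List.range' 0 i ++ List.range' i (n - 1 - i) := by
      rw [List.range_eq_range']
      have := List.range'_append (s := 0) (m := (i : ℕ)) (n := n - 1 - i) (step := 1)
      rw [one_mul, zero_add] at this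
      rw [this]
      congr 1
      omega
    rw [cherednik, omega, hr, List.map_append, List.prod_append, shiftOp_eq_scaleVar q (by omega),
      List.range_eq_range', h1, ← h2']
    simp only [mul_assoc]
    rw [← mul_assoc (scaleVar q (π i)), scaleVar_mul_permVars, mul_assoc]
  rw [hop]
  refine (((isTriangular_prod_hecke_transp t i i 0 (by simp)).mul (isTriangular_scaleVar q i)).mul
    (isTriangular_prod_transp_heckeInv ht i (n - 1 - i) (by omega))).congr fun ν => ?_
  rw [Finset.prod_ite, Finset.prod_ite, Finset.prod_const_one, Finset.prod_const_one,
    Finset.prod_const, Finset.prod_const, one_mul, one_mul, eig, Finset.filter_filter,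
    Finset.filter_filter]
  have e1 : ((Finset.univ.filter fun k : Fin n => (0 ≤ (k : ℕ) ∧ k < i) ∧ ¬ ν i < ν k).card : ℤ) =
      (i : ℕ) - (Finset.univ.filter fun j => j < i ∧ ν i < ν j).card := by
    have : (Finset.univ.filter fun k : Fin n => (0 ≤ (k : ℕ) ∧ k < i) ∧ ¬ ν i < ν k).card +
        (Finset.univ.filter fun j => j < i ∧ ν i < ν j).card = (Finset.Iio i).card := by
      rw [← Finset.card_union_of_disjoint]
      · congr 1
        ext k
        simp only [Finset.mem_filter, Finset.mem_univ, true_and, Finset.mem_union, Finset.mem_Iio]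
        omega
      · rw [Finset.disjoint_left]
        intro k
        simp only [Finset.mem_filter, Finset.mem_univ, true_and]
        omega
    rw [Fin.card_Iio] at this
    omega
  have e2 : (Finset.univ.filter fun k : Fin n =>
      (i < k ∧ (k : ℕ) ≤ i + (n - 1 - i)) ∧ ¬ ν k < ν i) =
      Finset.univ.filter fun j => i < j ∧ ν i ≤ ν j := by
    ext k
    have := k.isLt
    simp only [Finset.mem_filter, Finset.mem_univ, true_and]
    omega
  rw [e2, inv_pow, ← zpow_natCast, e1, ← zpow_natCast t (Finset.card _), ← zpow_neg,
    mul_comm (t ^ _) (q ^ _), mul_assoc, ← zpow_add₀ ht, eta]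
  congr 2
  ring

/-- A joint eigenvector whose joint eigenvalue is simple is determined by its leading coefficient. -/
theorem eq_zero_of_cherednik_eigen {q t : ℂ} (ht : t ≠ 0) (μ : Fin n → ℕ)
    (hsimple : ∀ ν : Fin n → ℕ, ∑ i, ν i ≤ ∑ i, μ i → ν ≠ μ → ∃ i, eig q t ν i ≠ eig q t μ i)
    {p : MvPolynomial (Fin n) ℂ} (hdeg : p.totalDegree ≤ ∑ i, μ i)
    (hcoeff : p.coeff (Finsupp.equivFunOnFinite.symm μ) = 0)
    (heig : ∀ i, cherednik q t i p = eig q t μ i • p) : p = 0 := by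
  by_contra hne
  -- At a monomial of maximal key the diagonal entries `y_i(ν)` equal the eigenvalues `y_i(μ)`.
  -- Simplicity forces `ν = μ`, which the missing coefficient excludes.
  obtain ⟨ν, hν, hmax⟩ := Finset.exists_max_image p.support monKey (support_nonempty.mpr hne)
  have hνμ : (ν : Fin n → ℕ) ≠ μ := by
    intro h
    apply mem_support_iff.mp hν
    rw [← hcoeff]
    congr 1
    ext k
    simp [← h]
  have hνdeg : ∑ i, ν i ≤ ∑ i, μ i := by
    have := le_totalDegree hν
    rw [Finsupp.sum_fintype _ _ (by simp)] at this
    exact this.trans hdeg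
  obtain ⟨i, hi⟩ := hsimple ν hνdeg hνμ
  exact hi ((isTriangular_cherednik ht i).eigenvalue_eq (heig i) hν hmax)

/-! ### Reversal of the alphabet -/

/-- Reversal sends the neighbouring pair `k`, `k + 1` to `n - 1 - k`, `n - 2 - k`, in decreasing
order. Numerator and denominator both change sign when reordered, so `α` and `β` trade places. -/
theorem permVars_rev_ratioOp (α β : ℂ) {k : ℕ} (hk : k + 1 < n) :
    permVars Fin.revPerm * ratioOp n α β k = ratioOp n β α (n - 2 - k) * permVars Fin.revPerm := by
  refine LinearMap.ext fun p => ?_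
  have hk' : (n - 2 - k) + 1 < n := by omega
  have e1 : Fin.revPerm (⟨k, by omega⟩ : Fin n) = ⟨n - 2 - k + 1, hk'⟩ := by
    ext; simp [Fin.val_rev]; omega
  have e2 : Fin.revPerm (⟨k + 1, hk⟩ : Fin n) = ⟨n - 2 - k, by omega⟩ := by
    ext; simp [Fin.val_rev]; omega
  apply mul_left_cancel₀ (X_sub_X_ne_zero
    (show (⟨n - 2 - k, by omega⟩ : Fin n) ≠ ⟨n - 2 - k + 1, hk'⟩ by simp))
  rw [Module.End.mul_apply, Module.End.mul_apply, mul_ratioOp_apply]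
  have h := congrArg (permVars Fin.revPerm) (mul_ratioOp_apply α β k hk p)
  rw [permVars_apply, permVars_apply, map_mul, map_mul, map_sub, map_sub, map_sub, map_mul, map_mul,
    rename_C, rename_C, rename_X, rename_X, e1, e2, ← permVars_apply _ (swapVars _ _ _),
    permVars_swapVars, e1, e2, ← permVars_apply, ← permVars_apply] at h
  have hs : swapVars ⟨n - 2 - k + 1, hk'⟩ ⟨n - 2 - k, by omega⟩ =
      (swapVars ⟨n - 2 - k, by omega⟩ ⟨n - 2 - k + 1, hk'⟩ :
        Module.End ℂ (MvPolynomial (Fin n) ℂ)) := by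
    rw [swapVars, swapVars, Equiv.swap_comm]
  rw [hs] at h
  linear_combination -h

theorem permVars_rev_hecke (t : ℂ) {k : ℕ} (hk : k + 1 < n) :
    permVars Fin.revPerm * hecke n t k = heckeTilde n t (n - 2 - k) * permVars Fin.revPerm := by
  rw [hecke, heckeTilde, mul_sub, sub_mul, permVars_rev_ratioOp _ _ hk, mul_smul_comm, mul_one,
    smul_mul_assoc, one_mul]

theorem permVars_rev_heckeInv (t : ℂ) {k : ℕ} (hk : k + 1 < n) :
    permVars Fin.revPerm * heckeInv n t k =
      heckeTildeInv n t (n - 2 - k) * permVars Fin.revPerm := by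
  rw [heckeInv, heckeTildeInv, mul_smul_comm, smul_mul_assoc, mul_sub, sub_mul,
    permVars_rev_ratioOp _ _ hk, mul_one, one_mul]

theorem permVars_rev_transp {k : ℕ} (hk : k + 1 < n) :
    permVars Fin.revPerm * transp n k = transp n (n - 2 - k) * permVars Fin.revPerm := by
  refine LinearMap.ext fun p => ?_
  have hk' : (n - 2 - k) + 1 < n := by omega
  have e1 : Fin.revPerm (⟨k, by omega⟩ : Fin n) = ⟨n - 2 - k + 1, hk'⟩ := by
    ext; simp [Fin.val_rev]; omega
  have e2 : Fin.revPerm (⟨k + 1, hk⟩ : Fin n) = ⟨n - 2 - k, by omega⟩ := by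
    ext; simp [Fin.val_rev]; omega
  rw [Module.End.mul_apply, Module.End.mul_apply, transp, dif_pos hk, transp, dif_pos hk',
    permVars_swapVars, e1, e2, swapVars, swapVars, Equiv.swap_comm]

theorem mul_list_prod_map {M : Type*} [Monoid M] {r : M} {f g : ℕ → M} (l : List ℕ)
    (h : ∀ k ∈ l, r * f k = g (n - 2 - k) * r) :
    r * (l.map f).prod = ((l.map fun k => n - 2 - k).map g).prod * r := by
  induction l with
  | nil => simp
  | cons k l ih =>
    rw [List.map_cons, List.prod_cons, List.map_cons, List.map_cons, List.prod_cons, ← mul_assoc,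
      h k (by simp), mul_assoc, ih fun k' hk' => h k' (by simp [hk']), mul_assoc]

theorem map_rev_reverse_range {m : ℕ} (hm : m < n) :
    ((List.range m).reverse.map fun k => n - 2 - k) = List.range' (n - 1 - m) m := by
  refine List.ext_getElem (by simp) fun r h1 h2 => ?_
  simp only [List.length_range'] at h2
  simp only [List.getElem_map, List.getElem_reverse, List.length_range, List.getElem_range,
    List.getElem_range']
  omega

theorem map_rev_reverse_range' {i : ℕ} (hi : i < n) :
    ((List.range' i (n - 1 - i)).reverse.map fun k => n - 2 - k) = List.range (n - 1 - i) := by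
  refine List.ext_getElem (by simp) fun r h1 h2 => ?_
  simp only [List.length_range] at h2
  simp only [List.getElem_map, List.getElem_reverse, List.length_range', List.getElem_range,
    List.getElem_range']
  omega

theorem map_rev_range :
    ((List.range (n - 1)).map fun k => n - 2 - k) = (List.range (n - 1)).reverse := by
  refine List.ext_getElem (by simp) fun r h1 h2 => ?_
  simp only [List.length_reverse, List.length_range] at h2
  simp only [List.getElem_map, List.getElem_reverse, List.length_range, List.getElem_range]
  omega

theorem exists_perm_prod_transp_reverse (m : ℕ) (hm : m < n) :
    ∃ π : Equiv.Perm (Fin n), ((List.range m).reverse.map (transp n)).prod = permVars π ∧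
      π ⟨0, by omega⟩ = ⟨m, hm⟩ := by
  induction m with
  | zero =>
    refine ⟨1, ?_, rfl⟩
    refine LinearMap.ext fun p => ?_
    simp [permVars]
  | succ m ih =>
    obtain ⟨π, h1, h2⟩ := ih (by omega)
    refine ⟨Equiv.swap ⟨m, by omega⟩ ⟨m + 1, hm⟩ * π, ?_, ?_⟩
    · rw [List.range_succ, List.reverse_append, List.map_append, List.prod_append, h1,
        List.reverse_singleton, List.map_singleton, List.prod_singleton, transp_eq_permVars hm,
        permVars_mul]
    · rw [Equiv.Perm.mul_apply, h2, Equiv.swap_apply_left]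

/-- On both sides the shift can be moved to act on the last variable: reversal and the cycle
`s_{n-1} ⋯ s_1` agree on the first index. -/
theorem permVars_rev_omega (q : ℂ) (h : 0 < n) :
    permVars Fin.revPerm * omega n q = omegaTilde n q * permVars Fin.revPerm := by
  obtain ⟨π, h1, h2⟩ := exists_perm_prod_transp_reverse (n := n) (n - 1) (by omega)
  have e : Fin.revPerm (⟨0, h⟩ : Fin n) = π ⟨0, by omega⟩ := by
    rw [h2]; ext; simp [Fin.val_rev]
  rw [omega, omegaTilde, shiftOp_eq_scaleVar q h, ← mul_assoc, ← scaleVar_mul_permVars, mul_assoc,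
    mul_list_prod_map (n := n) _ (fun k hk => permVars_rev_transp (by
      have := List.mem_range.mp hk; omega)), map_rev_range, h1, ← mul_assoc, e,
    scaleVar_mul_permVars, mul_assoc]

/-- Reversing the alphabet exchanges the two families of Cherednik--Dunkl operators. -/
theorem permVars_rev_cherednik (q t : ℂ) (i : Fin n) :
    permVars Fin.revPerm * cherednik q t i =
      cherednikTilde q t i.rev * permVars Fin.revPerm := by
  have hi := i.isLt
  have hr : ((i.rev : Fin n) : ℕ) = n - 1 - i := by rw [Fin.val_rev]; omega
  have hr' : n - 1 - (n - 1 - (i : ℕ)) = i := by omega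
  rw [cherednik, cherednikTilde, ← mul_assoc, ← mul_assoc,
    mul_list_prod_map (n := n) (g := heckeTilde n t) _ (fun k hk => permVars_rev_hecke t (by
      have := List.mem_range.mp (List.mem_reverse.mp hk); omega)), map_rev_reverse_range hi,
    mul_assoc (List.prod _) (permVars _) (omega n q), permVars_rev_omega q (by omega), ← mul_assoc,
    mul_assoc _ (permVars _) (List.prod _),
    mul_list_prod_map (n := n) (g := heckeTildeInv n t) _ (fun k hk => permVars_rev_heckeInv t (by
      have := List.mem_range'_1.mp (List.mem_reverse.mp hk); omega)), map_rev_reverse_range' hi,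
    hr, hr', ← mul_assoc]

theorem card_filter_rev (P : Fin n → Prop) [DecidablePred P] :
    (Finset.univ.filter fun j : Fin n => P j.rev).card = (Finset.univ.filter P).card := by
  rw [← Finset.card_map Fin.revPerm.toEmbedding]
  congr 1
  ext j
  simp only [Finset.mem_map_equiv, Finset.mem_filter, Finset.mem_univ, true_and]
  simp

theorem eigTilde_rev (q t : ℂ) (μ : Fin n → ℕ) (i : Fin n) :
    eigTilde q t (fun j => μ j.rev) i.rev = eig q t μ i := by
  have h1 := card_filter_rev fun j : Fin n => i < j ∧ μ i ≤ μ j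
  have h2 := card_filter_rev fun j : Fin n => j < i ∧ μ i < μ j
  have e1 : ∀ j : Fin n, i < j.rev ↔ j < i.rev := fun j => Fin.lt_rev_iff
  have e2 : ∀ j : Fin n, j.rev < i ↔ i.rev < j := fun j => Fin.rev_lt_iff
  simp only [e1, e2] at h1 h2
  unfold eigTilde eig etaTilde eta
  simp only [Fin.rev_rev]
  rw [h1, h2, Fin.val_rev]
  have := i.isLt
  congr 2
  omega

theorem isE_rename_rev {q t : ℂ} {μ : Fin n → ℕ} {p : MvPolynomial (Fin n) ℂ}
    (hdeg : p.totalDegree ≤ ∑ i, μ i) (hcoeff : p.coeff (Finsupp.equivFunOnFinite.symm μ) = 1)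
    (heig : ∀ i, cherednik q t i p = eig q t μ i • p) :
    IsE q t (fun i => μ i.rev) (rename Fin.rev p) where
  degree_le := by
    refine (totalDegree_rename_le _ _).trans (hdeg.trans (le_of_eq ?_))
    exact (Equiv.sum_comp Fin.revPerm μ).symm
  monic := by
    rw [← hcoeff, ← coeff_rename_mapDomain Fin.rev Fin.rev_injective p]
    congr 1
    ext k
    have h := Finsupp.mapDomain_equiv_apply (f := Fin.revPerm) (Finsupp.equivFunOnFinite.symm μ) k
    exact h.symm
  eigen i := by
    have h := LinearMap.congr_fun (permVars_rev_cherednik q t i.rev) p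
    rw [Fin.rev_rev, Module.End.mul_apply, Module.End.mul_apply, heig, map_smul] at h
    have h' := eigTilde_rev q t μ i.rev
    rw [Fin.rev_rev] at h'
    rw [h']
    exact h.symm

theorem rename_rev_rename_rev (p : MvPolynomial (Fin n) ℂ) :
    rename Fin.rev (rename Fin.rev p) = p := by
  have : (Fin.rev : Fin n → Fin n) ∘ Fin.rev = id := funext Fin.rev_rev
  rw [rename_rename, this, rename_id_apply]

/-- The properties of `rename Fin.rev E` for `E` satisfying `IsE`. -/
theorem IsE.rename_rev {q t : ℂ} {μ : Fin n → ℕ} {E : MvPolynomial (Fin n) ℂ}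
    (hE : IsE q t (fun i => μ i.rev) E) :
    (rename Fin.rev E).totalDegree ≤ ∑ i, μ i ∧
      (rename Fin.rev E).coeff (Finsupp.equivFunOnFinite.symm μ) = 1 ∧
      ∀ i, cherednik q t i (rename Fin.rev E) = eig q t μ i • rename Fin.rev E := by
  refine ⟨?_, ?_, fun i => ?_⟩
  · refine (totalDegree_rename_le _ _).trans (hE.degree_le.trans (le_of_eq ?_))
    exact Equiv.sum_comp Fin.revPerm μ
  · rw [← hE.monic, ← coeff_rename_mapDomain Fin.rev Fin.rev_injective E]
    congr 1
    ext k
    have h := Finsupp.mapDomain_equiv_apply (f := Fin.revPerm)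
      (Finsupp.equivFunOnFinite.symm fun i => μ i.rev) k
    refine Eq.trans ?_ h.symm
    simp
  · apply rename_injective Fin.rev Fin.rev_injective
    have h := LinearMap.congr_fun (permVars_rev_cherednik q t i) (rename Fin.rev E)
    have h' : permVars Fin.revPerm (rename Fin.rev E) = E := rename_rev_rename_rev E
    rw [Module.End.mul_apply, Module.End.mul_apply, h', hE.eigen, eigTilde_rev] at h
    rw [map_smul, rename_rev_rename_rev]
    exact h

end NonsymMacdonald

end

/-! ### The theorem -/

theorem theorem4p2 (n : ℕ) (μ : Fin n → ℕ) (q t : ℂ) (hq : q ≠ 0) (ht : t ≠ 0)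
    -- the twists are so small that the geometric series converge
    (hv : ∀ i j, ‖NonsymMacdonald.twist q t μ i j‖ * max 1 ‖t‖ ^ n < 1) :
    -- the sum over all families `{m}` converges absolutely
    (∀ x : Fin n → ℂ, Summable fun m =>
      NonsymMacdonald.formTerm μ (NonsymMacdonald.twist q t μ)
        (NonsymMacdonald.rowOpProd (NonsymMacdonald.maxPart μ) t x) m) ∧
    -- the partition function is a polynomial, a joint eigenfunction of the operators `Y_i`, with
    -- `x^μ` coefficient `1 / Ω_μ`
    NonsymMacdonald.Omega q t μ ≠ 0 ∧
    (∃ Z : MvPolynomial (Fin n) ℂ,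
      (∀ x : Fin n → ℂ, NonsymMacdonald.partitionFn q t μ x = MvPolynomial.eval x Z) ∧
      (∀ i, NonsymMacdonald.cherednik q t i Z = NonsymMacdonald.eig q t μ i • Z) ∧
      Z.coeff (Finsupp.equivFunOnFinite.symm μ) = 1 / NonsymMacdonald.Omega q t μ) ∧
    -- wherever the joint eigenvalue of `μ` is simple among compositions of size at most `|μ|`,
    -- the nonsymmetric Macdonald polynomial is well defined and given by the partition function
    ((∀ ν : Fin n → ℕ, ∑ i, ν i ≤ ∑ i, μ i → ν ≠ μ →
        ∃ i, NonsymMacdonald.eig q t ν i ≠ NonsymMacdonald.eig q t μ i) →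
      (∃! E, NonsymMacdonald.IsE q t (fun i => μ i.rev) E) ∧
      ∀ x : Fin n → ℂ,
        NonsymMacdonald.Omega q t μ * NonsymMacdonald.partitionFn q t μ x =
          MvPolynomial.eval x (NonsymMacdonald.polyF q t μ)) := by
  classical
  set Z := NonsymMacdonald.partitionPoly t μ (NonsymMacdonald.twist q t μ) id with hZ
  have hΩ := NonsymMacdonald.Omega_ne_zero ht μ hv
  have heval : ∀ x : Fin n → ℂ, NonsymMacdonald.partitionFn q t μ x = MvPolynomial.eval x Z :=
    fun x => (NonsymMacdonald.eval_partitionPoly ht μ _ hv id x).symm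
  have heig := NonsymMacdonald.cherednik_partitionPoly hq ht μ hv
  have hcoeff := NonsymMacdonald.coeff_partitionPoly ht μ hv
  refine ⟨fun x => NonsymMacdonald.summable_formTerm ht μ _ hv id x, hΩ,
    ⟨Z, heval, heig, by rw [hcoeff, one_div]⟩, fun hsimple => ?_⟩
  set F := NonsymMacdonald.Omega q t μ • Z with hF
  have hFdeg : F.totalDegree ≤ ∑ i, μ i :=
    (MvPolynomial.totalDegree_smul_le _ _).trans
      (NonsymMacdonald.totalDegree_partitionPoly_le t μ _)
  have hFcoeff : F.coeff (Finsupp.equivFunOnFinite.symm μ) = 1 := by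
    rw [hF, MvPolynomial.coeff_smul, hcoeff, smul_eq_mul, mul_inv_cancel₀ hΩ]
  have hFeig : ∀ i, NonsymMacdonald.cherednik q t i F = NonsymMacdonald.eig q t μ i • F := by
    intro i
    rw [hF, map_smul, heig, smul_comm]
  have hE := NonsymMacdonald.isE_rename_rev hFdeg hFcoeff hFeig
  -- The difference of two normalized eigenvectors has no `x^μ` term, so triangularity and
  -- simplicity make it vanish.
  have huniq : ∀ E, NonsymMacdonald.IsE q t (fun i => μ i.rev) E →
      MvPolynomial.rename Fin.rev E = F := by
    intro E hE'
    obtain ⟨h1, h2, h3⟩ := hE'.rename_rev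
    refine sub_eq_zero.mp (NonsymMacdonald.eq_zero_of_cherednik_eigen ht μ hsimple ?_ ?_ ?_)
    · exact (MvPolynomial.totalDegree_sub _ _).trans (max_le h1 hFdeg)
    · rw [MvPolynomial.coeff_sub, h2, hFcoeff, sub_self]
    · intro i
      rw [map_sub, h3, hFeig, smul_sub]
  refine ⟨⟨_, hE, fun E hE' => ?_⟩, fun x => ?_⟩
  · rw [← huniq E hE', NonsymMacdonald.rename_rev_rename_rev]
  -- `polyE` is a choice that satisfies `IsE` only once existence is known; the rescaled partition
  -- function supplies it.
  · have hpoly : NonsymMacdonald.polyF q t μ = F :=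
      huniq _ (Classical.epsilon_spec (p := NonsymMacdonald.IsE q t fun i => μ i.rev) ⟨_, hE⟩)
    rw [hpoly, hF, MvPolynomial.smul_eval, heval]
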